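/- **Setting.** Write $\hat f(\xi)=\int_{\mathbb R}e^{-ix\xi}f(x)\,dx$ (extended to $L^2(\mathbb R)$ by Plancherel). For $s\ge 0$ let $H^s(\mathbb R)$ be the space of complex-valued $f\in L^2(\mathbb R)$ with $\|f\|_{H^s}=\big(\int_{\mathbb R}(1+|\xi|^2)^s|\hat f(\xi)|^2\,d\xi\big)^{1/2}<\infty$. For $t\in\mathbb R$ and an integer $N\ge1$ put $$\mathcal B_t^Nf(x)=\frac1{2\pi}\int_{\mathbb R}e^{-|\xi|^2/N^2}e^{ix\xi}e^{it|\xi|\sqrt{1+|\xi|^2}}\hat f(\xi)\,d\xi ,\qquad \mathcal B_tf(x)=\lim_{N\to\infty}\mathcal B_t^Nf(x),$$ the latter wherever the limit exists in $\mathbb C$; the value of $f\in H^s(\mathbb R)$ at a point is understood as $f(x)=\mathcal B_0f(x)$. The statement "$\lim_{t\to0}\mathcal B_tf(x)=f(x)$" means that $\mathcal B_tf(x)$ exists for all $t$ in a neighbourhood of $0$, including $t=0$, and tends to $\mathcal B_0f(x)$ as $t\to0$. The divergence set $D(f)$ is the set of all $x\in\mathbb R$ at which this fails, and $$\alpha_{1,\mathcal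 B}(s)=\sup_{f\in H^s(\mathbb R)}\dim_H D(f).$$ For $0<\alpha\le1$ let $c_\alpha(\mu)=\sup_{x\in\mathbb R,\,r>0}r^{-\alpha}\mu\big((x-r,x+r)\big)$, and let $M^\alpha(\mathbb B)$ be the set of all Borel probability measures $\mu$ on $\mathbb R$ with $\mu(\mathbb R\setminus(-1,1))=0$ and $c_\alpha(\mu)<\infty$. Finally let $\bar\alpha_{1,\mathcal B}(s)$ be the infimum of all $\alpha\in(0,1]$ for which there is a constant $C$ such that $$\Big\|\sup_{k\in\mathbb N,\;N\ge1}\big|\mathcal B_{t_k}^Nf\big|\Big\|_{L^1(d\mu)}\le C\sqrt{c_\alpha(\mu)}\,\|f\|_{H^s(\mathbb R)}\qquad(*)$$ for all $\mu\in M^\alpha(\mathbb B)$, all $f\in H^s(\mathbb R)$ and all sequences $(t_k)$ in $(0,\infty)$ (and $\bar\alpha_{1,\mathcal B}(s)=\infty$ if there is no such $\alpha$). **Theorem 1.10.** Let $\frac14\le s\le\frac12$. (i) For every $\alpha>1-2s$ there is a constant $C$, depending only on $s$ and $\alpha$, such that $(*)$ holds for all $\mu\in M^\alpha(\mathbb B)$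 (so $\alpha\le1$), all real sequences $(t_k)$ with $\lim_{k\to\infty}t_k=0$, and all $f\in H^s(\mathbb R)$. (ii) $\bar\alpha_{1,\mathcal B}(s)=1-2s=\alpha_{1,\mathcal B}(s)$. -/

import Mathlib

open MeasureTheory Filter Topology
open scoped ENNReal NNReal FourierTransform

noncomputable section

namespace Boussinesq

/-- Complex-valued `L²` functions on the real line (modulo equality almost everywhere). -/
abbrev LTwo : Type := Lp ℂ 2 (volume : Measure ℝ)

/-- The `L²` Fourier transform in the normalization `f̂(ξ) = ∫ e^{-ixξ} f(x) dx`.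
Mathlib's (Plancherel) transform is normalized with `e^{-2πixξ}`, hence the rescaling. -/
def hat (f : LTwo) (ξ : ℝ) : ℂ :=
  (𝓕 f : LTwo) (ξ / (2 * Real.pi))

/-- The Sobolev norm `(∫ (1 + ξ²)^s |f̂(ξ)|² dξ)^{1/2}`, possibly infinite. -/
def sobolevNorm (s : ℝ) (f : LTwo) : ℝ≥0∞ :=
  (∫⁻ ξ : ℝ, ENNReal.ofReal ((1 + |ξ| ^ 2) ^ s) * ‖hat f ξ‖ₑ ^ 2) ^ (1 / 2 : ℝ)

/-- The Sobolev space `H^s(ℝ)` for `s ≥ 0`: the `L²` functions of finite Sobolev norm. -/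
def sobolevSpace (s : ℝ) : Set LTwo :=
  {f | sobolevNorm s f < ∞}

/-- The Gaussian cut-off `ψ(r) = e^{-r²}`. -/
def psi (r : ℝ) : ℝ := Real.exp (-r ^ 2)

/-- The truncated Boussinesq operator
`B_t^N f(x) = (2π)⁻¹ ∫ ψ(|ξ|/N) e^{ixξ} e^{it|ξ|√(1+|ξ|²)} f̂(ξ) dξ`, for `N ≥ 1`.
The integrand is integrable since `f̂` is square integrable. -/
def truncated (N : ℕ) (t : ℝ) (f : LTwo) (x : ℝ) : ℂ :=
  ((2 * Real.pi)⁻¹ : ℝ) *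
    ∫ ξ : ℝ, (psi (|ξ| / N) : ℂ) * Complex.exp (Complex.I * (x * ξ : ℝ)) *
      Complex.exp (Complex.I * (t * (|ξ| * √(1 + |ξ| ^ 2)) : ℝ)) * hat f ξ

/-- `sup_{k, N} |B_{t_k}^N f(x)|`, the supremum over all `k` and all integers `N ≥ 1`. -/
def maximal (t : ℕ → ℝ) (f : LTwo) (x : ℝ) : ℝ≥0∞ :=
  ⨆ (k : ℕ) (N : ℕ+), ‖truncated N (t k) f x‖ₑ

/-- `c_α(μ) = sup_{x, r > 0} r^{-α} μ(B(x, r))`. -/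
def densityConst (α : ℝ) (μ : Measure ℝ) : ℝ≥0∞ :=
  ⨆ (x : ℝ) (r : ℝ) (_ : 0 < r), ENNReal.ofReal (r ^ (-α)) * μ (Metric.ball x r)

/-- The class `M^α(𝔹)`, for `0 < α ≤ 1`, of the `α`-dimensional Borel probability measures
supported in the unit ball `𝔹 = B(0, 1)` of `ℝ`. -/
structure IsDimensional (α : ℝ) (μ : Measure ℝ) : Prop where
  pos : 0 < α
  le_one : α ≤ 1
  isProbabilityMeasure : IsProbabilityMeasure μ
  supported : μ (Metric.ball (0 : ℝ) 1)ᶜ = 0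
  densityConst_lt_top : densityConst α μ < ∞

/-- The exponents `α ∈ (0, 1]` for which
`‖sup_{k, N} |B_{t_k}^N f|‖_{L¹(dμ)} ≤ C √(c_α(μ)) ‖f‖_{H^s}` holds, with one constant `C`, for all
`μ ∈ M^α(𝔹)`, all `f ∈ H^s(ℝ)` and all sequences `t_k ∈ (0, ∞)`. -/
def admissibleExponents (s : ℝ) : Set ℝ :=
  {α | 0 < α ∧ α ≤ 1 ∧ ∃ C : ℝ≥0, ∀ μ : Measure ℝ, IsDimensional α μ →
    ∀ f ∈ sobolevSpace s, ∀ t : ℕ → ℝ, (∀ k, 0 < t k) →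
      ∫⁻ x, maximal t f x ∂μ ≤ C * densityConst α μ ^ (1 / 2 : ℝ) * sobolevNorm s f}

/-- `ᾱ_{1,B}(s)`, the infimum of the admissible exponents (`∞` if there is none). -/
def alphaBar (s : ℝ) : ℝ≥0∞ :=
  ⨅ α ∈ admissibleExponents s, ENNReal.ofReal α

/-- `lim_{t → 0} B_t f(x) = f(x)`. Elements of `H^s(ℝ)` are classes of functions, so both sides are
understood through the truncated operators, `B_t f(x) = lim_{N → ∞} B_t^N f(x)` and
`f(x) = B_0 f(x)`: these limits (the values `u t`) must exist for all `t` near `0`, including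
`t = 0`, and `u t → u 0` as `t → 0`. -/
def ConvergesAt (f : LTwo) (x : ℝ) : Prop :=
  ∃ u : ℝ → ℂ,
    (∀ᶠ t in 𝓝 (0 : ℝ), Tendsto (fun N : ℕ => truncated N t f x) atTop (𝓝 (u t))) ∧
    Tendsto u (𝓝[≠] 0) (𝓝 (u 0))

/-- The set of the points where `lim_{t → 0} B_t f(x) = f(x)` fails. -/
def divergenceSet (f : LTwo) : Set ℝ :=
  {x | ¬ ConvergesAt f x}

/-- `α_{1,B}(s)`, the supremum over `f ∈ H^s(ℝ)` of the Hausdorff dimension of the divergence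
set. -/
def alphaDiv (s : ℝ) : ℝ≥0∞ :=
  ⨆ f ∈ sobolevSpace s, dimH (divergenceSet f)

end Boussinesq

end

/-! Everything rests on one oscillatory integral. Composing the linearized operator with its adjoint
gives the kernel `K(x, t) = ∫ e^{i(xξ + t|ξ|√(1+ξ²))} e^{-cξ²} (1+ξ²)^{-s} dξ`. For `1/4 ≤ s < 1/2`,
`x ≠ 0` and `|x| ≤ 2` it satisfies `|K(x, t)| ≤ C |x|^{-(1-2s)}`, uniformly in `t` and `c > 0`
(`norm_integral_kernelFull_le`). Frequencies below `2/|x|` are estimated by absolute values, the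
others by van der Corput's lemma; for `|t| < x²` the region of possible stationary points is what
forces `s ≥ 1/4`.

Replacing the supremum by measurable choices `N(x)`, `t(x)` and dualizing, the square of the maximal
estimate reduces to bounding the energy `∬ |x-y|^{-(1-2s)} dμ dμ`, which is at most a constant times
`c_α(μ)` as soon as `α > 1-2s` (`exists_linearized_maximal_le`, `exists_maximal_estimate`). The
endpoint `s = 1/2` follows from slightly smaller `s`. This gives (i) and the upper bound for the
exponent of the maximal estimate.

For the divergence set, frequencies are cut into bounded annuli with energy of order `16^{-m}`. On
an annulus the kernel is blind to distances below the reciprocal of its outer radius, so the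
estimate may be tested on finitely supported measures that have the right growth only above that
scale. A discrete Frostman construction (`exists_discrete_frostman`) provides such measures on any
set, with no measurability requirement, and yields dyadic covers of the set where the `m`-th piece
reaches `2^{-m}` for some time and truncation (`exists_cover_levelSet`). Their sizes sum to
`O(4^{-m})`. By Borel–Cantelli almost every point, in the sense of `α`-dimensional Hausdorff
measure, lies in finitely many of these sets, and there the series of pieces converges uniformly in
time (`dimH_divergenceSet_le`).

Both lower bounds come from one function. For `0 < α < 1-2s` let `μ` be a Cantor measure of
dimension `α` and superpose its Gaussian mollifications at scales `δ = 2^{-j}` with weights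
`δ^{1-α}`. Every scale contributes at least a fixed amount on the Cantor set, so the truncations at
time `0` tend to infinity there, while the Sobolev norm stays finite (`exists_blowup`). The maximal
function is then infinite `μ`-almost everywhere, and the divergence set contains a set carrying `μ`,
so its dimension is at least `α` by the mass distribution principle. -/

namespace Boussinesq

/-! ### Oscillatory integrals with a decreasing weight -/

/-- A phase `θ` with `θ' = p`, `θ'' = q`, and a decreasing weight `w` with `w' = v`,
on the half-line `[a, ∞)`. -/
structure PhaseWeight (a : ℝ) (θ p q w v : ℝ → ℝ) : Prop where
  hasDerivAt_phase : ∀ ξ, HasDerivAt θ (p ξ) ξ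
  hasDerivAt_deriv : ∀ ξ, HasDerivAt p (q ξ) ξ
  continuous_second : Continuous q
  second_nonneg : ∀ ξ, a ≤ ξ → 0 ≤ q ξ
  hasDerivAt_weight : ∀ ξ, HasDerivAt w (v ξ) ξ
  continuous_weightDeriv : Continuous v
  weightDeriv_nonpos : ∀ ξ, a ≤ ξ → v ξ ≤ 0
  weight_nonneg : ∀ ξ, 0 ≤ w ξ
  weight_anti : ∀ ξ η, a ≤ ξ → ξ ≤ η → w η ≤ w ξ

namespace PhaseWeight

variable {a : ℝ} {θ p q w v : ℝ → ℝ}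

theorem continuous_phase (h : PhaseWeight a θ p q w v) : Continuous θ :=
  continuous_iff_continuousAt.2 fun ξ => (h.hasDerivAt_phase ξ).continuousAt

theorem continuous_deriv (h : PhaseWeight a θ p q w v) : Continuous p :=
  continuous_iff_continuousAt.2 fun ξ => (h.hasDerivAt_deriv ξ).continuousAt

theorem continuous_weight (h : PhaseWeight a θ p q w v) : Continuous w :=
  continuous_iff_continuousAt.2 fun ξ => (h.hasDerivAt_weight ξ).continuousAt

theorem continuous_integrand (h : PhaseWeight a θ p q w v) :
    Continuous fun ξ => Complex.exp (Complex.I * (θ ξ : ℝ)) * (w ξ : ℂ) := by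
  have h1 := h.continuous_phase
  have h2 := h.continuous_weight
  fun_prop

theorem norm_integrand (h : PhaseWeight a θ p q w v) (ξ : ℝ) :
    ‖Complex.exp (Complex.I * (θ ξ : ℝ)) * (w ξ : ℂ)‖ = w ξ := by
  rw [norm_mul, mul_comm Complex.I, Complex.norm_exp_ofReal_mul_I, one_mul, Complex.norm_real,
    Real.norm_of_nonneg (h.weight_nonneg ξ)]

/-- Van der Corput's first derivative test. -/
theorem norm_integral_le_of_le_abs_deriv (h : PhaseWeight a θ p q w v) {A B l : ℝ} (haA : a ≤ A)
    (hAB : A ≤ B) (hl : 0 < l)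
    (hp : (∀ ξ ∈ Set.Icc A B, l ≤ p ξ) ∨ ∀ ξ ∈ Set.Icc A B, p ξ ≤ -l) :
    ‖∫ ξ in A..B, Complex.exp (Complex.I * (θ ξ : ℝ)) * (w ξ : ℂ)‖ ≤ 3 * w A / l := by
  have habs : ∀ ξ ∈ Set.Icc A B, l ≤ |p ξ| := by
    rcases hp with hp | hp
    · exact fun ξ hξ => (hp ξ hξ).trans (le_abs_self _)
    · exact fun ξ hξ => (by linarith [hp ξ hξ] : l ≤ -p ξ).trans (neg_le_abs _)
  have hne : ∀ ξ ∈ Set.Icc A B, p ξ ≠ 0 := fun ξ hξ h0 => by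
    have := habs ξ hξ
    rw [h0, abs_zero] at this
    linarith
  -- Since `q ≥ 0`, the total variation of `1/p` telescopes to this difference. It involves two
  -- numbers of the same sign and modulus at most `1/l`, so it does not cost `2/l`.
  have hinv : (p A)⁻¹ - (p B)⁻¹ ≤ l⁻¹ := by
    rcases hp with hp | hp
    · have h1 := inv_anti₀ hl (hp A ⟨le_rfl, hAB⟩)
      have h2 : 0 ≤ (p B)⁻¹ := inv_nonneg.2 (hl.le.trans (hp B ⟨hAB, le_rfl⟩))
      linarith
    · have h1 : (p A)⁻¹ ≤ 0 := inv_nonpos.2 (by linarith [hp A ⟨le_rfl, hAB⟩])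
      have h2 := inv_anti₀ hl (by linarith [hp B ⟨hAB, le_rfl⟩] : l ≤ -p B)
      rw [inv_neg] at h2
      linarith
  have hcθ := h.continuous_phase
  have hcp := h.continuous_deriv
  have hcw := h.continuous_weight
  have hcq := h.continuous_second
  have hcv := h.continuous_weightDeriv
  set e : ℝ → ℂ := fun ξ => Complex.exp (Complex.I * (θ ξ : ℝ)) with he
  have hce : Continuous e := by fun_prop
  have hne' : ∀ ξ, ‖e ξ‖ = 1 := fun ξ => by
    rw [he]; simp only; rw [mul_comm, Complex.norm_exp_ofReal_mul_I]
  set r : ℝ → ℝ := fun ξ => (v ξ * p ξ - w ξ * q ξ) / p ξ ^ 2 with hr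
  have hrc : ContinuousOn r (Set.Icc A B) :=
    ContinuousOn.div (by fun_prop) (by fun_prop) fun ξ hξ => pow_ne_zero _ (hne ξ hξ)
  -- Integration by parts: `e^{iθ} w` is, up to the factor `i`, the derivative of `e^{iθ} w/p` minus
  -- `e^{iθ} (w/p)'`, and `r = (w/p)'`.
  have hG : ∀ ξ ∈ Set.uIcc A B, HasDerivAt (fun ξ => e ξ * ((w ξ / p ξ : ℝ) : ℂ))
      (Complex.I * (e ξ * w ξ) + e ξ * (r ξ : ℂ)) ξ := by
    intro ξ hξ
    rw [Set.uIcc_of_le hAB] at hξ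
    have h1 : HasDerivAt e (e ξ * (Complex.I * (p ξ : ℝ))) ξ :=
      ((h.hasDerivAt_phase ξ).ofReal_comp.const_mul Complex.I).cexp
    have h2 : HasDerivAt (fun ξ => ((w ξ / p ξ : ℝ) : ℂ)) (r ξ : ℂ) ξ :=
      ((h.hasDerivAt_weight ξ).div (h.hasDerivAt_deriv ξ) (hne ξ hξ)).ofReal_comp
    refine (h1.mul h2).congr_deriv ?_
    have : (p ξ : ℂ) ≠ 0 := by exact_mod_cast hne ξ hξ
    push_cast
    field_simp
  have hrei : IntervalIntegrable (fun ξ => e ξ * (r ξ : ℂ)) volume A B := by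
    refine ContinuousOn.intervalIntegrable ?_
    rw [Set.uIcc_of_le hAB]
    exact hce.continuousOn.mul (Complex.continuous_ofReal.comp_continuousOn hrc)
  have hwi : IntervalIntegrable (fun ξ => Complex.I * (e ξ * w ξ)) volume A B :=
    Continuous.intervalIntegrable (by fun_prop) _ _
  have hmain := intervalIntegral.integral_eq_sub_of_hasDerivAt hG (hwi.add hrei)
  rw [intervalIntegral.integral_add hwi hrei, intervalIntegral.integral_const_mul] at hmain
  -- The derivative shown here majorizes `|(w/p)'|`. Its integral is `(w A - w B)/l + w A (1/p A -
  -- 1/p B)`; with the boundary terms `w A/l + w B/l` the total is at most `3 w A/l`.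
  have hH : ∀ ξ ∈ Set.uIcc A B, HasDerivAt (fun ξ => -(w ξ / l) - w A * (p ξ)⁻¹)
      (-(v ξ / l) + w A * (q ξ / p ξ ^ 2)) ξ := by
    intro ξ hξ
    rw [Set.uIcc_of_le hAB] at hξ
    refine (((h.hasDerivAt_weight ξ).div_const l).neg.sub
      (((h.hasDerivAt_deriv ξ).inv (hne ξ hξ)).const_mul (w A))).congr_deriv ?_
    ring
  have hHi : IntervalIntegrable (fun ξ => -(v ξ / l) + w A * (q ξ / p ξ ^ 2)) volume A B := by
    refine ContinuousOn.intervalIntegrable ?_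
    rw [Set.uIcc_of_le hAB]
    exact ContinuousOn.add (by fun_prop) (continuousOn_const.mul
      (ContinuousOn.div (by fun_prop) (by fun_prop) fun ξ hξ => pow_ne_zero _ (hne ξ hξ)))
  have hbound : ‖∫ ξ in A..B, e ξ * (r ξ : ℂ)‖ ≤
      ∫ ξ in A..B, (-(v ξ / l) + w A * (q ξ / p ξ ^ 2)) := by
    refine intervalIntegral.norm_integral_le_of_norm_le hAB
      (Eventually.of_forall fun ξ hξ => ?_) hHi
    have hξ' : ξ ∈ Set.Icc A B := Set.Ioc_subset_Icc_self hξ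
    have hp0 : 0 < |p ξ| := abs_pos.2 (hne ξ hξ')
    rw [norm_mul, hne', one_mul, Complex.norm_real, Real.norm_eq_abs]
    have e1 : r ξ = v ξ / p ξ - w ξ * (q ξ / p ξ ^ 2) := by
      simp only [hr]
      have := hne ξ hξ'
      field_simp
    have haξ := haA.trans hξ'.1
    have hq0 : 0 ≤ q ξ / p ξ ^ 2 := div_nonneg (h.second_nonneg ξ haξ) (sq_nonneg _)
    have e2 : |v ξ / p ξ| ≤ -(v ξ / l) := by
      rw [abs_div, abs_of_nonpos (h.weightDeriv_nonpos ξ haξ), ← neg_div]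
      exact div_le_div_of_nonneg_left (neg_nonneg.2 (h.weightDeriv_nonpos ξ haξ)) hl (habs ξ hξ')
    have e3 : |w ξ * (q ξ / p ξ ^ 2)| ≤ w A * (q ξ / p ξ ^ 2) := by
      rw [abs_of_nonneg (mul_nonneg (h.weight_nonneg ξ) hq0)]
      exact mul_le_mul_of_nonneg_right (h.weight_anti A ξ haA hξ'.1) hq0
    rw [e1]
    exact (abs_sub _ _).trans (add_le_add e2 e3)
  rw [intervalIntegral.integral_eq_sub_of_hasDerivAt hH hHi] at hbound
  have hGb : ∀ ξ ∈ Set.Icc A B, ‖e ξ * ((w ξ / p ξ : ℝ) : ℂ)‖ ≤ w ξ / l := by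
    intro ξ hξ
    rw [norm_mul, hne', one_mul, Complex.norm_real, Real.norm_eq_abs, abs_div,
      abs_of_nonneg (h.weight_nonneg ξ)]
    exact div_le_div_of_nonneg_left (h.weight_nonneg ξ) hl (habs ξ hξ)
  have hI : ‖∫ ξ in A..B, e ξ * (w ξ : ℂ)‖ = ‖Complex.I * ∫ ξ in A..B, e ξ * (w ξ : ℂ)‖ := by
    rw [norm_mul, Complex.norm_I, one_mul]
  rw [hI, eq_sub_of_add_eq hmain]
  have hA := hGb A ⟨le_rfl, hAB⟩
  have hB := hGb B ⟨hAB, le_rfl⟩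
  have hlast : w A * ((p A)⁻¹ - (p B)⁻¹) ≤ w A / l := by
    rw [div_eq_mul_inv]
    exact mul_le_mul_of_nonneg_left hinv (h.weight_nonneg A)
  have e4 : 3 * w A / l = w A / l + w A / l + w A / l := by ring
  rw [e4]
  refine (norm_sub_le _ _).trans ((add_le_add (norm_sub_le _ _) hbound).trans ?_)
  nlinarith

theorem norm_integral_le_length (h : PhaseWeight a θ p q w v) {A B : ℝ} (haA : a ≤ A)
    (hAB : A ≤ B) :
    ‖∫ ξ in A..B, Complex.exp (Complex.I * (θ ξ : ℝ)) * (w ξ : ℂ)‖ ≤ w A * (B - A) := by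
  refine (intervalIntegral.norm_integral_le_of_norm_le_const (C := w A) fun ξ hξ => ?_).trans_eq ?_
  · rw [Set.uIoc_of_le hAB] at hξ
    rw [h.norm_integrand]
    exact h.weight_anti A ξ haA hξ.1.le
  · rw [abs_of_nonneg (sub_nonneg.2 hAB)]

/-- Van der Corput's second derivative test. -/
theorem norm_integral_le_of_le_second_deriv (h : PhaseWeight a θ p q w v) {A B l : ℝ}
    (haA : a ≤ A) (hAB : A ≤ B) (hl : 0 < l) (hq : ∀ ξ, a ≤ ξ → l ≤ q ξ) :
    ‖∫ ξ in A..B, Complex.exp (Complex.I * (θ ξ : ℝ)) * (w ξ : ℂ)‖ ≤ 8 * w A / √l := by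
  have hgrow : ∀ x y, a ≤ x → x ≤ y → l * (y - x) ≤ p y - p x := by
    intro x y hx hxy
    refine (convex_Ici a).mul_sub_le_image_sub_of_le_deriv h.continuous_deriv.continuousOn
      (fun ξ _ => (h.hasDerivAt_deriv ξ).differentiableAt.differentiableWithinAt)
      (fun ξ hξ => ?_) x hx y (hx.trans hxy) hxy
    rw [(h.hasDerivAt_deriv ξ).deriv]
    exact hq ξ (interior_subset hξ)
  -- The stationary point of the phase, or an endpoint if `p` keeps its sign; each sign condition is
  -- needed only if something is left on that side.
  obtain ⟨c, hcA, hcB, hc1, hc2⟩ : ∃ c, A ≤ c ∧ c ≤ B ∧ (c < B → 0 ≤ p c) ∧ (A < c → p c ≤ 0) := by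
    by_cases h1 : 0 ≤ p A
    · exact ⟨A, le_rfl, hAB, fun _ => h1, fun h => absurd h (lt_irrefl _)⟩
    by_cases h2 : p B ≤ 0
    · exact ⟨B, hAB, le_rfl, fun h => absurd h (lt_irrefl _), fun _ => h2⟩
    push Not at h1 h2
    obtain ⟨c, hc, hc0⟩ := intermediate_value_Icc hAB h.continuous_deriv.continuousOn
      (Set.mem_Icc.2 ⟨h1.le, h2.le⟩)
    exact ⟨c, hc.1, hc.2, fun _ => hc0.ge, fun _ => hc0.le⟩
  -- At distance `η` from `c` the derivative has grown to `lη = √l`, so the two outer pieces cost `3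
  -- w A/√l` each by the first derivative test, and the middle one costs its length `2η`. Hence `8 =
  -- 3 + 2 + 3`.
  set η : ℝ := (√l)⁻¹ with hη
  have hs : 0 < √l := Real.sqrt_pos.2 hl
  have hη0 : 0 < η := inv_pos.2 hs
  have hlη : l * η = √l := by
    rw [hη, ← div_eq_mul_inv, Real.div_sqrt]
  set c₁ := max A (c - η) with hc₁
  set c₂ := min B (c + η) with hc₂
  have hA1 : A ≤ c₁ := le_max_left _ _
  have h12 : c₁ ≤ c₂ := max_le (le_min hAB (by linarith)) (le_min (by linarith) (by linarith))
  have h2B : c₂ ≤ B := min_le_left _ _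
  have hwA := h.weight_nonneg A
  have b1 : ‖∫ ξ in A..c₁, Complex.exp (Complex.I * (θ ξ : ℝ)) * (w ξ : ℂ)‖ ≤ 3 * w A / √l := by
    rcases hA1.eq_or_lt with h0 | h0
    · rw [← h0, intervalIntegral.integral_same, norm_zero]
      positivity
    · have hce : c₁ = c - η := by
        rcases max_choice A (c - η) with h' | h'
        · rw [hc₁, h'] at h0; exact absurd h0 (lt_irrefl _)
        · rw [hc₁, h']
      have hAc : A < c := by linarith
      refine h.norm_integral_le_of_le_abs_deriv haA hA1 hs (Or.inr fun ξ hξ => ?_)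
      have hξ2 : ξ ≤ c - η := hce ▸ hξ.2
      have := hgrow ξ c (haA.trans hξ.1) (by linarith)
      have h3 : l * η ≤ l * (c - ξ) := mul_le_mul_of_nonneg_left (by linarith) hl.le
      linarith [hc2 hAc]
  have b2 : ‖∫ ξ in c₁..c₂, Complex.exp (Complex.I * (θ ξ : ℝ)) * (w ξ : ℂ)‖ ≤ 2 * w A / √l := by
    refine (h.norm_integral_le_length (haA.trans hA1) h12).trans ?_
    have h3 : c₂ - c₁ ≤ 2 * η := by
      have := min_le_right B (c + η)
      have := le_max_right A (c - η)
      linarith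
    calc w c₁ * (c₂ - c₁) ≤ w A * (2 * η) :=
          mul_le_mul (h.weight_anti A c₁ haA hA1) h3 (by linarith) hwA
      _ = 2 * w A / √l := by rw [hη]; ring
  have b3 : ‖∫ ξ in c₂..B, Complex.exp (Complex.I * (θ ξ : ℝ)) * (w ξ : ℂ)‖ ≤ 3 * w A / √l := by
    rcases h2B.eq_or_lt with h0 | h0
    · rw [h0, intervalIntegral.integral_same, norm_zero]
      positivity
    · have hce : c₂ = c + η := by
        rcases min_choice B (c + η) with h' | h'
        · rw [hc₂, h'] at h0; exact absurd h0 (lt_irrefl _)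
        · rw [hc₂, h']
      have hcB' : c < B := by linarith
      refine (h.norm_integral_le_of_le_abs_deriv (haA.trans (hA1.trans h12)) h2B hs
        (Or.inl fun ξ hξ => ?_)).trans ?_
      · have hξ2 : c + η ≤ ξ := hce ▸ hξ.1
        have := hgrow c ξ (haA.trans hcA) (by linarith)
        have h3 : l * η ≤ l * (ξ - c) := mul_le_mul_of_nonneg_left (by linarith) hl.le
        linarith [hc1 hcB']
      · have := h.weight_anti A c₂ haA (hA1.trans h12)
        gcongr
  have hint : ∀ x y, IntervalIntegrable
      (fun ξ => Complex.exp (Complex.I * (θ ξ : ℝ)) * (w ξ : ℂ)) volume x y :=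
    fun x y => h.continuous_integrand.intervalIntegrable x y
  rw [← intervalIntegral.integral_add_adjacent_intervals (hint A c₁) (hint c₁ B),
    ← intervalIntegral.integral_add_adjacent_intervals (hint c₁ c₂) (hint c₂ B)]
  refine (norm_add_le _ _).trans ((add_le_add b1 ((norm_add_le _ _).trans (add_le_add b2 b3))).trans
    (le_of_eq ?_))
  ring

end PhaseWeight

/-! ### The kernel of `T T*` -/

/-- The weight `e^{-cξ²} (1 + ξ²)^{-s}`. -/
noncomputable def kernelWeight (c s ξ : ℝ) : ℝ :=
  Real.exp (-(c * ξ ^ 2)) * (1 + ξ ^ 2) ^ (-s)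

theorem kernelWeight_nonneg (c s ξ : ℝ) : 0 ≤ kernelWeight c s ξ := by
  unfold kernelWeight; positivity

theorem kernelWeight_neg (c s ξ : ℝ) : kernelWeight c s (-ξ) = kernelWeight c s ξ := by
  simp [kernelWeight]

theorem kernelWeight_anti {c s : ℝ} (hc : 0 ≤ c) (hs : 0 ≤ s) {ξ η : ℝ} (hξ : 0 ≤ ξ)
    (h : ξ ≤ η) : kernelWeight c s η ≤ kernelWeight c s ξ := by
  have h2 : ξ ^ 2 ≤ η ^ 2 := pow_le_pow_left₀ hξ h 2
  unfold kernelWeight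
  refine mul_le_mul (Real.exp_le_exp.2 ?_) ?_ (by positivity) (by positivity)
  · exact neg_le_neg (mul_le_mul_of_nonneg_left h2 hc)
  · exact Real.rpow_le_rpow_of_nonpos (by positivity) (by linarith) (by linarith)

theorem kernelWeight_le {c s : ℝ} (hc : 0 ≤ c) (hs : 0 ≤ s) {ξ : ℝ} (hξ : 0 < ξ) :
    kernelWeight c s ξ ≤ ξ ^ (-(2 * s)) := by
  unfold kernelWeight
  have h1 : Real.exp (-(c * ξ ^ 2)) ≤ 1 := Real.exp_le_one_iff.2 (by nlinarith [sq_nonneg ξ])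
  have h2 : (1 + ξ ^ 2) ^ (-s) ≤ (ξ ^ 2) ^ (-s) :=
    Real.rpow_le_rpow_of_nonpos (by positivity) (by linarith) (by linarith)
  have h3 : (ξ ^ 2) ^ (-s) = ξ ^ (-(2 * s)) := by
    rw [← Real.rpow_natCast, ← Real.rpow_mul hξ.le]
    congr 1
    push_cast
    ring
  calc _ ≤ 1 * (ξ ^ 2) ^ (-s) := mul_le_mul h1 h2 (by positivity) zero_le_one
    _ = _ := by rw [one_mul, h3]

theorem hasDerivAt_kernelWeight (c s ξ : ℝ) :
    HasDerivAt (kernelWeight c s)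
      (-(2 * c * ξ + 2 * s * ξ / (1 + ξ ^ 2)) * kernelWeight c s ξ) ξ := by
  have hpos : 0 < 1 + ξ ^ 2 := by positivity
  have h1 : HasDerivAt (fun ξ : ℝ => Real.exp (-(c * ξ ^ 2)))
      (Real.exp (-(c * ξ ^ 2)) * -(c * (2 * ξ))) ξ := by
    have := (((hasDerivAt_pow 2 ξ).const_mul c).neg).exp
    simpa using this
  have h2 : HasDerivAt (fun ξ : ℝ => (1 + ξ ^ 2) ^ (-s))
      (2 * ξ * -s * (1 + ξ ^ 2) ^ (-s - 1)) ξ := by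
    have := ((hasDerivAt_pow 2 ξ).const_add 1).rpow_const (p := -s) (Or.inl hpos.ne')
    simpa using this
  refine (h1.mul h2).congr_deriv ?_
  rw [Real.rpow_sub_one hpos.ne']
  unfold kernelWeight
  field_simp
  ring

theorem continuous_kernelWeight (c s : ℝ) : Continuous (kernelWeight c s) :=
  continuous_iff_continuousAt.2 fun ξ => (hasDerivAt_kernelWeight c s ξ).continuousAt

/-! ### The Boussinesq phase and its derivatives. -/

/-- The Boussinesq phase on positive frequencies. -/
noncomputable def phase (ξ : ℝ) : ℝ := ξ * √(1 + ξ ^ 2)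

/-- The first derivative of `phase`. -/
noncomputable def phaseDeriv (ξ : ℝ) : ℝ := (1 + 2 * ξ ^ 2) / √(1 + ξ ^ 2)

/-- The second derivative of `phase`. -/
noncomputable def phaseSecond (ξ : ℝ) : ℝ := ξ * (3 + 2 * ξ ^ 2) / ((1 + ξ ^ 2) * √(1 + ξ ^ 2))

theorem hasDerivAt_sqrt_one_add_sq (ξ : ℝ) :
    HasDerivAt (fun ξ : ℝ => √(1 + ξ ^ 2)) (ξ / √(1 + ξ ^ 2)) ξ := by
  have hpos : 0 < 1 + ξ ^ 2 := by positivity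
  have := ((hasDerivAt_pow 2 ξ).const_add 1).sqrt hpos.ne'
  refine this.congr_deriv ?_
  field_simp
  simp

theorem hasDerivAt_phase (ξ : ℝ) : HasDerivAt phase (phaseDeriv ξ) ξ := by
  have hpos : 0 < √(1 + ξ ^ 2) := by positivity
  refine ((hasDerivAt_id ξ).mul (hasDerivAt_sqrt_one_add_sq ξ)).congr_deriv ?_
  unfold phaseDeriv
  have := Real.sq_sqrt (by positivity : 0 ≤ 1 + ξ ^ 2)
  simp only [id]
  field_simp
  rw [this]
  ring

theorem hasDerivAt_phaseDeriv (ξ : ℝ) : HasDerivAt phaseDeriv (phaseSecond ξ) ξ := by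
  have hpos : 0 < √(1 + ξ ^ 2) := by positivity
  have hpos' : 0 < 1 + ξ ^ 2 := by positivity
  have h1 : HasDerivAt (fun ξ : ℝ => 1 + 2 * ξ ^ 2) (2 * (2 * ξ)) ξ := by
    have := ((hasDerivAt_pow 2 ξ).const_mul 2).const_add (1 : ℝ)
    simpa using this
  refine (h1.div (hasDerivAt_sqrt_one_add_sq ξ) hpos.ne').congr_deriv ?_
  unfold phaseSecond
  have h2 := Real.sq_sqrt hpos'.le
  field_simp
  rw [h2]
  ring

theorem continuous_phaseSecond : Continuous phaseSecond := by
  unfold phaseSecond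
  refine Continuous.div (by fun_prop) (by fun_prop) fun ξ => ?_
  positivity

theorem phaseSecond_nonneg {ξ : ℝ} (h : 0 ≤ ξ) : 0 ≤ phaseSecond ξ := by
  unfold phaseSecond; positivity

theorem sqrt_one_add_sq_le {ξ : ℝ} (h : 1 ≤ ξ) : √(1 + ξ ^ 2) ≤ 3 / 2 * ξ := by
  rw [Real.sqrt_le_left (by linarith)]
  nlinarith

/-- The second derivative vanishes at the origin, so the second derivative test is available only
away from it; this is why high frequencies are taken at least `1`. -/
theorem one_le_phaseSecond {ξ : ℝ} (h : 1 ≤ ξ) : 1 ≤ phaseSecond ξ := by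
  unfold phaseSecond
  have := sqrt_one_add_sq_le h
  rw [one_le_div (by positivity)]
  calc (1 + ξ ^ 2) * √(1 + ξ ^ 2) ≤ (1 + ξ ^ 2) * (3 / 2 * ξ) :=
        mul_le_mul_of_nonneg_left this (by positivity)
    _ ≤ ξ * (3 + 2 * ξ ^ 2) := by nlinarith [mul_nonneg (by linarith : 0 ≤ ξ) (sq_nonneg ξ)]

theorem phaseDeriv_nonneg (ξ : ℝ) : 0 ≤ phaseDeriv ξ := by
  unfold phaseDeriv; positivity

theorem phaseDeriv_le {ξ : ℝ} (h : 1 ≤ ξ) : phaseDeriv ξ ≤ 3 * ξ := by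
  unfold phaseDeriv
  have h1 := sqrt_one_add_sq_le h
  have h2 := Real.sq_sqrt (by positivity : 0 ≤ 1 + ξ ^ 2)
  rw [div_le_iff₀ (by positivity)]
  nlinarith [Real.sqrt_nonneg (1 + ξ ^ 2)]

/-- Convexity of the phase requires `t ≥ 0`; negative times are recovered by complex conjugation. -/
theorem phaseWeight_kernel {c s t : ℝ} (hc : 0 ≤ c) (hs : 0 ≤ s) (ht : 0 ≤ t) (x : ℝ) {a : ℝ}
    (ha : 0 ≤ a) :
    PhaseWeight a (fun ξ => x * ξ + t * phase ξ) (fun ξ => x + t * phaseDeriv ξ)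
      (fun ξ => t * phaseSecond ξ) (kernelWeight c s)
      (fun ξ => -(2 * c * ξ + 2 * s * ξ / (1 + ξ ^ 2)) * kernelWeight c s ξ) where
  hasDerivAt_phase ξ := by
    have := ((hasDerivAt_id ξ).const_mul x).add ((hasDerivAt_phase ξ).const_mul t)
    refine this.congr_deriv ?_
    ring
  hasDerivAt_deriv ξ := ((hasDerivAt_phaseDeriv ξ).const_mul t).const_add x
  continuous_second := continuous_const.mul continuous_phaseSecond
  second_nonneg ξ hξ := mul_nonneg ht (phaseSecond_nonneg (ha.trans hξ))
  hasDerivAt_weight := hasDerivAt_kernelWeight c s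
  continuous_weightDeriv := by
    have := continuous_kernelWeight c s
    refine Continuous.mul (Continuous.neg (Continuous.add (by fun_prop)
      (Continuous.div (by fun_prop) (by fun_prop) fun ξ => ?_))) this
    positivity
  weightDeriv_nonpos ξ hξ := by
    have h0 : 0 ≤ ξ := ha.trans hξ
    have : 0 ≤ (2 * c * ξ + 2 * s * ξ / (1 + ξ ^ 2)) * kernelWeight c s ξ :=
      mul_nonneg (by positivity) (kernelWeight_nonneg c s ξ)
    linarith
  weight_nonneg := kernelWeight_nonneg c s
  weight_anti ξ η hξ h := kernelWeight_anti hc hs (ha.trans hξ) h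

/-! ### Bounds for the one-sided kernel. -/

/-- The integrand of the kernel on positive frequencies. -/
noncomputable def kernelFun (c s x t ξ : ℝ) : ℂ :=
  Complex.exp (Complex.I * (x * ξ + t * phase ξ : ℝ)) * (kernelWeight c s ξ : ℂ)

theorem norm_kernelFun (c s x t ξ : ℝ) : ‖kernelFun c s x t ξ‖ = kernelWeight c s ξ := by
  rw [kernelFun, norm_mul, mul_comm Complex.I, Complex.norm_exp_ofReal_mul_I, one_mul,
    Complex.norm_real, Real.norm_of_nonneg (kernelWeight_nonneg c s ξ)]

theorem continuous_phase : Continuous phase := by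
  unfold phase; fun_prop

theorem continuous_kernelFun (c s x t : ℝ) : Continuous (kernelFun c s x t) := by
  unfold kernelFun
  have h1 := continuous_phase
  have h2 := continuous_kernelWeight c s
  fun_prop

/-- No oscillation is used: the weight is at most `ξ^{-2s}`, which is integrable at `0` because `2s
< 1`. -/
theorem norm_integral_kernelFun_le_rpow {c s : ℝ} (hc : 0 ≤ c) (hs : 0 ≤ s) (hs' : s < 1 / 2)
    (x t : ℝ) {a b : ℝ} (ha : 0 ≤ a) (hab : a ≤ b) :
    ‖∫ ξ in a..b, kernelFun c s x t ξ‖ ≤ b ^ (1 - 2 * s) / (1 - 2 * s) := by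
  have hi : ∀ x y : ℝ, IntervalIntegrable (fun ξ : ℝ => ξ ^ (-(2 * s))) volume x y :=
    fun x y => intervalIntegral.intervalIntegrable_rpow' (by linarith)
  refine (intervalIntegral.norm_integral_le_of_norm_le hab
    (Eventually.of_forall fun ξ hξ => ?_) (hi a b)).trans ?_
  · rw [norm_kernelFun]
    exact kernelWeight_le hc hs (ha.trans_lt hξ.1)
  · rw [integral_rpow (Or.inl (by linarith)), show -(2 * s) + 1 = 1 - 2 * s by ring]
    have : 0 ≤ a ^ (1 - 2 * s) := Real.rpow_nonneg ha _
    exact div_le_div_of_nonneg_right (by linarith) (by linarith)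

/-- If `t ≥ x²`, the second derivative test alone suffices. If `t < x²`, the phase derivative `x +
tφ'(ξ)` can vanish only for `ξ ≳ |x|/t`; below `|x|/(6t)` the first derivative test applies, and
above it the second, with a weight that has become small. As `φ' ≤ 3ξ`, the constant `6` keeps `tφ'`
below `|x|/2` up to the cut. -/
theorem norm_integral_kernelFun_high {c s t : ℝ} (hc : 0 ≤ c) (hs : 1 / 4 ≤ s) (hs' : s < 1 / 2)
    (ht : 0 ≤ t) {x : ℝ} (hx : x ≠ 0) (hx2 : |x| ≤ 2) {a b : ℝ} (ha : 2 / |x| ≤ a)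
    (hab : a ≤ b) :
    ‖∫ ξ in a..b, kernelFun c s x t ξ‖ ≤ 60 * |x| ^ (-(1 - 2 * s)) := by
  have hx0 : 0 < |x| := abs_pos.2 hx
  have ha1 : 1 ≤ a := le_trans (by rw [le_div_iff₀ hx0]; linarith) ha
  have h := phaseWeight_kernel hc (by linarith : 0 ≤ s) ht x (zero_le_one' ℝ)
  have hwa : ∀ y, a ≤ y → kernelWeight c s y ≤ |x| ^ (2 * s) := by
    intro y hy
    have hy0 : 0 < y := by linarith
    refine (kernelWeight_le hc (by linarith) hy0).trans ?_
    rw [Real.rpow_neg hy0.le, ← Real.inv_rpow hy0.le]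
    refine Real.rpow_le_rpow (by positivity) ?_ (by linarith)
    rw [inv_le_comm₀ hy0 hx0]
    calc |x|⁻¹ ≤ 2 / |x| := by
          rw [inv_eq_one_div]; exact div_le_div_of_nonneg_right (by norm_num) hx0.le
      _ ≤ y := ha.trans hy
  have hpow : |x| ^ (2 * s) / |x| = |x| ^ (-(1 - 2 * s)) := by
    rw [← Real.rpow_sub_one hx0.ne']
    congr 1; ring
  have hX : 0 ≤ |x| ^ (-(1 - 2 * s)) := Real.rpow_nonneg hx0.le _
  have second : 0 < t → ∀ y z, a ≤ y → y ≤ z →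
      ‖∫ ξ in y..z, kernelFun c s x t ξ‖ ≤ 8 * kernelWeight c s y / √t := by
    intro ht' y z hy hyz
    refine h.norm_integral_le_of_le_second_deriv (ha1.trans hy) hyz ht' fun ξ hξ => ?_
    exact le_mul_of_one_le_right ht (one_le_phaseSecond hξ)
  -- In this case `1/√t ≤ 1/|x|` and the weight at `a ≥ 2/|x|` is at most `|x|^{2s}`.
  by_cases hcase : x ^ 2 ≤ t
  · have ht' : 0 < t := lt_of_lt_of_le (by positivity) hcase
    have hsq : |x| ≤ √t := by rw [← Real.sqrt_sq_eq_abs]; exact Real.sqrt_le_sqrt hcase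
    calc _ ≤ 8 * kernelWeight c s a / √t := second ht' a b le_rfl hab
      _ ≤ 8 * |x| ^ (2 * s) / |x| := by
          have := hwa a le_rfl
          gcongr
      _ = 8 * |x| ^ (-(1 - 2 * s)) := by rw [mul_div_assoc, hpow]
      _ ≤ _ := by linarith
  push Not at hcase
  have first : ∀ z, a ≤ z → 6 * t * z ≤ |x| →
      ‖∫ ξ in a..z, kernelFun c s x t ξ‖ ≤ 6 * |x| ^ (-(1 - 2 * s)) := by
    intro z hz hzt
    have hp : ∀ ξ ∈ Set.Icc a z, t * phaseDeriv ξ ≤ |x| / 2 := by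
      intro ξ hξ
      have h1 := phaseDeriv_le (ha1.trans hξ.1)
      have h2 : t * phaseDeriv ξ ≤ t * (3 * z) :=
        mul_le_mul_of_nonneg_left (h1.trans (by linarith [hξ.2])) ht
      linarith
    have hp0 : ∀ ξ, 0 ≤ t * phaseDeriv ξ := fun ξ => mul_nonneg ht (phaseDeriv_nonneg ξ)
    refine (h.norm_integral_le_of_le_abs_deriv ha1 hz (half_pos hx0) ?_).trans ?_
    · rcases lt_or_gt_of_ne hx with hneg | hpos
      · refine Or.inr fun ξ hξ => ?_
        have := hp ξ hξ
        rw [abs_of_neg hneg] at this ⊢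
        linarith
      · refine Or.inl fun ξ hξ => ?_
        have := hp0 ξ
        rw [abs_of_pos hpos]
        linarith
    · calc 3 * kernelWeight c s a / (|x| / 2) = 6 * (kernelWeight c s a / |x|) := by
            field_simp; ring
        _ ≤ 6 * (|x| ^ (2 * s) / |x|) := by
            have := hwa a le_rfl
            gcongr
        _ = _ := by rw [hpow]
  -- Here the weight is at most `(6t/|x|)^{2s}`, so the second derivative test gives `t^{2s-1/2}
  -- |x|^{-2s}` up to a constant. Because `2s - 1/2 ≥ 0`, the power of `t` may be replaced by the
  -- same power of `x²`: this is where `s ≥ 1/4` is decisive.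
  have tail : ∀ y, a ≤ y → y ≤ b → |x| ≤ 6 * t * y →
      ‖∫ ξ in y..b, kernelFun c s x t ξ‖ ≤ 48 * |x| ^ (-(1 - 2 * s)) := by
    intro y hy hyb hty
    have hy0 : 0 < y := by linarith
    have ht' : 0 < t := by
      rcases ht.eq_or_lt with h0 | h0
      · rw [← h0] at hty; simp at hty; exact absurd hty hx
      · exact h0
    refine (second ht' y b hy hyb).trans ?_
    have h1 : kernelWeight c s y ≤ (6 * t / |x|) ^ (2 * s) := by
      refine (kernelWeight_le hc (by linarith) hy0).trans ?_
      rw [Real.rpow_neg hy0.le, ← Real.inv_rpow hy0.le]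
      refine Real.rpow_le_rpow (by positivity) ?_ (by linarith)
      rw [inv_le_comm₀ hy0 (by positivity), inv_div, div_le_iff₀ (by positivity)]
      linarith
    have h2 : (6 * t / |x|) ^ (2 * s) ≤ 6 * (t ^ (2 * s) / |x| ^ (2 * s)) := by
      rw [Real.div_rpow (by positivity) hx0.le, Real.mul_rpow (by norm_num) ht, mul_div_assoc]
      refine mul_le_mul_of_nonneg_right ?_ (by positivity)
      calc (6 : ℝ) ^ (2 * s) ≤ 6 ^ (1 : ℝ) :=
            Real.rpow_le_rpow_of_exponent_le (by norm_num) (by linarith)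
        _ = 6 := Real.rpow_one 6
    have h3 : t ^ (2 * s) / √t ≤ |x| ^ (4 * s - 1) := by
      rw [Real.sqrt_eq_rpow, ← Real.rpow_sub ht']
      calc t ^ (2 * s - 1 / 2) ≤ (|x| ^ 2) ^ (2 * s - 1 / 2) :=
            Real.rpow_le_rpow ht (by rw [sq_abs]; exact hcase.le) (by linarith)
        _ = |x| ^ (4 * s - 1) := by
            rw [← Real.rpow_natCast, ← Real.rpow_mul hx0.le]
            congr 1; push_cast; ring
    calc 8 * kernelWeight c s y / √t ≤ 8 * (6 * (t ^ (2 * s) / |x| ^ (2 * s))) / √t := by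
          have := h1.trans h2
          gcongr
      _ = 48 * (t ^ (2 * s) / √t / |x| ^ (2 * s)) := by ring
      _ ≤ 48 * (|x| ^ (4 * s - 1) / |x| ^ (2 * s)) := by gcongr
      _ = _ := by
          rw [← Real.rpow_sub hx0]
          congr 2; ring
  rcases le_total (6 * t * b) |x| with hb | hb
  · exact (first b hab hb).trans (by linarith)
  rcases le_total |x| (6 * t * a) with hA | hA
  · exact (tail a le_rfl hab hA).trans (by linarith)
  have ht' : 0 < t := by
    rcases ht.eq_or_lt with h0 | h0
    · rw [← h0] at hb; simp at hb; exact absurd hb hx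
    · exact h0
  have hm : 6 * t * (|x| / (6 * t)) = |x| := by field_simp
  have hma : a ≤ |x| / (6 * t) := by rw [le_div_iff₀ (by positivity)]; linarith
  have hmb : |x| / (6 * t) ≤ b := by rw [div_le_iff₀ (by positivity)]; linarith
  have hint : ∀ y z, IntervalIntegrable (kernelFun c s x t) volume y z :=
    fun y z => (continuous_kernelFun c s x t).intervalIntegrable y z
  rw [← intervalIntegral.integral_add_adjacent_intervals (hint a (|x| / (6 * t))) (hint _ b)]
  refine (norm_add_le _ _).trans ((add_le_add (first _ hma hm.le)
    (tail _ hma hmb hm.ge)).trans ?_)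
  linarith

/-- The frequency `2/|x|` separates the trivial estimate from the oscillatory one; it is at least
`1` because `|x| ≤ 2`. -/
theorem norm_integral_kernelFun_le_of_nonneg {c s t : ℝ} (hc : 0 ≤ c) (hs : 1 / 4 ≤ s)
    (hs' : s < 1 / 2) (ht : 0 ≤ t) {x : ℝ} (hx : x ≠ 0) (hx2 : |x| ≤ 2) {a b : ℝ} (ha : 0 ≤ a)
    (hab : a ≤ b) :
    ‖∫ ξ in a..b, kernelFun c s x t ξ‖ ≤ (2 / (1 - 2 * s) + 60) * |x| ^ (-(1 - 2 * s)) := by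
  have hx0 : 0 < |x| := abs_pos.2 hx
  have hX : 0 ≤ |x| ^ (-(1 - 2 * s)) := Real.rpow_nonneg hx0.le _
  have hβ : 0 < 1 - 2 * s := by linarith
  have hL : (2 / |x|) ^ (1 - 2 * s) / (1 - 2 * s) ≤ 2 / (1 - 2 * s) * |x| ^ (-(1 - 2 * s)) := by
    rw [Real.div_rpow (by norm_num) hx0.le, Real.rpow_neg hx0.le]
    have : (2 : ℝ) ^ (1 - 2 * s) ≤ 2 := by
      calc (2 : ℝ) ^ (1 - 2 * s) ≤ 2 ^ (1 : ℝ) :=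
            Real.rpow_le_rpow_of_exponent_le (by norm_num) (by linarith)
        _ = 2 := Real.rpow_one 2
    calc _ = (2 : ℝ) ^ (1 - 2 * s) / (1 - 2 * s) * (|x| ^ (1 - 2 * s))⁻¹ := by ring
      _ ≤ _ := by gcongr
  have low : ∀ z, a ≤ z → z ≤ 2 / |x| →
      ‖∫ ξ in a..z, kernelFun c s x t ξ‖ ≤ 2 / (1 - 2 * s) * |x| ^ (-(1 - 2 * s)) := by
    intro z haz hz
    refine (norm_integral_kernelFun_le_rpow hc (by linarith) hs' x t ha haz).trans
      (le_trans ?_ hL)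
    exact div_le_div_of_nonneg_right (Real.rpow_le_rpow (ha.trans haz) hz hβ.le) hβ.le
  have h2 : 0 ≤ 2 / (1 - 2 * s) * |x| ^ (-(1 - 2 * s)) := by positivity
  rw [add_mul]
  rcases le_total b (2 / |x|) with hb | hb
  · exact (low b hab hb).trans (by linarith)
  rcases le_total (2 / |x|) a with hA | hA
  · exact (norm_integral_kernelFun_high hc hs hs' ht hx hx2 hA hab).trans (by linarith)
  have hint : ∀ y z, IntervalIntegrable (kernelFun c s x t) volume y z :=
    fun y z => (continuous_kernelFun c s x t).intervalIntegrable y z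
  rw [← intervalIntegral.integral_add_adjacent_intervals (hint a (2 / |x|)) (hint _ b)]
  exact (norm_add_le _ _).trans (add_le_add (low _ hA le_rfl)
    (norm_integral_kernelFun_high hc hs hs' ht hx hx2 le_rfl hb))

theorem conj_kernelFun (c s x t ξ : ℝ) :
    (starRingEnd ℂ) (kernelFun c s x t ξ) = kernelFun c s (-x) (-t) ξ := by
  unfold kernelFun
  rw [map_mul, ← Complex.exp_conj, map_mul, Complex.conj_I, Complex.conj_ofReal,
    Complex.conj_ofReal]
  congr 2
  push_cast
  ring

theorem norm_integral_kernelFun_le {c s t : ℝ} (hc : 0 ≤ c) (hs : 1 / 4 ≤ s)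
    (hs' : s < 1 / 2) {x : ℝ} (hx : x ≠ 0) (hx2 : |x| ≤ 2) {a b : ℝ} (ha : 0 ≤ a)
    (hab : a ≤ b) :
    ‖∫ ξ in a..b, kernelFun c s x t ξ‖ ≤ (2 / (1 - 2 * s) + 60) * |x| ^ (-(1 - 2 * s)) := by
  rcases le_total 0 t with ht | ht
  · exact norm_integral_kernelFun_le_of_nonneg hc hs hs' ht hx hx2 ha hab
  · have h := norm_integral_kernelFun_le_of_nonneg hc hs hs' (neg_nonneg.2 ht) (neg_ne_zero.2 hx)
      (by rwa [abs_neg]) ha hab (x := -x)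
    rw [abs_neg] at h
    refine le_of_eq_of_le ?_ h
    rw [← RCLike.norm_conj, intervalIntegral.integral_of_le hab, ← integral_conj,
      intervalIntegral.integral_of_le hab]
    simp only [conj_kernelFun]

/-! ### The two-sided kernel, on annuli and on the whole line. -/

/-- The frequencies `a ≤ |ξ| < b`. -/
def annulus (a b : ℝ) : Set ℝ := {ξ | a ≤ |ξ| ∧ |ξ| < b}

theorem measurableSet_annulus (a b : ℝ) : MeasurableSet (annulus a b) :=
  (measurableSet_le (measurable_const (a := a)) (measurable_id.abs)).inter
    (measurableSet_lt (measurable_id.abs) (measurable_const (a := b)))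

theorem annulus_subset_Ioo (a b : ℝ) : annulus a b ⊆ Set.Ioo (-b) b :=
  fun _ h => abs_lt.1 h.2

theorem volume_annulus_lt_top (a b : ℝ) : volume (annulus a b) < ∞ :=
  (measure_mono (annulus_subset_Ioo a b)).trans_lt (by simp)

/-- The integrand of the kernel. -/
noncomputable def kernelFull (c s x t ξ : ℝ) : ℂ :=
  Complex.exp (Complex.I * (x * ξ + t * (|ξ| * √(1 + |ξ| ^ 2)) : ℝ)) * (kernelWeight c s ξ : ℂ)

theorem continuous_kernelFull (c s x t : ℝ) : Continuous (kernelFull c s x t) := by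
  unfold kernelFull
  have h2 := continuous_kernelWeight c s
  fun_prop

theorem norm_kernelFull (c s x t ξ : ℝ) : ‖kernelFull c s x t ξ‖ = kernelWeight c s ξ := by
  rw [kernelFull, norm_mul, mul_comm Complex.I, Complex.norm_exp_ofReal_mul_I, one_mul,
    Complex.norm_real, Real.norm_of_nonneg (kernelWeight_nonneg c s ξ)]

theorem kernelFull_of_nonneg (c s x t : ℝ) {ξ : ℝ} (h : 0 ≤ ξ) :
    kernelFull c s x t ξ = kernelFun c s x t ξ := by
  rw [kernelFull, kernelFun, phase, abs_of_nonneg h]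

theorem kernelFull_neg (c s x t : ℝ) {ξ : ℝ} (h : 0 ≤ ξ) :
    kernelFull c s x t (-ξ) = kernelFun c s (-x) t ξ := by
  rw [kernelFull, kernelFun, phase, abs_neg, abs_of_nonneg h, kernelWeight_neg, neg_mul_comm]

/-- The time phase and the weight are even in the frequency, so reflecting negative frequencies only
changes the sign of `x`. -/
theorem setIntegral_annulus_kernelFull (c s x t : ℝ) {a b : ℝ} (ha : 0 ≤ a) (hab : a ≤ b) :
    ∫ ξ in annulus a b, kernelFull c s x t ξ =
      (∫ ξ in a..b, kernelFun c s x t ξ) + ∫ ξ in a..b, kernelFun c s (-x) t ξ := by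
  have hint : IntegrableOn (kernelFull c s x t) (annulus a b) :=
    ((continuous_kernelFull c s x t).integrableOn_Icc (a := -b) (b := b)).mono_set
      ((annulus_subset_Ioo a b).trans Set.Ioo_subset_Icc_self)
  rw [← integral_inter_add_sdiff (measurableSet_Ici (a := (0 : ℝ))) hint]
  congr 1
  · have h1 : annulus a b ∩ Set.Ici 0 = Set.Ico a b := by
      ext ξ
      simp only [annulus, Set.mem_inter_iff, Set.mem_ofPred_eq, Set.mem_Ici, Set.mem_Ico]
      constructor
      · rintro ⟨h, h0⟩
        rwa [abs_of_nonneg h0] at h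
      · intro h
        have h0 := ha.trans h.1
        exact ⟨by rwa [abs_of_nonneg h0], h0⟩
    rw [h1, integral_Ico_eq_integral_Ioc, intervalIntegral.integral_of_le hab]
    exact setIntegral_congr_fun measurableSet_Ioc fun ξ hξ =>
      kernelFull_of_nonneg c s x t (ha.trans hξ.1.le)
  -- Equality can fail at `0`, when `a = 0`; hence only almost everywhere.
  · have h1 : (annulus a b \ Set.Ici 0 : Set ℝ) =ᵐ[volume] Set.Ioc (-b) (-a) := by
      filter_upwards [compl_mem_ae_iff.2 (measure_singleton (0 : ℝ))] with ξ hξ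
      have hξ0 : ξ ≠ 0 := hξ
      apply propext
      change ((a ≤ |ξ| ∧ |ξ| < b) ∧ ¬ (0 ≤ ξ)) ↔ (-b < ξ ∧ ξ ≤ -a)
      constructor
      · rintro ⟨h, h0⟩
        push Not at h0
        rw [abs_of_neg h0] at h
        constructor <;> linarith
      · intro h
        have h0 : ξ < 0 := lt_of_le_of_ne (by linarith) hξ0
        rw [abs_of_neg h0]
        refine ⟨⟨?_, ?_⟩, ?_⟩ <;> linarith
    rw [setIntegral_congr_set h1, ← intervalIntegral.integral_of_le (by linarith),
      ← intervalIntegral.integral_comp_neg]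
    refine intervalIntegral.integral_congr fun ξ hξ => ?_
    rw [Set.uIcc_of_le hab] at hξ
    exact kernelFull_neg c s x t (ha.trans hξ.1)

theorem norm_setIntegral_annulus_le {c s : ℝ} (hc : 0 ≤ c) (hs : 1 / 4 ≤ s) (hs' : s < 1 / 2)
    (t : ℝ) {x : ℝ} (hx : x ≠ 0) (hx2 : |x| ≤ 2) {a b : ℝ} (ha : 0 ≤ a) (hab : a ≤ b) :
    ‖∫ ξ in annulus a b, kernelFull c s x t ξ‖ ≤
      2 * (2 / (1 - 2 * s) + 60) * |x| ^ (-(1 - 2 * s)) := by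
  rw [setIntegral_annulus_kernelFull c s x t ha hab]
  have h1 := norm_integral_kernelFun_le hc hs hs' hx hx2 ha hab (t := t)
  have h2 := norm_integral_kernelFun_le hc hs hs' (neg_ne_zero.2 hx) (by rwa [abs_neg]) ha hab
    (t := t) (x := -x)
  rw [abs_neg] at h2
  refine (norm_add_le _ _).trans ((add_le_add h1 h2).trans (le_of_eq ?_))
  ring

theorem norm_setIntegral_annulus_le_rpow {c s : ℝ} (hc : 0 ≤ c) (hs : 0 ≤ s) (hs' : s < 1 / 2)
    (x t : ℝ) {a b : ℝ} (ha : 0 ≤ a) (hab : a ≤ b) :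
    ‖∫ ξ in annulus a b, kernelFull c s x t ξ‖ ≤
      2 / (1 - 2 * s) * b ^ (1 - 2 * s) := by
  rw [setIntegral_annulus_kernelFull c s x t ha hab]
  refine (norm_add_le _ _).trans ((add_le_add
    (norm_integral_kernelFun_le_rpow hc hs hs' x t ha hab)
    (norm_integral_kernelFun_le_rpow hc hs hs' (-x) t ha hab)).trans (le_of_eq ?_))
  ring

theorem integrable_kernelFull {c s : ℝ} (hc : 0 < c) (hs : 0 ≤ s) (x t : ℝ) :
    Integrable (kernelFull c s x t) := by
  refine (integrable_exp_neg_mul_sq hc).mono' (continuous_kernelFull c s x t).aestronglyMeasurable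
    (Eventually.of_forall fun ξ => ?_)
  rw [norm_kernelFull, kernelWeight, neg_mul]
  exact mul_le_of_le_one_right (Real.exp_pos _).le
    (Real.rpow_le_one_of_one_le_of_nonpos (by nlinarith [sq_nonneg ξ]) (by linarith))

theorem norm_integral_kernelFull_le {c s : ℝ} (hc : 0 < c) (hs : 1 / 4 ≤ s) (hs' : s < 1 / 2)
    (t : ℝ) {x : ℝ} (hx : x ≠ 0) (hx2 : |x| ≤ 2) :
    ‖∫ ξ, kernelFull c s x t ξ‖ ≤ 2 * (2 / (1 - 2 * s) + 60) * |x| ^ (-(1 - 2 * s)) := by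
  have hU : (⋃ n : ℕ, annulus 0 n) = Set.univ := by
    refine Set.eq_univ_of_forall fun ξ => Set.mem_iUnion.2 ?_
    obtain ⟨n, hn⟩ := exists_nat_gt |ξ|
    exact ⟨n, abs_nonneg ξ, hn⟩
  have hlim := tendsto_setIntegral_of_monotone (μ := volume) (f := kernelFull c s x t)
    (fun n : ℕ => measurableSet_annulus 0 n)
    (fun m n hmn ξ hξ => ⟨hξ.1, hξ.2.trans_le (Nat.cast_le.2 hmn)⟩)
    (integrable_kernelFull hc (by linarith) x t).integrableOn
  rw [hU, Measure.restrict_univ] at hlim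
  exact le_of_tendsto hlim.norm (Eventually.of_forall fun n =>
    norm_setIntegral_annulus_le hc.le hs hs' t hx hx2 le_rfl n.cast_nonneg)

/-! ### The `T T*` inequality -/

/-- Expand the square of the inner integral as a double integral over `μ × μ` and apply Fubini; the
square-integrable majorant `g` makes the triple integral absolutely convergent. -/
theorem lintegral_sq_norm_integral_le {μ ν : Measure ℝ} [IsFiniteMeasure μ] [SFinite ν]
    {Ψ : ℝ → ℝ → ℂ} (hΨ : Measurable (Function.uncurry Ψ)) {g : ℝ → ℝ} (hg : MemLp g 2 ν)
    (hΨg : ∀ x ξ, ‖Ψ x ξ‖ ≤ g ξ) :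
    ∫⁻ ξ, ‖∫ x, Ψ x ξ ∂μ‖ₑ ^ 2 ∂ν ≤
      ∫⁻ x, ∫⁻ y, ‖∫ ξ, Ψ x ξ * (starRingEnd ℂ) (Ψ y ξ) ∂ν‖ₑ ∂μ ∂μ := by
  have hg0 : ∀ ξ, 0 ≤ g ξ := fun ξ => (norm_nonneg _).trans (hΨg 0 ξ)
  set G : ℝ → ℂ := fun ξ => ∫ x, Ψ x ξ ∂μ with hG
  have hGm : Measurable G := by
    have : Measurable (Function.uncurry fun ξ x => Ψ x ξ) := hΨ.comp measurable_swap
    exact this.stronglyMeasurable.integral_prod_right.measurable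
  have hGb : ∀ ξ, ‖G ξ‖ ≤ g ξ * μ.real Set.univ := fun ξ =>
    norm_integral_le_of_norm_le_const (Eventually.of_forall fun x => hΨg x ξ)
  have hGL : MemLp G 2 ν := by
    refine (hg.const_mul (μ.real Set.univ)).mono hGm.aestronglyMeasurable
      (Eventually.of_forall fun ξ => ?_)
    refine (hGb ξ).trans ?_
    rw [mul_comm]
    exact le_abs_self _
  have hg2 : Integrable (fun ξ => g ξ * g ξ) ν := hg.integrable_mul hg
  have hΨ1 : Measurable fun z : ℝ × ℝ × ℝ => Ψ z.2.1 z.1 :=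
    hΨ.comp ((measurable_fst.comp measurable_snd).prodMk measurable_fst)
  have hΨ2 : Measurable fun z : ℝ × ℝ × ℝ => (starRingEnd ℂ) (Ψ z.2.2 z.1) :=
    Complex.continuous_conj.measurable.comp
      (hΨ.comp ((measurable_snd.comp measurable_snd).prodMk measurable_fst))
  have hF3 : Integrable (Function.uncurry fun (ξ : ℝ) (z : ℝ × ℝ) =>
      Ψ z.1 ξ * (starRingEnd ℂ) (Ψ z.2 ξ)) (ν.prod (μ.prod μ)) := by
    refine (hg2.comp_fst (μ.prod μ)).mono' (hΨ1.mul hΨ2).aestronglyMeasurable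
      (Eventually.of_forall fun z => ?_)
    simp only [Function.uncurry]
    rw [norm_mul, RCLike.norm_conj]
    exact mul_le_mul (hΨg _ _) (hΨg _ _) (norm_nonneg _) (hg0 _)
  have hid : ((∫ ξ, ‖G ξ‖ ^ 2 ∂ν : ℝ) : ℂ) = ∫ z : ℝ × ℝ,
      ∫ ξ, Ψ z.1 ξ * (starRingEnd ℂ) (Ψ z.2 ξ) ∂ν ∂(μ.prod μ) := by
    rw [← integral_complex_ofReal]
    calc ∫ ξ, ((‖G ξ‖ ^ 2 : ℝ) : ℂ) ∂ν = ∫ ξ, ∫ z : ℝ × ℝ,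
          Ψ z.1 ξ * (starRingEnd ℂ) (Ψ z.2 ξ) ∂(μ.prod μ) ∂ν := by
          refine integral_congr_ae (Eventually.of_forall fun ξ => ?_)
          simp only
          rw [integral_prod_mul (fun x => Ψ x ξ) (fun y => (starRingEnd ℂ) (Ψ y ξ)),
            integral_conj, Complex.mul_conj, Complex.normSq_eq_norm_sq]
      _ = _ := integral_integral_swap hF3
  have hKm : Measurable fun z : ℝ × ℝ => ∫ ξ, Ψ z.1 ξ * (starRingEnd ℂ) (Ψ z.2 ξ) ∂ν := by
    have : StronglyMeasurable (Function.uncurry fun (z : ℝ × ℝ) (ξ : ℝ) =>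
        Ψ z.1 ξ * (starRingEnd ℂ) (Ψ z.2 ξ)) :=
      ((hΨ1.mul hΨ2).comp measurable_swap).stronglyMeasurable
    exact this.integral_prod_right.measurable
  calc ∫⁻ ξ, ‖G ξ‖ₑ ^ 2 ∂ν = ENNReal.ofReal (∫ ξ, ‖G ξ‖ ^ 2 ∂ν) := by
        rw [ofReal_integral_eq_lintegral_ofReal (hGL.integrable_norm_pow (by norm_num))
          (Eventually.of_forall fun ξ => by positivity)]
        refine lintegral_congr fun ξ => ?_
        rw [ENNReal.ofReal_pow (norm_nonneg _), ofReal_norm]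
    _ = ‖((∫ ξ, ‖G ξ‖ ^ 2 ∂ν : ℝ) : ℂ)‖ₑ := by
        rw [← ofReal_norm, Complex.norm_real, Real.norm_of_nonneg
          (integral_nonneg fun ξ => by positivity)]
    _ ≤ ∫⁻ z : ℝ × ℝ, ‖∫ ξ, Ψ z.1 ξ * (starRingEnd ℂ) (Ψ z.2 ξ) ∂ν‖ₑ ∂(μ.prod μ) := by
        rw [hid]
        exact enorm_integral_le_lintegral_enorm _
    _ = _ := lintegral_prod _ hKm.enorm.aemeasurable

/-- Duality: multiply `T x` by a phase `ε x` that makes it nonnegative, exchange the integrals, and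
apply Cauchy–Schwarz in `ξ`. The factor `ε` is absorbed into `Ψ` and disappears again once the
kernel is taken in absolute value. -/
theorem lintegral_norm_integral_le {μ ν : Measure ℝ} [IsFiniteMeasure μ] [SFinite ν]
    {Ψ : ℝ → ℝ → ℂ} (hΨ : Measurable (Function.uncurry Ψ)) {g : ℝ → ℝ} (hg : MemLp g 2 ν)
    (hΨg : ∀ x ξ, ‖Ψ x ξ‖ ≤ g ξ) {H : ℝ → ℂ} (hHm : Measurable H) (hH : MemLp H 2 ν) :
    ∫⁻ x, ‖∫ ξ, Ψ x ξ * H ξ ∂ν‖ₑ ∂μ ≤ (∫⁻ ξ, ‖H ξ‖ₑ ^ 2 ∂ν) ^ (1 / 2 : ℝ) *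
      (∫⁻ x, ∫⁻ y, ‖∫ ξ, Ψ x ξ * (starRingEnd ℂ) (Ψ y ξ) ∂ν‖ₑ ∂μ ∂μ) ^ (1 / 2 : ℝ) := by
  set T : ℝ → ℂ := fun x => ∫ ξ, Ψ x ξ * H ξ ∂ν with hT
  have hTm : Measurable T := by
    have : StronglyMeasurable (Function.uncurry fun x ξ => Ψ x ξ * H ξ) :=
      (hΨ.mul (hHm.comp measurable_snd)).stronglyMeasurable
    exact this.integral_prod_right.measurable
  -- Where `T x = 0`, division by zero gives `ε x = 0`, which is harmless.
  set ε : ℝ → ℂ := fun x => (starRingEnd ℂ) (T x) / ‖T x‖ with hε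
  have hεm : Measurable ε := by
    have : Measurable fun x => (starRingEnd ℂ) (T x) := Complex.continuous_conj.measurable.comp hTm
    exact this.div (Complex.measurable_ofReal.comp hTm.norm)
  have hε1 : ∀ x, ‖ε x‖ ≤ 1 := by
    intro x
    rw [hε]
    simp only [norm_div, RCLike.norm_conj, Complex.norm_real, norm_norm]
    exact div_self_le_one _
  have hεT : ∀ x, ε x * T x = (‖T x‖ : ℂ) := by
    intro x
    simp only [hε]
    by_cases h0 : T x = 0
    · simp [h0]
    · rw [div_mul_eq_mul_div, mul_comm, Complex.mul_conj, Complex.normSq_eq_norm_sq]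
      have : (‖T x‖ : ℂ) ≠ 0 := by exact_mod_cast norm_ne_zero_iff.2 h0
      push_cast
      field_simp
  have hgH : Integrable (fun ξ => g ξ * ‖H ξ‖) ν := hg.integrable_mul hH.norm
  have hgH2 : Integrable (fun z : ℝ × ℝ => g z.2 * ‖H z.2‖) (μ.prod ν) := hgH.comp_snd μ
  have hF1 : Integrable (fun z : ℝ × ℝ => Ψ z.1 z.2 * H z.2) (μ.prod ν) := by
    refine hgH2.mono' (hΨ.mul (hHm.comp measurable_snd)).aestronglyMeasurable
      (Eventually.of_forall fun z => ?_)
    rw [norm_mul]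
    exact mul_le_mul_of_nonneg_right (hΨg _ _) (norm_nonneg _)
  have hF2 : Integrable (Function.uncurry fun x ξ => ε x * Ψ x ξ * H ξ) (μ.prod ν) := by
    refine hgH2.mono' (((hεm.comp measurable_fst).mul hΨ).mul
      (hHm.comp measurable_snd)).aestronglyMeasurable (Eventually.of_forall fun z => ?_)
    simp only [Function.uncurry]
    rw [norm_mul, norm_mul]
    exact mul_le_mul_of_nonneg_right
      ((mul_le_of_le_one_left (norm_nonneg _) (hε1 _)).trans (hΨg _ _)) (norm_nonneg _)
  have hTi : Integrable T μ := hF1.integral_prod_left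
  set G : ℝ → ℂ := fun ξ => ∫ x, ε x * Ψ x ξ ∂μ with hG
  have hεΨ : Measurable (Function.uncurry fun ξ x => ε x * Ψ x ξ) :=
    (hεm.comp measurable_snd).mul (hΨ.comp measurable_swap)
  have hGm : Measurable G := hεΨ.stronglyMeasurable.integral_prod_right.measurable
  have hswap : ((∫ x, ‖T x‖ ∂μ : ℝ) : ℂ) = ∫ ξ, G ξ * H ξ ∂ν := by
    rw [← integral_complex_ofReal]
    calc ∫ x, (‖T x‖ : ℂ) ∂μ = ∫ x, ∫ ξ, ε x * Ψ x ξ * H ξ ∂ν ∂μ := by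
          refine integral_congr_ae (Eventually.of_forall fun x => ?_)
          simp only
          rw [← hεT, hT]
          simp only [mul_assoc]
          rw [integral_const_mul]
      _ = ∫ ξ, ∫ x, ε x * Ψ x ξ * H ξ ∂μ ∂ν := integral_integral_swap hF2
      _ = ∫ ξ, G ξ * H ξ ∂ν := by
          refine integral_congr_ae (Eventually.of_forall fun ξ => ?_)
          simp only [hG]
          rw [integral_mul_const]
  have hGsq : ∫⁻ ξ, ‖G ξ‖ₑ ^ 2 ∂ν ≤
      ∫⁻ x, ∫⁻ y, ‖∫ ξ, Ψ x ξ * (starRingEnd ℂ) (Ψ y ξ) ∂ν‖ₑ ∂μ ∂μ := by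
    have hεΨm : Measurable (Function.uncurry fun x ξ => ε x * Ψ x ξ) :=
      (hεm.comp measurable_fst).mul hΨ
    refine (lintegral_sq_norm_integral_le hεΨm hg fun x ξ => ?_).trans
      (lintegral_mono fun x => lintegral_mono fun y => ?_)
    · rw [norm_mul]
      exact (mul_le_of_le_one_left (norm_nonneg _) (hε1 _)).trans (hΨg _ _)
    · have : ∫ ξ, ε x * Ψ x ξ * (starRingEnd ℂ) (ε y * Ψ y ξ) ∂ν =
          ε x * (starRingEnd ℂ) (ε y) * ∫ ξ, Ψ x ξ * (starRingEnd ℂ) (Ψ y ξ) ∂ν := by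
        rw [← integral_const_mul]
        refine integral_congr_ae (Eventually.of_forall fun ξ => ?_)
        simp only [map_mul]
        ring
      simp only
      rw [this, enorm_mul]
      refine mul_le_of_le_one_left zero_le ?_
      rw [← ofReal_norm, norm_mul, RCLike.norm_conj]
      exact ENNReal.ofReal_le_one.2 (mul_le_one₀ (hε1 _) (norm_nonneg _) (hε1 _))
  calc ∫⁻ x, ‖T x‖ₑ ∂μ = ENNReal.ofReal (∫ x, ‖T x‖ ∂μ) :=
        (ofReal_integral_norm_eq_lintegral_enorm hTi).symm
    _ = ‖∫ ξ, G ξ * H ξ ∂ν‖ₑ := by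
        rw [← hswap, ← ofReal_norm, Complex.norm_real,
          Real.norm_of_nonneg (integral_nonneg fun x => norm_nonneg _)]
    _ ≤ ∫⁻ ξ, ‖H ξ‖ₑ * ‖G ξ‖ₑ ∂ν := by
        refine (enorm_integral_le_lintegral_enorm _).trans (lintegral_mono fun ξ => ?_)
        rw [enorm_mul, mul_comm]
    _ ≤ (∫⁻ ξ, ‖H ξ‖ₑ ^ (2 : ℝ) ∂ν) ^ (1 / 2 : ℝ) * (∫⁻ ξ, ‖G ξ‖ₑ ^ (2 : ℝ) ∂ν) ^ (1 / 2 : ℝ) :=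
        ENNReal.lintegral_mul_le_Lp_mul_Lq ν Real.HolderConjugate.two_two
          hHm.enorm.aemeasurable hGm.enorm.aemeasurable
    _ ≤ _ := by
        simp only [ENNReal.rpow_two]
        gcongr

/-! ### Potentials of measures of positive dimension -/

/-- For `u > 0` the single term with `4/2^k` comparable to `u` already dominates; at `u = 0` both
sides are infinite. The range `u < 4` accommodates `|x - y| + δ` with `|x - y| ≤ 2` and `δ ≤ 1`. -/
theorem ofReal_rpow_neg_le_tsum {β u : ℝ} (hβ : 0 < β) (hu : 0 ≤ u) (hu4 : u < 4) :
    ENNReal.ofReal u ^ (-β) ≤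
      ∑' k : ℕ, (Set.Iio (4 / 2 ^ k : ℝ)).indicator (fun _ => ENNReal.ofReal ((2 ^ β) ^ k)) u := by
  have h2β : (1 : ℝ) ≤ 2 ^ β := Real.one_le_rpow (by norm_num) hβ.le
  rcases hu.eq_or_lt with h0 | h0
  · rw [← h0, ENNReal.ofReal_zero, ENNReal.zero_rpow_of_neg (by linarith)]
    calc (⊤ : ℝ≥0∞) = ∑' _ : ℕ, 1 := (ENNReal.tsum_const_eq_top_of_ne_zero one_ne_zero).symm
      _ ≤ _ := by
        refine ENNReal.tsum_le_tsum fun k => ?_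
        rw [Set.indicator_of_mem (Set.mem_Iio.2 (by positivity))]
        exact ENNReal.one_le_ofReal.2 (one_le_pow₀ h2β)
  rw [ENNReal.ofReal_rpow_of_pos h0]
  rcases le_or_gt u 1 with h1 | h1
  · obtain ⟨k, hk1, hk2⟩ := exists_nat_pow_near ((one_le_div h0).2 h1) (by norm_num : (1 : ℝ) < 2)
    rw [div_lt_iff₀ h0] at hk2
    rw [le_div_iff₀ h0] at hk1
    have hp : (0 : ℝ) < 2 ^ (k + 1) := by positivity
    refine le_trans ?_ (ENNReal.le_tsum (k + 1))
    rw [Set.indicator_of_mem]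
    · refine ENNReal.ofReal_le_ofReal ?_
      rw [Real.rpow_neg h0.le, ← Real.inv_rpow h0.le, ← Real.rpow_natCast, ← Real.rpow_mul
        (by norm_num), mul_comm β, Real.rpow_mul (by norm_num), Real.rpow_natCast]
      refine Real.rpow_le_rpow (by positivity) ?_ hβ.le
      rw [inv_le_iff_one_le_mul₀ h0]
      exact hk2.le
    · rw [Set.mem_Iio, lt_div_iff₀ hp, pow_succ]
      linarith
  · refine le_trans ?_ (ENNReal.le_tsum 0)
    rw [Set.indicator_of_mem (by simpa using hu4)]
    refine ENNReal.ofReal_le_ofReal ?_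
    rw [pow_zero]
    exact Real.rpow_le_one_of_one_le_of_nonpos h1.le (by linarith)

/-- Summing over dyadic scales, `2^{βk} μ(B(x, 4/2^k))` is at most a multiple of `2^{(β-α)k}`, a
convergent geometric series. The shift by `δ` removes the scales up to `δ`, so ball growth is
demanded only above `δ`, which even point masses can satisfy. -/
theorem exists_lintegral_rpow_neg_le {α β : ℝ} (hβ : 0 < β) (hβα : β < α) :
    ∃ C : ℝ≥0, ∀ (μ : Measure ℝ) (δ : ℝ) (c : ℝ≥0∞), 0 ≤ δ → δ ≤ 1 →
      (∀ x r, δ < r → μ (Metric.ball x r) ≤ c * ENNReal.ofReal (r ^ α)) →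
      ∀ x, (∀ᵐ y ∂μ, |x - y| ≤ 2) →
        ∫⁻ y, ENNReal.ofReal (|x - y| + δ) ^ (-β) ∂μ ≤ C * c := by
  have hq0 : (0 : ℝ) ≤ 2 ^ (β - α) := by positivity
  have hq1 : (2 : ℝ) ^ (β - α) < 1 := Real.rpow_lt_one_of_one_lt_of_neg (by norm_num) (by linarith)
  have hsum : Summable fun k : ℕ => (4 : ℝ) ^ α * (2 ^ (β - α)) ^ k :=
    (summable_geometric_of_lt_one hq0 hq1).mul_left _
  refine ⟨(∑' k : ℕ, (4 : ℝ) ^ α * (2 ^ (β - α)) ^ k).toNNReal, ?_⟩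
  intro μ δ c hδ hδ1 hball x hx
  have hterm : ∀ k : ℕ, ENNReal.ofReal ((2 ^ β) ^ k) *
      μ {y | |x - y| + δ < 4 / 2 ^ k} ≤ c * ENNReal.ofReal ((4 : ℝ) ^ α * (2 ^ (β - α)) ^ k) := by
    intro k
    -- At scales not exceeding `δ` the set is empty, and nothing about `μ` is needed.
    rcases le_or_gt (4 / 2 ^ k : ℝ) δ with h | h
    · have : {y | |x - y| + δ < 4 / 2 ^ k} = ∅ := by
        refine Set.eq_empty_of_forall_notMem fun y hy => ?_
        have hy' : |x - y| + δ < 4 / 2 ^ k := hy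
        have := abs_nonneg (x - y)
        linarith
      rw [this, measure_empty, mul_zero]
      exact zero_le
    · have hsub : {y | |x - y| + δ < 4 / 2 ^ k} ⊆ Metric.ball x (4 / 2 ^ k) := by
        intro y hy
        have hy' : |x - y| + δ < 4 / 2 ^ k := hy
        rw [Metric.mem_ball, Real.dist_eq, abs_sub_comm]
        linarith
      calc _ ≤ ENNReal.ofReal ((2 ^ β) ^ k) * (c * ENNReal.ofReal ((4 / 2 ^ k) ^ α)) := by
            gcongr
            exact (measure_mono hsub).trans (hball x _ h)
        _ = c * (ENNReal.ofReal ((2 ^ β) ^ k) * ENNReal.ofReal ((4 / 2 ^ k) ^ α)) := by ring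
        _ = _ := by
            rw [← ENNReal.ofReal_mul (by positivity)]
            congr 2
            rw [Real.div_rpow (by norm_num) (by positivity), ← Real.rpow_natCast,
              ← Real.rpow_natCast, ← Real.rpow_natCast, ← Real.rpow_mul (by norm_num),
              ← Real.rpow_mul (by norm_num), ← Real.rpow_mul (by norm_num), mul_div_left_comm,
              ← Real.rpow_sub (by norm_num)]
            congr 2
            ring
  calc ∫⁻ y, ENNReal.ofReal (|x - y| + δ) ^ (-β) ∂μ
      ≤ ∫⁻ y, ∑' k : ℕ, ({y | |x - y| + δ < 4 / 2 ^ k} : Set ℝ).indicator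
          (fun _ => ENNReal.ofReal ((2 ^ β) ^ k)) y ∂μ := by
        refine lintegral_mono_ae ?_
        filter_upwards [hx] with y hy
        exact ofReal_rpow_neg_le_tsum hβ (add_nonneg (abs_nonneg _) hδ) (by linarith)
    _ = ∑' k : ℕ, ENNReal.ofReal ((2 ^ β) ^ k) * μ {y | |x - y| + δ < 4 / 2 ^ k} := by
        have hm : ∀ k : ℕ, MeasurableSet {y : ℝ | |x - y| + δ < 4 / 2 ^ k} := fun k =>
          measurableSet_lt (f := fun y : ℝ => |x - y| + δ) (by fun_prop) measurable_const
        rw [lintegral_tsum fun k => (measurable_const.indicator (hm k)).aemeasurable]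
        refine tsum_congr fun k => ?_
        rw [lintegral_indicator_const (hm k)]
    _ ≤ ∑' k : ℕ, c * ENNReal.ofReal ((4 : ℝ) ^ α * (2 ^ (β - α)) ^ k) :=
        ENNReal.tsum_le_tsum hterm
    _ = _ := by
        rw [ENNReal.tsum_mul_left, mul_comm,
          ← ENNReal.ofReal_tsum_of_nonneg (fun k => by positivity) hsum]
        rfl

/-! ### The linearized maximal estimate -/

/-- The oscillating factor of `truncated`. -/
noncomputable def osc (N : ℕ) (t x ξ : ℝ) : ℂ :=
  (psi (|ξ| / N) : ℂ) * Complex.exp (Complex.I * (x * ξ : ℝ)) *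
    Complex.exp (Complex.I * (t * (|ξ| * √(1 + |ξ| ^ 2)) : ℝ))

theorem truncated_eq (N : ℕ) (t : ℝ) (f : LTwo) (x : ℝ) :
    truncated N t f x = ((2 * Real.pi)⁻¹ : ℝ) * ∫ ξ : ℝ, osc N t x ξ * hat f ξ := rfl

theorem psi_nonneg (r : ℝ) : 0 ≤ psi r := (Real.exp_pos _).le

theorem psi_le_one (r : ℝ) : psi r ≤ 1 := by
  unfold psi
  exact Real.exp_le_one_iff.2 (by nlinarith [sq_nonneg r])

theorem continuous_psi : Continuous psi := by
  unfold psi; fun_prop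

theorem norm_osc (N : ℕ) (t x ξ : ℝ) : ‖osc N t x ξ‖ = psi (|ξ| / N) := by
  rw [osc, norm_mul, norm_mul, mul_comm Complex.I, Complex.norm_exp_ofReal_mul_I,
    mul_comm Complex.I, Complex.norm_exp_ofReal_mul_I, mul_one, mul_one, Complex.norm_real,
    Real.norm_of_nonneg (psi_nonneg _)]

theorem norm_osc_le_one (N : ℕ) (t x ξ : ℝ) : ‖osc N t x ξ‖ ≤ 1 := by
  rw [norm_osc]; exact psi_le_one _

theorem measurable_osc {N : ℝ → ℕ} {t : ℝ → ℝ} (hN : Measurable N) (ht : Measurable t) :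
    Measurable (Function.uncurry fun x ξ => osc (N x) (t x) x ξ) := by
  have hN' : Measurable fun z : ℝ × ℝ => ((N z.1 : ℕ) : ℝ) :=
    (measurable_from_top (f := fun n : ℕ => (n : ℝ))).comp (hN.comp measurable_fst)
  have ht' : Measurable fun z : ℝ × ℝ => t z.1 := ht.comp measurable_fst
  have hψ := continuous_psi.measurable
  unfold Function.uncurry osc
  refine Measurable.mul (Measurable.mul ?_ ?_) ?_
  · exact Complex.measurable_ofReal.comp (hψ.comp ((measurable_snd.abs).div hN'))
  · fun_prop
  · have : Measurable fun z : ℝ × ℝ => t z.1 * (|z.2| * √(1 + |z.2| ^ 2)) := by fun_prop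
    exact ((Complex.measurable_ofReal.comp this).const_mul Complex.I).cexp

theorem continuous_osc (N : ℕ) (t x : ℝ) : Continuous (osc N t x) := by
  have := continuous_psi
  unfold osc
  fun_prop

theorem psi_div_anti {M N : ℕ} (hM : 1 ≤ M) (h : M ≤ N) (ξ : ℝ) :
    psi (|ξ| / M) ≤ psi (|ξ| / N) := by
  unfold psi
  have hM' : (0 : ℝ) < M := by exact_mod_cast hM
  have hMN : (M : ℝ) ≤ N := by exact_mod_cast h
  refine Real.exp_le_exp.2 (neg_le_neg ?_)
  exact pow_le_pow_left₀ (by positivity)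
    (div_le_div_of_nonneg_left (abs_nonneg _) hM' hMN) 2

theorem psi_div_eq (N : ℕ) (ξ : ℝ) :
    psi (|ξ| / N) = Real.exp (-(1 / (N : ℝ) ^ 2 * ξ ^ 2)) := by
  unfold psi
  rw [div_pow, sq_abs]
  congr 2; ring

theorem integrable_psi_sq {N : ℕ} (hN : 1 ≤ N) : Integrable fun ξ => psi (|ξ| / N) ^ 2 := by
  have hN' : (0 : ℝ) < N := by exact_mod_cast hN
  have : (fun ξ => psi (|ξ| / N) ^ 2) = fun ξ => Real.exp (-(2 * (1 / (N : ℝ) ^ 2)) * ξ ^ 2) := by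
    ext ξ
    rw [psi_div_eq, ← Real.exp_nat_mul]
    congr 1
    push_cast
    ring
  rw [this]
  exact integrable_exp_neg_mul_sq (by positivity)

theorem memLp_psi {N : ℕ} (hN : 1 ≤ N) (A : Set ℝ) :
    MemLp (fun ξ => psi (|ξ| / N)) 2 (volume.restrict A) := by
  have hc : Continuous fun ξ : ℝ => psi (|ξ| / N) :=
    continuous_psi.comp (by fun_prop)
  exact ((memLp_two_iff_integrable_sq hc.aestronglyMeasurable).2 (integrable_psi_sq hN)).restrict A

/-- The product depends on the points and times through their differences only. The two Gaussian
cut-offs merge into one whose parameter varies with the points, so the kernel bound has to be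
uniform in it. -/
theorem osc_mul_conj_osc (s : ℝ) (M N : ℕ) (t u x y ξ : ℝ) :
    (osc M t x ξ * ((1 + ξ ^ 2) ^ (-(s / 2)) : ℝ)) *
        (starRingEnd ℂ) (osc N u y ξ * ((1 + ξ ^ 2) ^ (-(s / 2)) : ℝ)) =
      kernelFull (1 / (M : ℝ) ^ 2 + 1 / (N : ℝ) ^ 2) s (x - y) (t - u) ξ := by
  have hw : (1 + ξ ^ 2) ^ (-(s / 2)) * (1 + ξ ^ 2) ^ (-(s / 2)) = (1 + ξ ^ 2) ^ (-s) := by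
    rw [← Real.rpow_add (by positivity)]
    congr 1; ring
  have he : Complex.exp (Complex.I * ((x - y) * ξ + (t - u) * (|ξ| * √(1 + |ξ| ^ 2)) : ℝ)) =
      Complex.exp (Complex.I * (x * ξ : ℝ)) *
      Complex.exp (Complex.I * (t * (|ξ| * √(1 + |ξ| ^ 2)) : ℝ)) *
      (Complex.exp (-Complex.I * (y * ξ : ℝ)) *
      Complex.exp (-Complex.I * (u * (|ξ| * √(1 + |ξ| ^ 2)) : ℝ))) := by
    rw [← Complex.exp_add, ← Complex.exp_add, ← Complex.exp_add]
    congr 1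
    push_cast
    ring
  have hψ : psi (|ξ| / M) * psi (|ξ| / N) =
      Real.exp (-((1 / (M : ℝ) ^ 2 + 1 / (N : ℝ) ^ 2) * ξ ^ 2)) := by
    rw [psi_div_eq, psi_div_eq, ← Real.exp_add]
    congr 1; ring
  rw [kernelFull, he, kernelWeight, ← hw, ← hψ]
  simp only [osc, map_mul, ← Complex.exp_conj, Complex.conj_I, Complex.conj_ofReal]
  push_cast
  ring

/-- The `T T*` inequality with the weight `(1+ξ²)^{-s/2}` in the operator and its inverse in the
function, followed by the potential bound with exponent `1-2s < α`. The set `A` and the resolution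
`δ` serve two uses: all frequencies with `δ = 0`, and bounded annuli with `δ > 0`. The bound `N₀` on
the truncations supplies a common square-integrable majorant but does not enter the constant. -/
theorem exists_linearized_maximal_le {α s : ℝ} (hs0 : 0 ≤ s) (hs : s < 1 / 2) (hα : 1 - 2 * s < α) (C₀ : ℝ≥0) :
    ∃ C : ℝ≥0, ∀ (A : Set ℝ) (δ : ℝ), MeasurableSet A → 0 ≤ δ → δ ≤ 1 →
      (∀ c, 0 < c → ∀ x t, |x| ≤ 2 → ‖∫ ξ in A, kernelFull c s x t ξ‖ₑ ≤
        C₀ * ENNReal.ofReal (|x| + δ) ^ (-(1 - 2 * s))) →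
      ∀ (μ : Measure ℝ) [IsFiniteMeasure μ] (c : ℝ≥0∞) (a : ℝ),
      μ (Set.Icc a (a + 2))ᶜ = 0 →
      (∀ x r, δ < r → μ (Metric.ball x r) ≤ c * ENNReal.ofReal (r ^ α)) →
      ∀ (N : ℝ → ℕ) (N₀ : ℕ) (t : ℝ → ℝ), Measurable N → Measurable t → (∀ x, 1 ≤ N x) →
      (∀ x, N x ≤ N₀) → ∀ h : ℝ → ℂ, Measurable h →
      ∫⁻ ξ in A, ENNReal.ofReal ((1 + |ξ| ^ 2) ^ s) * ‖h ξ‖ₑ ^ 2 ≠ ∞ →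
      ∫⁻ x, ‖∫ ξ in A, osc (N x) (t x) x ξ * h ξ‖ₑ ∂μ ≤
        C * (c * μ Set.univ) ^ (1 / 2 : ℝ) *
          (∫⁻ ξ in A, ENNReal.ofReal ((1 + |ξ| ^ 2) ^ s) * ‖h ξ‖ₑ ^ 2) ^ (1 / 2 : ℝ) := by
  obtain ⟨C₁, hC₁⟩ := exists_lintegral_rpow_neg_le (by linarith : 0 < 1 - 2 * s) hα
  refine ⟨(C₀ * C₁) ^ (1 / 2 : ℝ), ?_⟩
  intro A δ hA hδ hδ1 hK μ _ c a hsupp hball N N₀ t hN ht hN1 hN0 h hh hfin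
  have hN01 : 1 ≤ N₀ := (hN1 0).trans (hN0 0)
  set w : ℝ → ℝ := fun ξ => (1 + ξ ^ 2) ^ (-(s / 2)) with hw
  set w' : ℝ → ℝ := fun ξ => (1 + ξ ^ 2) ^ (s / 2) with hw'
  have hpos : ∀ ξ : ℝ, 0 < 1 + ξ ^ 2 := fun ξ => by positivity
  have hww : ∀ ξ, w ξ * w' ξ = 1 := fun ξ => by
    simp only [hw, hw']
    rw [← Real.rpow_add (hpos ξ), neg_add_cancel, Real.rpow_zero]
  have hwc : Continuous w := by
    refine Continuous.rpow_const (by fun_prop) fun ξ => Or.inl (hpos ξ).ne'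
  have hwc' : Continuous w' := by
    refine Continuous.rpow_const (by fun_prop) fun ξ => Or.inl (hpos ξ).ne'
  have hH2 : ∀ ξ, ‖(w' ξ : ℂ) * h ξ‖ₑ ^ 2 =
      ENNReal.ofReal ((1 + |ξ| ^ 2) ^ s) * ‖h ξ‖ₑ ^ 2 := by
    intro ξ
    rw [enorm_mul, mul_pow, ← ofReal_norm (w' ξ : ℂ), Complex.norm_real,
      Real.norm_of_nonneg (Real.rpow_nonneg (hpos ξ).le _), ← ENNReal.ofReal_pow
      (Real.rpow_nonneg (hpos ξ).le _), sq_abs, ← Real.rpow_natCast, ← Real.rpow_mul (hpos ξ).le]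
    congr 3
    push_cast
    ring
  have hHm : Measurable fun ξ => (w' ξ : ℂ) * h ξ :=
    (Complex.measurable_ofReal.comp hwc'.measurable).mul hh
  have hHL : MemLp (fun ξ => (w' ξ : ℂ) * h ξ) 2 (volume.restrict A) := by
    refine ⟨hHm.aestronglyMeasurable, ?_⟩
    rw [eLpNorm_lt_top_iff_lintegral_rpow_enorm_lt_top (by norm_num) (by norm_num)]
    simp only [ENNReal.toReal_ofNat, ENNReal.rpow_two, hH2]
    exact hfin.lt_top
  have hΨm : Measurable (Function.uncurry fun x ξ => osc (N x) (t x) x ξ * (w ξ : ℂ)) :=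
    (measurable_osc hN ht).mul
      (Complex.measurable_ofReal.comp (hwc.measurable.comp measurable_snd))
  have hTT := lintegral_norm_integral_le (μ := μ) (ν := volume.restrict A) hΨm
    (g := fun ξ => psi (|ξ| / N₀)) (memLp_psi hN01 A) (fun x ξ => ?_) hHm hHL
  · simp only [hH2] at hTT
    have hL : ∀ x, ∫ ξ in A, osc (N x) (t x) x ξ * (w ξ : ℂ) * ((w' ξ : ℂ) * h ξ) =
        ∫ ξ in A, osc (N x) (t x) x ξ * h ξ := by
      intro x
      refine integral_congr_ae (Eventually.of_forall fun ξ => ?_)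
      simp only
      have : (w ξ : ℂ) * (w' ξ : ℂ) = 1 := by exact_mod_cast hww ξ
      linear_combination (osc (N x) (t x) x ξ * h ξ) * this
    simp only [hL] at hTT
    refine hTT.trans ?_
    have hsupp' : ∀ᵐ x ∂μ, x ∈ Set.Icc a (a + 2) := by
      rw [ae_iff]; exact hsupp
    have hE : ∫⁻ x, ∫⁻ y, ‖∫ ξ in A, osc (N x) (t x) x ξ * (w ξ : ℂ) *
        (starRingEnd ℂ) (osc (N y) (t y) y ξ * (w ξ : ℂ))‖ₑ ∂μ ∂μ ≤
        C₀ * C₁ * (c * μ Set.univ) := by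
      calc _ ≤ ∫⁻ _, (C₀ * (C₁ * c) : ℝ≥0∞) ∂μ := by
            refine lintegral_mono_ae ?_
            filter_upwards [hsupp'] with x hx
            have hxy : ∀ᵐ y ∂μ, |x - y| ≤ 2 := by
              filter_upwards [hsupp'] with y hy
              rw [abs_le]
              constructor <;> linarith [hx.1, hx.2, hy.1, hy.2]
            calc _ ≤ ∫⁻ y, C₀ * ENNReal.ofReal (|x - y| + δ) ^ (-(1 - 2 * s)) ∂μ := by
                  refine lintegral_mono_ae ?_
                  filter_upwards [hxy] with y hy
                  simp only [hw, osc_mul_conj_osc]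
                  have h1 : (0 : ℝ) < N x := by exact_mod_cast hN1 x
                  exact hK _ (by positivity) _ _ hy
              _ = C₀ * ∫⁻ y, ENNReal.ofReal (|x - y| + δ) ^ (-(1 - 2 * s)) ∂μ :=
                  lintegral_const_mul _ (by fun_prop)
              _ ≤ _ := by
                  gcongr
                  exact hC₁ μ δ c hδ hδ1 hball x hxy
        _ = _ := by
            rw [lintegral_const]; ring
    calc _ ≤ (∫⁻ ξ in A, ENNReal.ofReal ((1 + |ξ| ^ 2) ^ s) * ‖h ξ‖ₑ ^ 2) ^ (1 / 2 : ℝ) *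
          (C₀ * C₁ * (c * μ Set.univ)) ^ (1 / 2 : ℝ) := by gcongr
      _ = _ := by
        rw [ENNReal.mul_rpow_of_nonneg _ _ (by norm_num : (0 : ℝ) ≤ 1 / 2),
          ENNReal.coe_rpow_of_nonneg _ (by norm_num : (0 : ℝ) ≤ 1 / 2), ENNReal.coe_mul, mul_comm]
  · rw [norm_mul, norm_osc, Complex.norm_real, Real.norm_of_nonneg (Real.rpow_nonneg (hpos ξ).le _)]
    exact (mul_le_of_le_one_right (psi_nonneg _) (Real.rpow_le_one_of_one_le_of_nonpos
      (by nlinarith [sq_nonneg ξ]) (by linarith))).trans (psi_div_anti (hN1 x) (hN0 x) ξ)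

/-- The kernel bound on the whole line. -/
theorem enorm_integral_kernelFull_le {s : ℝ} (hs : 1 / 4 ≤ s) (hs' : s < 1 / 2) :
    ∀ c, 0 < c → ∀ x t, |x| ≤ 2 → ‖∫ ξ in Set.univ, kernelFull c s x t ξ‖ₑ ≤
      ((4 * (2 / (1 - 2 * s) + 60)).toNNReal : ℝ≥0) *
        ENNReal.ofReal (|x| + 0) ^ (-(1 - 2 * s)) := by
  intro c hc x t hx
  have hβ : 0 < 1 - 2 * s := by linarith
  have hC : 0 < 2 / (1 - 2 * s) + 60 := by positivity
  rw [Measure.restrict_univ, add_zero]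
  change _ ≤ ENNReal.ofReal _ * _
  by_cases hx0 : x = 0
  · rw [hx0, abs_zero, ENNReal.ofReal_zero, ENNReal.zero_rpow_of_neg (by linarith),
      ENNReal.mul_top (by simpa using hC)]
    exact le_top
  have hx0' : 0 < |x| := abs_pos.2 hx0
  rw [ENNReal.ofReal_rpow_of_pos hx0', ← ENNReal.ofReal_mul (by positivity), ← ofReal_norm]
  refine ENNReal.ofReal_le_ofReal ((norm_integral_kernelFull_le hc hs hs' t hx0 hx).trans ?_)
  have : 0 ≤ |x| ^ (-(1 - 2 * s)) := Real.rpow_nonneg hx0'.le _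
  gcongr
  norm_num

/-- The kernel bound on an annulus, which does not blow up at distances below `δ`. -/
theorem enorm_setIntegral_annulus_le {s : ℝ} (hs : 1 / 4 ≤ s) (hs' : s < 1 / 2) {a b δ : ℝ}
    (ha : 0 ≤ a) (hab : a ≤ b) (hδ : 0 < δ) (hbδ : b * δ ≤ 1) :
    ∀ c, 0 < c → ∀ x t, |x| ≤ 2 → ‖∫ ξ in annulus a b, kernelFull c s x t ξ‖ₑ ≤
      ((4 * (2 / (1 - 2 * s) + 60)).toNNReal : ℝ≥0) *
        ENNReal.ofReal (|x| + δ) ^ (-(1 - 2 * s)) := by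
  intro c hc x t hx
  have hβ : 0 < 1 - 2 * s := by linarith
  have hC : 0 < 2 / (1 - 2 * s) + 60 := by positivity
  change _ ≤ ENNReal.ofReal _ * _
  have hxδ : 0 < |x| + δ := by positivity
  rw [ENNReal.ofReal_rpow_of_pos hxδ, ← ENNReal.ofReal_mul (by positivity), ← ofReal_norm]
  refine ENNReal.ofReal_le_ofReal ?_
  have key : ∀ y, 0 < y → |x| + δ ≤ 2 * y →
      y ^ (-(1 - 2 * s)) ≤ 2 * (|x| + δ) ^ (-(1 - 2 * s)) := by
    intro y hy hxy
    have h1 : y ^ (-(1 - 2 * s)) ≤ ((|x| + δ) / 2) ^ (-(1 - 2 * s)) :=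
      Real.rpow_le_rpow_of_nonpos (by positivity) (by linarith) (by linarith)
    refine h1.trans ?_
    rw [Real.div_rpow hxδ.le (by norm_num), Real.rpow_neg (by norm_num : (0 : ℝ) ≤ 2),
      div_inv_eq_mul, mul_comm]
    refine mul_le_mul_of_nonneg_right ?_ (by positivity)
    calc (2 : ℝ) ^ (1 - 2 * s) ≤ 2 ^ (1 : ℝ) :=
          Real.rpow_le_rpow_of_exponent_le (by norm_num) (by linarith)
      _ = 2 := Real.rpow_one 2
  rcases le_or_gt δ |x| with h | h
  · have hx0' : 0 < |x| := by linarith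
    refine (norm_setIntegral_annulus_le hc.le hs hs' t (abs_pos.1 hx0') hx ha hab).trans ?_
    calc _ ≤ 2 * (2 / (1 - 2 * s) + 60) * (2 * (|x| + δ) ^ (-(1 - 2 * s))) := by
          gcongr
          exact key _ hx0' (by linarith)
      _ = _ := by ring
  -- For `|x| < δ` the size estimate `b^{1-2s}` is already at most `δ^{-(1-2s)}`, since `b ≤ 1/δ`.
  · refine (norm_setIntegral_annulus_le_rpow hc.le (by linarith) hs' x t ha hab).trans ?_
    have h1 : b ^ (1 - 2 * s) ≤ δ ^ (-(1 - 2 * s)) := by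
      rw [Real.rpow_neg hδ.le, ← Real.inv_rpow hδ.le]
      refine Real.rpow_le_rpow (ha.trans hab) ?_ hβ.le
      rw [← one_div, le_div_iff₀ hδ]
      exact hbδ
    have h2 := key δ hδ (by linarith)
    have h3 : 0 ≤ δ ^ (-(1 - 2 * s)) := by positivity
    calc _ ≤ (2 / (1 - 2 * s) + 60) * 2 * (2 * (|x| + δ) ^ (-(1 - 2 * s))) := by
          refine mul_le_mul ?_ (h1.trans h2) (Real.rpow_nonneg (ha.trans hab) _) (by positivity)
          nlinarith
      _ = _ := by ring

/-! ### The maximal estimate -/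

theorem measurable_hat (f : LTwo) : Measurable (hat f) :=
  (Lp.stronglyMeasurable (𝓕 f : LTwo)).measurable.comp (measurable_id.div_const _)

theorem sobolevNorm_mono {s s' : ℝ} (h : s ≤ s') (f : LTwo) :
    sobolevNorm s f ≤ sobolevNorm s' f := by
  unfold sobolevNorm
  gcongr
  nlinarith [sq_nonneg |(‹ℝ› : ℝ)|]

/-- The constant of the kernel bound contains `1/(1-2s)`. At `s = 1/2` one passes to a smaller `s₀`,
which the strict inequality for `α` allows. -/
theorem exists_sobolev_exponent {s α : ℝ} (hs : 1 / 4 ≤ s) (hs' : s ≤ 1 / 2)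
    (hα : 1 - 2 * s < α) : ∃ s₀, 1 / 4 ≤ s₀ ∧ s₀ < 1 / 2 ∧ s₀ ≤ s ∧ 1 - 2 * s₀ < α := by
  rcases hs'.lt_or_eq with h | h
  · exact ⟨s, hs, h, le_rfl, hα⟩
  · refine ⟨max (1 / 4) (1 / 2 - α / 4), le_max_left _ _, max_lt (by norm_num) (by linarith),
      max_le hs (by linarith), ?_⟩
    have := le_max_right (1 / 4) (1 / 2 - α / 4)
    linarith

theorem measure_ball_le_densityConst (α : ℝ) (μ : Measure ℝ) (x : ℝ) {r : ℝ} (hr : 0 < r) :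
    μ (Metric.ball x r) ≤ densityConst α μ * ENNReal.ofReal (r ^ α) := by
  have h : ENNReal.ofReal (r ^ (-α)) * μ (Metric.ball x r) ≤ densityConst α μ :=
    le_iSup_of_le x (le_iSup_of_le r (le_iSup_of_le hr le_rfl))
  calc μ (Metric.ball x r)
      = ENNReal.ofReal (r ^ α) * (ENNReal.ofReal (r ^ (-α)) * μ (Metric.ball x r)) := by
        rw [← mul_assoc, ← ENNReal.ofReal_mul (by positivity), ← Real.rpow_add hr, add_neg_cancel,
          Real.rpow_zero, ENNReal.ofReal_one, one_mul]
    _ ≤ ENNReal.ofReal (r ^ α) * densityConst α μ := by gcongr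
    _ = _ := mul_comm _ _

/-- Measurable choice of an index at which a finite maximum is attained. -/
theorem exists_measurable_argmax {F : ℕ → ℝ → ℝ≥0∞} (hF : ∀ n, Measurable (F n)) (n : ℕ) :
    ∃ j : ℝ → ℕ, Measurable j ∧ (∀ x, j x ≤ n) ∧ ∀ x, ∀ k ≤ n, F k x ≤ F (j x) x := by
  induction n with
  | zero =>
    refine ⟨fun _ => 0, measurable_const, fun _ => le_rfl, fun x k hk => ?_⟩
    rw [Nat.le_zero.1 hk]
  | succ n ih =>
    obtain ⟨j, hj, hjn, hmax⟩ := ih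
    have hFj : Measurable fun x => F (j x) x :=
      (measurable_from_prod_countable_right (f := fun z : ℕ × ℝ => F z.1 z.2) hF).comp
        (hj.prodMk measurable_id)
    refine ⟨fun x => if F (n + 1) x ≤ F (j x) x then j x else n + 1,
      Measurable.ite (measurableSet_le (hF _) hFj) hj measurable_const, fun x => ?_,
      fun x k hk => ?_⟩
    · simp only
      split_ifs
      · exact (hjn x).trans n.le_succ
      · exact le_rfl
    · rcases Nat.le_succ_iff.1 hk with hk | hk
      · by_cases hc : F (n + 1) x ≤ F (j x) x
        · simpa only [if_pos hc] using hmax x k hk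
        · simpa only [if_neg hc] using (hmax x k hk).trans (not_le.1 hc).le
      · by_cases hc : F (n + 1) x ≤ F (j x) x
        · simpa only [if_pos hc, hk] using hc
        · simp only [if_neg hc, hk]; rfl

/-- Monotone convergence reduces the supremum to finite maxima, each attained at a measurable index.
That index is bounded, which later bounds the chosen truncations. -/
theorem lintegral_iSup_le_of_measurable_choice {μ : Measure ℝ} {F : ℕ → ℝ → ℝ≥0∞}
    (hF : ∀ n, Measurable (F n)) {B : ℝ≥0∞}
    (h : ∀ (n : ℕ) (j : ℝ → ℕ), Measurable j → (∀ x, j x ≤ n) → ∫⁻ x, F (j x) x ∂μ ≤ B) :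
    ∫⁻ x, ⨆ n, F n x ∂μ ≤ B := by
  choose j hj hjn hmax using exists_measurable_argmax hF
  have hFj : ∀ n, Measurable fun x => F (j n x) x := fun n =>
    (measurable_from_prod_countable_right (f := fun z : ℕ × ℝ => F z.1 z.2) hF).comp
      ((hj n).prodMk measurable_id)
  have hmono : Monotone fun n x => F (j n x) x := fun m n hmn x =>
    hmax n x _ ((hjn m x).trans hmn)
  calc ∫⁻ x, ⨆ n, F n x ∂μ ≤ ∫⁻ x, ⨆ n, F (j n x) x ∂μ :=
        lintegral_mono fun x => iSup_mono fun n => hmax n x n le_rfl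
    _ = ⨆ n, ∫⁻ x, F (j n x) x ∂μ := lintegral_iSup hFj hmono
    _ ≤ B := iSup_le fun n => h n (j n) (hj n) (hjn n)

theorem enorm_truncated_le (N : ℕ) (t : ℝ) (f : LTwo) (x : ℝ) :
    ‖truncated N t f x‖ₑ ≤ ‖∫ ξ, osc N t x ξ * hat f ξ‖ₑ := by
  rw [truncated_eq, enorm_mul, ← ofReal_norm (((2 * Real.pi)⁻¹ : ℝ) : ℂ), Complex.norm_real,
    Real.norm_of_nonneg (by positivity)]
  refine mul_le_of_le_one_left zero_le (ENNReal.ofReal_le_one.2 ?_)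
  exact inv_le_one_of_one_le₀ (by linarith [Real.pi_gt_three])

theorem measurable_integral_osc (N : ℕ) (t : ℝ) (f : LTwo) :
    Measurable fun x => ∫ ξ, osc N t x ξ * hat f ξ := by
  have : StronglyMeasurable (Function.uncurry fun x ξ => osc N t x ξ * hat f ξ) :=
    ((measurable_osc (measurable_const (a := N)) (measurable_const (a := t))).mul
      ((measurable_hat f).comp measurable_snd)).stronglyMeasurable
  exact this.integral_prod_right.measurable

theorem exists_maximal_estimate {s α : ℝ} (hs : 1 / 4 ≤ s) (hs' : s ≤ 1 / 2)
    (hα : 1 - 2 * s < α) : ∃ C : ℝ≥0, ∀ μ : Measure ℝ, IsDimensional α μ →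
      ∀ t : ℕ → ℝ, ∀ f ∈ sobolevSpace s,
        ∫⁻ x, maximal t f x ∂μ ≤ C * densityConst α μ ^ (1 / 2 : ℝ) * sobolevNorm s f := by
  obtain ⟨s₀, hs1, hs2, hs3, hs4⟩ := exists_sobolev_exponent hs hs' hα
  obtain ⟨C, hC⟩ := exists_linearized_maximal_le (by linarith) hs2 hs4
    ((4 * (2 / (1 - 2 * s₀) + 60)).toNNReal)
  refine ⟨C, fun μ hμ t f hf => ?_⟩
  have := hμ.isProbabilityMeasure
  have hnorm : sobolevNorm s₀ f ≤ sobolevNorm s f := sobolevNorm_mono hs3 f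
  have hfin : ∫⁻ ξ in Set.univ, ENNReal.ofReal ((1 + |ξ| ^ 2) ^ s₀) * ‖hat f ξ‖ₑ ^ 2 ≠ ∞ := by
    have h1 : sobolevNorm s₀ f < ∞ := hnorm.trans_lt hf
    rw [Measure.restrict_univ]
    exact ((ENNReal.rpow_lt_top_iff_of_pos (by norm_num)).1 h1).ne
  -- Enumerating the pairs `(k, N)` turns the double supremum into a supremum over `ℕ`.
  obtain ⟨e, he⟩ := exists_surjective_nat (ℕ × ℕ+)
  set F : ℕ → ℝ → ℝ≥0∞ := fun n x => ‖∫ ξ, osc (e n).2 (t (e n).1) x ξ * hat f ξ‖ₑ with hF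
  have hFm : ∀ n, Measurable (F n) := fun n => (measurable_integral_osc _ _ f).enorm
  have hle : ∀ x, maximal t f x ≤ ⨆ n, F n x := by
    intro x
    refine iSup_le fun k => iSup_le fun N => ?_
    obtain ⟨n, hn⟩ := he (k, N)
    refine (enorm_truncated_le N (t k) f x).trans (le_iSup_of_le n ?_)
    rw [hF]
    simp only [hn]
    exact le_rfl
  refine (lintegral_mono hle).trans ((lintegral_iSup_le_of_measurable_choice hFm
    (B := C * densityConst α μ ^ (1 / 2 : ℝ) * sobolevNorm s₀ f) ?_).trans (by gcongr))
  intro n j hj hjn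
  have hsupp : μ (Set.Icc (-1 : ℝ) (-1 + 2))ᶜ = 0 := by
    refine measure_mono_null (Set.compl_subset_compl.2 fun x hx => ?_) hμ.supported
    rw [Metric.mem_ball, Real.dist_eq, sub_zero, abs_lt] at hx
    exact ⟨hx.1.le, by linarith [hx.2]⟩
  have hNm : Measurable fun x => ((e (j x)).2 : ℕ) :=
    (measurable_from_top (f := fun k : ℕ => ((e k).2 : ℕ))).comp (hj)
  have htm : Measurable fun x => t (e (j x)).1 :=
    (measurable_from_top (f := fun k : ℕ => t (e k).1)).comp (hj)
  obtain ⟨N₀, hN₀⟩ : ∃ N₀ : ℕ, ∀ x, ((e (j x)).2 : ℕ) ≤ N₀ := by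
    refine ⟨∑ k ∈ Finset.range (n + 1), ((e k).2 : ℕ), fun x => ?_⟩
    exact Finset.single_le_sum (f := fun k => ((e k).2 : ℕ)) (fun _ _ => Nat.zero_le _)
      (Finset.mem_range.2 (Nat.lt_succ_of_le (hjn x)))
  have h := hC Set.univ 0 MeasurableSet.univ le_rfl zero_le_one
    (enorm_integral_kernelFull_le hs1 hs2) μ (densityConst α μ) (-1) hsupp
    (fun x r hr => measure_ball_le_densityConst α μ x hr) _ N₀ _ hNm htm
    (fun x => (e (j x)).2.pos) hN₀ (hat f) (measurable_hat f) hfin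
  simp only [Measure.restrict_univ, measure_univ, mul_one] at h
  exact h

theorem alphaBar_le {s : ℝ} (hs : 1 / 4 ≤ s) (hs' : s ≤ 1 / 2) :
    alphaBar s ≤ ENNReal.ofReal (1 - 2 * s) := by
  refine le_of_forall_gt_imp_ge_of_dense fun b hb => ?_
  obtain ⟨α, h0, h1, h2⟩ : ∃ α : ℝ, 1 - 2 * s < α ∧ α ≤ 1 ∧ ENNReal.ofReal α ≤ b := by
    have h1 : ENNReal.ofReal (1 - 2 * s) < min b 1 :=
      lt_min hb (ENNReal.ofReal_lt_one.2 (by linarith))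
    obtain ⟨c, hc1, hc2⟩ := exists_between h1
    have hct : c ≠ ∞ := (hc2.trans_le (min_le_right _ _)).ne_top
    refine ⟨c.toReal, (ENNReal.ofReal_lt_iff_lt_toReal (by linarith) hct).1 hc1, ?_, ?_⟩
    · exact ENNReal.toReal_le_of_le_ofReal zero_le_one
        (by rw [ENNReal.ofReal_one]; exact hc2.le.trans (min_le_right _ _))
    · rw [ENNReal.ofReal_toReal hct]
      exact hc2.le.trans (min_le_left _ _)
  refine le_trans (iInf₂_le α ?_) h2
  obtain ⟨C, hC⟩ := exists_maximal_estimate hs hs' h0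
  exact ⟨by linarith, h1, C, fun μ hμ f hf t _ => hC μ hμ t f hf⟩

/-! ### Dyadic intervals and a discrete Frostman lemma -/

/-- The dyadic interval `[i 2^{-k}, (i + 1) 2^{-k})`. -/
def dyadic (k : ℕ) (i : ℤ) : Set ℝ := {x | ⌊2 ^ k * x⌋ = i}

theorem mem_dyadic {k : ℕ} {i : ℤ} {x : ℝ} : x ∈ dyadic k i ↔ ⌊2 ^ k * x⌋ = i := Iff.rfl

theorem floor_two_mul (z : ℝ) : ⌊2 * z⌋ = 2 * ⌊z⌋ ∨ ⌊2 * z⌋ = 2 * ⌊z⌋ + 1 := by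
  have h1 := Int.floor_le z
  have h2 := Int.lt_floor_add_one z
  have h3 : 2 * ⌊z⌋ ≤ ⌊2 * z⌋ := Int.le_floor.2 (by push_cast; linarith)
  have h4 : ⌊2 * z⌋ < 2 * ⌊z⌋ + 2 := Int.floor_lt.2 (by push_cast; linarith)
  omega

theorem floor_pow_succ_mul (k : ℕ) (x : ℝ) :
    ⌊2 ^ (k + 1) * x⌋ = 2 * ⌊2 ^ k * x⌋ ∨ ⌊2 ^ (k + 1) * x⌋ = 2 * ⌊2 ^ k * x⌋ + 1 := by
  rw [pow_succ', mul_assoc]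
  exact floor_two_mul _

theorem dyadic_eq_union (k : ℕ) (i : ℤ) :
    dyadic k i = dyadic (k + 1) (2 * i) ∪ dyadic (k + 1) (2 * i + 1) := by
  ext x
  rw [Set.mem_union, mem_dyadic, mem_dyadic, mem_dyadic]
  have := floor_pow_succ_mul k x
  omega

theorem floor_eq_of_floor_eq {k j : ℕ} (hkj : k ≤ j) {x y : ℝ}
    (h : ⌊2 ^ j * x⌋ = ⌊2 ^ j * y⌋) : ⌊2 ^ k * x⌋ = ⌊2 ^ k * y⌋ := by
  induction j, hkj using Nat.le_induction with
  | base => exact h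
  | succ j _ ih =>
    refine ih ?_
    have h1 := floor_pow_succ_mul j x
    have h2 := floor_pow_succ_mul j y
    omega

/-- Dyadic intervals are nested or disjoint. When the measures on two halves are added, only one of
them contributes to a given finer interval. -/
theorem disjoint_dyadic_or {k j : ℕ} (hkj : k ≤ j) {i₁ i₂ : ℤ} (hi : i₁ ≠ i₂) (i' : ℤ) :
    Disjoint (dyadic j i') (dyadic k i₁) ∨ Disjoint (dyadic j i') (dyadic k i₂) := by
  by_contra! h
  obtain ⟨x, hx, hx1⟩ := Set.not_disjoint_iff.1 h.1
  obtain ⟨y, hy, hy1⟩ := Set.not_disjoint_iff.1 h.2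
  rw [mem_dyadic] at hx hx1 hy hy1
  have := floor_eq_of_floor_eq hkj (hx.trans hy.symm)
  omega

/-- A finitely supported measure on `E ∩ dyadic k i` whose mass dominates the sizes of a cover by
dyadic intervals, and which is controlled on dyadic intervals of levels `k, …, k + d`. -/
theorem exists_discrete_frostman {g : ℕ → ℝ≥0∞} (hgt : ∀ j, g j ≠ ∞)
    (E : Set ℝ) (d : ℕ) : ∀ (k : ℕ) (i : ℤ), ∃ (μ : Measure ℝ) (P : Set ℝ) (S : Finset (ℕ × ℤ)),
      IsFiniteMeasure μ ∧ P.Finite ∧ P ⊆ E ∩ dyadic k i ∧ μ Pᶜ = 0 ∧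
      (∀ j i', k ≤ j → j ≤ k + d → μ (dyadic j i') ≤ g j) ∧
      E ∩ dyadic k i ⊆ ⋃ p ∈ S, dyadic p.1 p.2 ∧ ∑ p ∈ S, g p.1 ≤ μ Set.univ := by
  induction d with
  | zero =>
    intro k i
    rcases (E ∩ dyadic k i).eq_empty_or_nonempty with h | ⟨p, hp⟩
    · exact ⟨0, ∅, ∅, inferInstance, Set.finite_empty, Set.empty_subset _, by simp, by simp,
        by simp [h], by simp⟩
    · refine ⟨g k • Measure.dirac p, {p}, {(k, i)},
        ⟨by simpa using (hgt k).lt_top⟩,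
        Set.finite_singleton p, Set.singleton_subset_iff.2 hp, ?_, ?_, ?_, ?_⟩
      · simp
      · intro j i' hkj hjk
        have : j = k := by omega
        subst this
        calc (g j • Measure.dirac p) (dyadic j i') ≤ (g j • Measure.dirac p) Set.univ :=
              measure_mono (Set.subset_univ _)
          _ = g j := by simp
      · intro x hx
        simpa using hx.2
      · simp
  | succ d ih =>
    intro k i
    obtain ⟨μ₁, P₁, S₁, hf₁, hP₁, hPE₁, hμP₁, hμ₁, hc₁, hS₁⟩ := ih (k + 1) (2 * i)
    obtain ⟨μ₂, P₂, S₂, hf₂, hP₂, hPE₂, hμP₂, hμ₂, hc₂, hS₂⟩ := ih (k + 1) (2 * i + 1)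
    have hPE : P₁ ∪ P₂ ⊆ E ∩ dyadic k i := by
      rw [dyadic_eq_union, Set.inter_union_distrib_left]
      exact Set.union_subset_union hPE₁ hPE₂
    have hμP : (μ₁ + μ₂) (P₁ ∪ P₂)ᶜ = 0 := by
      rw [Measure.add_apply, measure_mono_null
        (Set.compl_subset_compl.2 Set.subset_union_left) hμP₁, measure_mono_null
        (Set.compl_subset_compl.2 Set.subset_union_right) hμP₂, add_zero]
    have hfine : ∀ j i', k + 1 ≤ j → j ≤ k + (d + 1) → (μ₁ + μ₂) (dyadic j i') ≤ g j := by
      intro j i' h1 h2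
      rw [Measure.add_apply]
      rcases disjoint_dyadic_or h1 (by omega : 2 * i ≠ 2 * i + 1) i' with h | h
      · have : μ₁ (dyadic j i') = 0 := measure_mono_null (fun x hx hxP =>
          Set.disjoint_left.1 h hx (hPE₁ hxP).2) hμP₁
        rw [this, zero_add]
        exact hμ₂ j i' h1 (by omega)
      · have : μ₂ (dyadic j i') = 0 := measure_mono_null (fun x hx hxP =>
          Set.disjoint_left.1 h hx (hPE₂ hxP).2) hμP₂
        rw [this, add_zero]
        exact hμ₁ j i' h1 (by omega)
    set T := (μ₁ + μ₂) Set.univ with hT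
    -- If the two halves together respect the budget `g k`, keep the measure and both covers.
    -- Otherwise scale the mass down to exactly `g k` and cover by the parent interval alone; either
    -- way the cover costs no more than the mass.
    rcases le_or_gt T (g k) with hTk | hTk
    · refine ⟨μ₁ + μ₂, P₁ ∪ P₂, S₁ ∪ S₂, inferInstance, hP₁.union hP₂, hPE, hμP, ?_, ?_, ?_⟩
      · intro j i' h1 h2
        rcases h1.eq_or_lt with h3 | h3
        · rw [← h3]
          exact (measure_mono (Set.subset_univ _)).trans hTk
        · exact hfine j i' h3 h2
      · rw [dyadic_eq_union, Set.inter_union_distrib_left, Finset.set_biUnion_union]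
        exact Set.union_subset_union hc₁ hc₂
      · calc ∑ p ∈ S₁ ∪ S₂, g p.1 ≤ ∑ p ∈ S₁, g p.1 + ∑ p ∈ S₂, g p.1 := by
              rw [← Finset.sum_union_inter]; exact le_self_add
          _ ≤ T := by
              rw [hT, Measure.add_apply]; exact add_le_add hS₁ hS₂
    · have hT0 : T ≠ 0 := (zero_le.trans_lt hTk).ne'
      have hTt : T ≠ ∞ := measure_ne_top _ _
      have hq : g k / T ≤ 1 := ENNReal.div_le_of_le_mul (by rw [one_mul]; exact hTk.le)
      have htot : ((g k / T) • (μ₁ + μ₂)) Set.univ = g k := by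
        rw [Measure.smul_apply, smul_eq_mul, ← hT, ENNReal.div_mul_cancel hT0 hTt]
      refine ⟨(g k / T) • (μ₁ + μ₂), P₁ ∪ P₂, {(k, i)}, ⟨by rw [htot]; exact (hgt k).lt_top⟩,
        hP₁.union hP₂, hPE, ?_, ?_, ?_, ?_⟩
      · rw [Measure.smul_apply, hμP, smul_zero]
      · intro j i' h1 h2
        rcases h1.eq_or_lt with h3 | h3
        · rw [← h3]
          exact (measure_mono (Set.subset_univ _)).trans htot.le
        · rw [Measure.smul_apply, smul_eq_mul]
          exact (mul_le_of_le_one_left zero_le hq).trans (hfine j i' h3 h2)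
      · intro x hx
        simpa using hx.2
      · rw [htot]; simp

/-- The `α`-th power of the length of a dyadic interval of level `j`. -/
noncomputable def dyadicSize (α : ℝ) (j : ℕ) : ℝ≥0∞ := ENNReal.ofReal ((1 / 2 ^ j) ^ α)

theorem dyadicSize_ne_top (α : ℝ) (j : ℕ) : dyadicSize α j ≠ ∞ := ENNReal.ofReal_ne_top

theorem dyadicSize_eq (α : ℝ) (j : ℕ) : dyadicSize α j = ENNReal.ofReal (1 / 2 ^ j) ^ α := by
  rw [dyadicSize, ENNReal.ofReal_rpow_of_pos (by positivity)]

theorem ediam_dyadic_le (j : ℕ) (i : ℤ) : Metric.ediam (dyadic j i) ≤ ENNReal.ofReal (1 / 2 ^ j) := by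
  have hp : (0 : ℝ) < 2 ^ j := by positivity
  refine Metric.ediam_le fun x hx y hy => ?_
  rw [edist_dist, Real.dist_eq]
  refine ENNReal.ofReal_le_ofReal ?_
  rw [mem_dyadic] at hx hy
  have h := Int.abs_sub_lt_one_of_floor_eq_floor (hx.trans hy.symm)
  rw [← mul_sub, abs_mul, abs_of_pos hp] at h
  rw [le_div_iff₀ hp, mul_comm]
  exact h.le

/-- Control on dyadic intervals gives control on balls. -/
theorem measure_ball_le_of_dyadic {α : ℝ} (hα : 0 < α) {μ : Measure ℝ} {n : ℕ}
    (htot : μ Set.univ ≤ 1)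
    (h : ∀ j i, j ≤ n → μ (dyadic j i) ≤ dyadicSize α j) (x : ℝ) {r : ℝ} (hr : 1 / 2 ^ n < r) :
    μ (Metric.ball x r) ≤ ENNReal.ofReal (3 * 2 ^ α) * ENNReal.ofReal (r ^ α) := by
  have hr0 : 0 < r := lt_trans (by positivity) hr
  have h2α : (1 : ℝ) ≤ 2 ^ α := Real.one_le_rpow (by norm_num) hα.le
  rw [← ENNReal.ofReal_mul (by positivity)]
  rcases le_or_gt 1 r with h1 | h1
  · refine ((measure_mono (Set.subset_univ _)).trans htot).trans (ENNReal.one_le_ofReal.2 ?_)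
    have := Real.one_le_rpow h1 hα.le
    nlinarith
  -- With `2^m ≤ 1/r < 2^{m+1}` the ball is covered by three intervals of level `m`, each of length
  -- at most `2r`: hence `3 · 2^α`. As `r > 2^{-n}`, the level is at most `n`.
  · obtain ⟨m, hm1, hm2⟩ := exists_nat_pow_near ((one_le_div hr0).2 h1.le)
      (by norm_num : (1 : ℝ) < 2)
    have hmn : m ≤ n := by
      have : (2 : ℝ) ^ m < 2 ^ n := hm1.trans_lt (by
        rw [div_lt_comm₀ hr0 (by positivity)]; exact hr)
      exact ((pow_lt_pow_iff_right₀ (by norm_num)).1 this).le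
    rw [le_div_iff₀ hr0] at hm1
    rw [div_lt_iff₀ hr0] at hm2
    set i₀ := ⌊2 ^ m * x⌋ with hi₀
    have hcov : Metric.ball x r ⊆
        dyadic m (i₀ - 1) ∪ dyadic m i₀ ∪ dyadic m (i₀ + 1) := by
      intro y hy
      rw [Metric.mem_ball, Real.dist_eq] at hy
      have hy1 : |2 ^ m * y - 2 ^ m * x| < 1 := by
        rw [← mul_sub, abs_mul, abs_of_pos (by positivity : (0 : ℝ) < 2 ^ m)]
        have := mul_lt_mul_of_pos_left hy (by positivity : (0 : ℝ) < 2 ^ m)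
        linarith
      rw [abs_lt] at hy1
      have hx1 := Int.floor_le (2 ^ m * x)
      have hx2 := Int.lt_floor_add_one (2 ^ m * x)
      rw [← hi₀] at hx1 hx2
      have h5 : i₀ - 1 ≤ ⌊2 ^ m * y⌋ := Int.le_floor.2 (by push_cast; linarith)
      have h6 : ⌊2 ^ m * y⌋ < i₀ + 2 := Int.floor_lt.2 (by push_cast; linarith)
      rw [Set.mem_union, Set.mem_union, mem_dyadic, mem_dyadic, mem_dyadic]
      omega
    calc μ (Metric.ball x r) ≤ dyadicSize α m + dyadicSize α m + dyadicSize α m :=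
          (measure_mono hcov).trans ((measure_union_le _ _).trans (add_le_add
            ((measure_union_le _ _).trans (add_le_add (h m _ hmn) (h m _ hmn))) (h m _ hmn)))
      _ = ENNReal.ofReal (3 * (1 / 2 ^ m) ^ α) := by
          rw [dyadicSize, ← ENNReal.ofReal_add (by positivity) (by positivity),
            ← ENNReal.ofReal_add (by positivity) (by positivity)]
          congr 1; ring
      _ ≤ _ := by
          refine ENNReal.ofReal_le_ofReal ?_
          rw [mul_assoc, ← Real.mul_rpow (by norm_num) hr0.le]
          have : (1 : ℝ) / 2 ^ m ≤ 2 * r := by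
            rw [div_le_iff₀ (by positivity)]
            rw [pow_succ] at hm2
            linarith
          gcongr

/-- A set all of whose points belong to infinitely many of the sets `E m` is Hausdorff null if
the `E m` have covers by dyadic intervals of summable sizes. -/
theorem hausdorffMeasure_frequently_eq_zero {α : ℝ} (hα : 0 < α) {E : ℕ → Set ℝ}
    {S : ℕ → Finset (ℕ × ℤ)} (hE : ∀ m, E m ⊆ ⋃ p ∈ S m, dyadic p.1 p.2)
    (hsum : ∑' m, ∑ p ∈ S m, dyadicSize α p.1 ≠ ∞) :
    Measure.hausdorffMeasure α {x | ∃ᶠ m in atTop, x ∈ E m} = 0 := by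
  set T : ℕ → ℝ≥0∞ := fun J => ∑' k, ∑ p ∈ S (k + J), dyadicSize α p.1 with hT
  have hT0 : Tendsto T atTop (𝓝 0) := ENNReal.tendsto_sum_nat_add _ hsum
  -- Each single size is at most the tail `T J`, so the diameters are at most `T J ^ (1/α)`:
  -- summability by itself makes the covers fine.
  have hr : Tendsto (fun J => T J ^ (1 / α)) atTop (𝓝 0) := by
    have h := (ENNReal.continuous_rpow_const (y := 1 / α)).tendsto (0 : ℝ≥0∞)
    rw [ENNReal.zero_rpow_of_pos (by positivity)] at h
    exact h.comp hT0
  have hterm : ∀ J (p : Σ k : ℕ, {p : ℕ × ℤ // p ∈ S (k + J)}),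
      dyadicSize α p.2.1.1 ≤ T J := by
    intro J p
    exact (Finset.single_le_sum (f := fun q : ℕ × ℤ => dyadicSize α q.1)
      (fun _ _ => zero_le) p.2.2).trans (ENNReal.le_tsum p.1)
  have hmain := Measure.hausdorffMeasure_le_liminf_tsum (X := ℝ) (l := atTop)
    (ι := fun J : ℕ => Σ k : ℕ, {p : ℕ × ℤ // p ∈ S (k + J)}) α
    {x | ∃ᶠ m in atTop, x ∈ E m} (fun J => T J ^ (1 / α)) hr
    (fun J p => dyadic p.2.1.1 p.2.1.2)
    (Eventually.of_forall fun J p => by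
      refine (ediam_dyadic_le _ _).trans ?_
      have h := ENNReal.rpow_le_rpow (hterm J p) (by positivity : 0 ≤ 1 / α)
      rwa [dyadicSize_eq, ← ENNReal.rpow_mul, mul_one_div_cancel hα.ne', ENNReal.rpow_one] at h)
    (Eventually.of_forall fun J x hx => by
      obtain ⟨m, hm, hxm⟩ := (Filter.frequently_atTop.1 hx) J
      obtain ⟨p, hp, hxp⟩ := Set.mem_iUnion₂.1 (hE m hxm)
      refine Set.mem_iUnion.2 ⟨⟨m - J, ⟨p, ?_⟩⟩, hxp⟩
      rwa [Nat.sub_add_cancel hm])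
  refine le_antisymm (hmain.trans ?_) zero_le
  have hle : ∀ J, ∑' p : Σ k : ℕ, {p : ℕ × ℤ // p ∈ S (k + J)},
      Metric.ediam (dyadic p.2.1.1 p.2.1.2) ^ α ≤ T J := by
    intro J
    calc _ ≤ ∑' p : Σ k : ℕ, {p : ℕ × ℤ // p ∈ S (k + J)}, dyadicSize α p.2.1.1 := by
          refine ENNReal.tsum_le_tsum fun p => ?_
          rw [dyadicSize_eq]
          exact ENNReal.rpow_le_rpow (ediam_dyadic_le _ _) hα.le
      _ = T J := by
          rw [ENNReal.tsum_sigma']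
          refine tsum_congr fun k => ?_
          rw [Finset.tsum_subtype (S (k + J)) fun q : ℕ × ℤ => dyadicSize α q.1]
  exact (liminf_le_liminf (Eventually.of_forall hle)).trans hT0.liminf_eq.le

/-! ### Content of the level sets of the maximal function -/

/-- The points where the maximal function over all `t` and `N ≥ 1` of the part of `h` with
frequencies in `A` reaches `l`. -/
def levelSet (A : Set ℝ) (h : ℝ → ℂ) (l : ℝ≥0∞) : Set ℝ :=
  {x | ∃ (t : ℝ) (N : ℕ), 1 ≤ N ∧ l ≤ ‖∫ ξ in A, osc N t x ξ * h ξ‖ₑ}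

/-- Squaring and cancelling one factor of the total mass `M` turns the `L¹` estimate at height `l`
into a weak-type bound for the mass. -/
theorem mul_sq_le_of_mul_le {M l K c W : ℝ≥0∞} (hM : M ≠ ∞)
    (h : l * M ≤ K * (c * M) ^ (1 / 2 : ℝ) * W ^ (1 / 2 : ℝ)) :
    M * l ^ 2 ≤ K ^ 2 * c * W := by
  rcases eq_or_ne M 0 with h0 | h0
  · rw [h0, zero_mul]; exact zero_le
  have hsq : ∀ y : ℝ≥0∞, (y ^ (1 / 2 : ℝ)) ^ 2 = y := fun y => by
    rw [← ENNReal.rpow_two, ← ENNReal.rpow_mul]; norm_num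
  have h2 := pow_le_pow_left' h 2
  rw [mul_pow, mul_pow, mul_pow, hsq, hsq] at h2
  refine (ENNReal.mul_le_mul_iff_right h0 hM).1 ?_
  calc M * (M * l ^ 2) = l ^ 2 * M ^ 2 := by ring
    _ ≤ K ^ 2 * (c * M) * W := h2
    _ = _ := by ring

/-- A weak-type estimate for dyadic content: the linearized estimate is tested on the discrete
Frostman measure of the level set, whose mass dominates the cover. Finite support makes any choice
of time and truncation on it measurable. -/
theorem exists_cover_levelSet {α s : ℝ} (hs : 1 / 4 ≤ s) (hs' : s < 1 / 2) (hα : 1 - 2 * s < α) :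
    ∃ C : ℝ≥0, ∀ (a b : ℝ) (h : ℝ → ℂ) (l : ℝ≥0∞) (i : ℤ), 0 ≤ a → a ≤ b → Measurable h →
      ∫⁻ ξ in annulus a b, ENNReal.ofReal ((1 + |ξ| ^ 2) ^ s) * ‖h ξ‖ₑ ^ 2 ≠ ∞ →
      ∃ S : Finset (ℕ × ℤ), levelSet (annulus a b) h l ∩ dyadic 0 i ⊆ ⋃ p ∈ S, dyadic p.1 p.2 ∧
        (∑ p ∈ S, dyadicSize α p.1) * l ^ 2 ≤
          C * ∫⁻ ξ in annulus a b, ENNReal.ofReal ((1 + |ξ| ^ 2) ^ s) * ‖h ξ‖ₑ ^ 2 := by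
  have hα0 : 0 < α := by linarith
  obtain ⟨C, hC⟩ := exists_linearized_maximal_le (by linarith) hs' hα
    ((4 * (2 / (1 - 2 * s) + 60)).toNNReal)
  refine ⟨C ^ 2 * (3 * 2 ^ α : ℝ).toNNReal, ?_⟩
  intro a b h l i ha hab hh hW
  -- The resolution `2^{-n}` lies below `1/b`, so the annulus does not see finer scales.
  obtain ⟨n, hn⟩ := pow_unbounded_of_one_lt b (by norm_num : (1 : ℝ) < 2)
  have hδ0 : (0 : ℝ) < 1 / 2 ^ n := by positivity
  have hδ1 : (1 : ℝ) / 2 ^ n ≤ 1 := by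
    rw [div_le_one (by positivity)]; exact one_le_pow₀ (by norm_num)
  have hbδ : b * (1 / 2 ^ n) ≤ 1 := by
    rw [mul_one_div, div_le_one (by positivity)]; exact hn.le
  set E := levelSet (annulus a b) h l with hE
  obtain ⟨μ, P, S, hfin, hP, hPE, hμP, hμ, hcov, hS⟩ :=
    exists_discrete_frostman (dyadicSize_ne_top α) E n 0 i
  refine ⟨S, hcov, ?_⟩
  have hPex : ∀ x : P, ∃ q : ℝ × ℕ, 1 ≤ q.2 ∧
      l ≤ ‖∫ ξ in annulus a b, osc q.2 q.1 x ξ * h ξ‖ₑ := fun x => by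
    obtain ⟨t, N, h1, h2⟩ := (hPE x.2).1
    exact ⟨(t, N), h1, h2⟩
  choose q hq1 hq2 using hPex
  classical
  -- The default truncation `1` preserves `1 ≤ N` off the support.
  set Q : ℝ → ℝ × ℕ := fun x => if hx : x ∈ P then q ⟨x, hx⟩ else (0, 1) with hQ
  have hQP : ∀ x (hx : x ∈ P), Q x = q ⟨x, hx⟩ := fun x hx => by simp only [hQ, dif_pos hx]
  have hQm : Measurable Q := by
    refine (measurable_const (a := ((0, 1) : ℝ × ℕ))).measurable_of_countable_ne
      (hP.countable.mono fun x hx => ?_)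
    by_contra hxP
    exact hx (by simp only [hQ, dif_neg hxP])
  have hQ1 : ∀ x, 1 ≤ (Q x).2 := fun x => by
    by_cases hx : x ∈ P
    · rw [hQP x hx]; exact hq1 _
    · simp only [hQ, dif_neg hx]; exact le_rfl
  obtain ⟨N₀, hN₀⟩ : ∃ N₀, ∀ x, (Q x).2 ≤ N₀ := by
    have hb : (insert ((0, 1) : ℝ × ℕ) (Q '' P)).Finite := (hP.image Q).insert _
    obtain ⟨N₀, hN₀⟩ := (hb.image Prod.snd).bddAbove
    refine ⟨N₀, fun x => hN₀ ⟨Q x, ?_, rfl⟩⟩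
    by_cases hx : x ∈ P
    · exact Or.inr ⟨x, hx, rfl⟩
    · exact Or.inl (by simp only [hQ, dif_neg hx])
  have hdy : dyadic 0 i ⊆ Set.Icc (i : ℝ) (i + 2) := fun x hx => by
    rw [mem_dyadic, pow_zero, one_mul, Int.floor_eq_iff] at hx
    exact ⟨hx.1, by linarith [hx.2]⟩
  have hsupp : μ (Set.Icc (i : ℝ) (i + 2))ᶜ = 0 :=
    measure_mono_null (Set.compl_subset_compl.2 fun x hx => hdy (hPE hx).2) hμP
  have htot : μ Set.univ ≤ 1 := by
    have h1 : μ Set.univ ≤ μ (dyadic 0 i) + μ (dyadic 0 i)ᶜ := by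
      rw [← Set.union_compl_self (dyadic 0 i)]
      exact measure_union_le _ _
    have h2 : μ (dyadic 0 i)ᶜ = 0 :=
      measure_mono_null (Set.compl_subset_compl.2 fun x hx => (hPE hx).2) hμP
    rw [h2, add_zero] at h1
    refine h1.trans ((hμ 0 i le_rfl (by omega)).trans (le_of_eq ?_))
    simp [dyadicSize]
  have hball := fun x r hr => measure_ball_le_of_dyadic hα0 htot
    (fun j i' hj => hμ j i' (Nat.zero_le _) (by omega)) x (r := r) (n := n) hr
  have hmain := hC (annulus a b) (1 / 2 ^ n) (measurableSet_annulus a b) hδ0.le hδ1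
    (enorm_setIntegral_annulus_le hs hs' ha hab hδ0 hbδ) μ (ENNReal.ofReal (3 * 2 ^ α)) i hsupp
    hball _ N₀ _ hQm.snd hQm.fst hQ1 hN₀ h hh hW
  have hlow : l * μ Set.univ ≤
      ∫⁻ x, ‖∫ ξ in annulus a b, osc (Q x).2 (Q x).1 x ξ * h ξ‖ₑ ∂μ := by
    rw [← lintegral_const]
    refine lintegral_mono_ae ?_
    have hae : ∀ᵐ x ∂μ, x ∈ P := by rw [ae_iff]; exact hμP
    filter_upwards [hae] with x hx
    rw [hQP x hx]
    exact hq2 ⟨x, hx⟩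
  have hfinal := mul_sq_le_of_mul_le (measure_ne_top μ _) (hlow.trans hmain)
  calc _ ≤ μ Set.univ * l ^ 2 := by gcongr
    _ ≤ _ := hfinal
    _ = _ := by
      rw [ENNReal.coe_mul, ENNReal.coe_pow]; rfl

/-! ### Convergence off the exceptional set -/

theorem memLp_hat {s : ℝ} (hs : 0 ≤ s) {f : LTwo} (hf : f ∈ sobolevSpace s) :
    MemLp (hat f) 2 volume := by
  refine ⟨(measurable_hat f).aestronglyMeasurable, ?_⟩
  rw [eLpNorm_lt_top_iff_lintegral_rpow_enorm_lt_top (by norm_num) (by norm_num)]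
  have h1 : sobolevNorm s f < ∞ := hf
  have h2 := (ENNReal.rpow_lt_top_iff_of_pos (by norm_num)).1 h1
  refine (lintegral_mono fun ξ => ?_).trans_lt h2
  rw [ENNReal.toReal_ofNat, ENNReal.rpow_two]
  refine le_mul_of_one_le_left zero_le (ENNReal.one_le_ofReal.2 ?_)
  exact Real.one_le_rpow (by nlinarith [sq_nonneg |ξ|]) hs

/-- As `|ξ| / 0 = 0` and `psi 0 = 1`, the index `N = 0` encodes the untruncated factor. -/
theorem tendsto_osc (t x ξ : ℝ) :
    Tendsto (fun N : ℕ => osc N t x ξ) atTop (𝓝 (osc 0 t x ξ)) := by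
  have h1 : Tendsto (fun N : ℕ => |ξ| / (N : ℝ)) atTop (𝓝 (|ξ| / ((0 : ℕ) : ℝ))) := by
    rw [Nat.cast_zero, div_zero]
    exact tendsto_const_div_atTop_nhds_zero_nat _
  have h2 := (Complex.continuous_ofReal.tendsto _).comp ((continuous_psi.tendsto _).comp h1)
  exact (h2.mul_const _).mul_const _

theorem continuous_osc_time (N : ℕ) (x ξ : ℝ) : Continuous fun t => osc N t x ξ := by
  unfold osc
  fun_prop

theorem norm_osc_mul_le (N : ℕ) (t x ξ : ℝ) (z : ℂ) : ‖osc N t x ξ * z‖ ≤ ‖z‖ := by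
  rw [norm_mul]
  exact mul_le_of_le_one_left (norm_nonneg _) (norm_osc_le_one _ _ _ _)

theorem integrable_osc_mul {h : ℝ → ℂ} (hh : MemLp h 2 volume) {N : ℕ} (hN : 1 ≤ N) (t x : ℝ) :
    Integrable fun ξ => osc N t x ξ * h ξ := by
  have h1 : MemLp (osc N t x) 2 volume := by
    have := memLp_psi hN Set.univ
    rw [Measure.restrict_univ] at this
    refine this.mono (continuous_osc N t x).aestronglyMeasurable (Eventually.of_forall fun ξ => ?_)
    rw [norm_osc]
    exact le_abs_self _
  exact h1.integrable_mul hh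

/-- On a set of finite measure `hat f` is integrable, so each frequency piece converges as `N → ∞`
and its limit is continuous in `t`. The summable bound, uniform in `t` and `N ≥ 1`, carries both
facts over to the series. -/
theorem convergesAt_of_eventually {f : LTwo} (hf : MemLp (hat f) 2 volume) {A : ℕ → Set ℝ}
    (hAm : ∀ m, MeasurableSet (A m)) (hAd : Pairwise (Function.onFun Disjoint A))
    (hAu : ⋃ m, A m = Set.univ) (hAv : ∀ m, volume (A m) < ∞) {x : ℝ} {J : ℕ}
    (hx : ∀ m, J ≤ m → ∀ (t : ℝ) (N : ℕ), 1 ≤ N →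
      ‖∫ ξ in A m, osc N t x ξ * hat f ξ‖ ≤ (1 / 2) ^ m) : ConvergesAt f x := by
  have hint : ∀ m, IntegrableOn (hat f) (A m) := fun m => by
    have : IsFiniteMeasure (volume.restrict (A m)) := ⟨by simpa using hAv m⟩
    exact (hf.restrict (A m)).integrable (by norm_num)
  set b : ℕ → ℕ → ℝ → ℂ := fun m N t => ∫ ξ in A m, osc N t x ξ * hat f ξ with hb
  have hmeas : ∀ N t, Measurable fun ξ => osc N t x ξ * hat f ξ := fun N t =>
    (continuous_osc N t x).measurable.mul (measurable_hat f)
  have hbN : ∀ m t, Tendsto (fun N => b m N t) atTop (𝓝 (b m 0 t)) := fun m t =>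
    tendsto_integral_of_dominated_convergence (fun ξ => ‖hat f ξ‖)
      (fun N => (hmeas N t).aestronglyMeasurable) (hint m).norm
      (fun N => Eventually.of_forall fun ξ => norm_osc_mul_le N t x ξ _)
      (Eventually.of_forall fun ξ => (tendsto_osc t x ξ).mul_const _)
  have hbt : ∀ m, Continuous fun t => b m 0 t := fun m =>
    continuous_of_dominated (bound := fun ξ => ‖hat f ξ‖)
      (fun t => (hmeas 0 t).aestronglyMeasurable)
      (fun t => Eventually.of_forall fun ξ => norm_osc_mul_le 0 t x ξ _) (hint m).norm
      (Eventually.of_forall fun ξ => (continuous_osc_time 0 x ξ).mul continuous_const)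
  -- The finitely many early pieces are bounded by the `L¹` norm of `hat f` there.
  set bd : ℕ → ℝ := fun m => if J ≤ m then (1 / 2) ^ m else ∫ ξ in A m, ‖hat f ξ‖ with hbd
  have hbds : Summable bd := by
    refine (summable_nat_add_iff J).1 ?_
    have : (fun m => bd (m + J)) = fun m => (1 / 2 : ℝ) ^ m * (1 / 2) ^ J := by
      ext m
      simp only [hbd, if_pos (Nat.le_add_left J m), pow_add]
    rw [this]
    exact (summable_geometric_of_lt_one (by norm_num) (by norm_num)).mul_right _
  have hbound1 : ∀ m N t, 1 ≤ N → ‖b m N t‖ ≤ bd m := by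
    intro m N t hN
    simp only [hbd]
    split_ifs with hm
    · exact hx m hm t N hN
    · exact norm_integral_le_of_norm_le (hint m).norm
        (Eventually.of_forall fun ξ => norm_osc_mul_le N t x ξ _)
  have hbound0 : ∀ m t, ‖b m 0 t‖ ≤ bd m := fun m t =>
    le_of_tendsto (hbN m t).norm
      ((eventually_ge_atTop 1).mono fun N hN => hbound1 m N t hN)
  have hsum : ∀ N t, 1 ≤ N → ∫ ξ, osc N t x ξ * hat f ξ = ∑' m, b m N t := by
    intro N t hN
    have hI := integrable_osc_mul hf hN t x
    have := integral_iUnion hAm hAd (f := fun ξ => osc N t x ξ * hat f ξ) (μ := volume)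
      (by rw [hAu]; exact hI.integrableOn)
    rwa [hAu, Measure.restrict_univ] at this
  refine ⟨fun t => ((2 * Real.pi)⁻¹ : ℝ) * ∑' m, b m 0 t, Eventually.of_forall fun t => ?_, ?_⟩
  · have h1 : Tendsto (fun N => ∑' m, b m N t) atTop (𝓝 (∑' m, b m 0 t)) :=
      tendsto_tsum_of_dominated_convergence hbds (fun m => hbN m t)
        ((eventually_ge_atTop 1).mono fun N hN m => hbound1 m N t hN)
    refine (h1.const_mul _).congr' ?_
    filter_upwards [eventually_ge_atTop 1] with N hN
    rw [truncated_eq, hsum N t hN]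
  · refine Tendsto.const_mul _ ?_
    exact tendsto_tsum_of_dominated_convergence hbds
      (fun m => ((hbt m).tendsto 0).mono_left nhdsWithin_le_nhds)
      (Eventually.of_forall fun t m => hbound0 m t)

/-! ### The dimension of the divergence set -/

/-- The tails decay like `16^{-m}` so as to beat the squared thresholds `4^{-m}`; `R 0 = 0` lets the
annuli exhaust the line. -/
theorem exists_radii {w : ℝ → ℝ≥0∞} (hw : ∫⁻ ξ, w ξ ≠ ∞) :
    ∃ R : ℕ → ℕ, StrictMono R ∧ R 0 = 0 ∧
      ∀ m, 1 ≤ m → ∫⁻ ξ in {ξ : ℝ | (R m : ℝ) ≤ |ξ|}, w ξ ≤ (1 / 16) ^ m := by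
  have hms : ∀ k : ℕ, MeasurableSet {ξ : ℝ | (k : ℝ) ≤ |ξ|} := fun k =>
    measurableSet_le measurable_const measurable_id.abs
  have hlim : Tendsto (fun k : ℕ => ∫⁻ ξ in {ξ : ℝ | (k : ℝ) ≤ |ξ|}, w ξ) atTop (𝓝 0) := by
    have h := tendsto_measure_iInter_atTop (μ := volume.withDensity w)
      (s := fun k : ℕ => {ξ : ℝ | (k : ℝ) ≤ |ξ|}) (fun k => (hms k).nullMeasurableSet)
      (fun j k hjk ξ hξ => le_trans (Nat.cast_le.2 hjk) (show (k : ℝ) ≤ |ξ| from hξ))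
      ⟨0, ne_top_of_le_ne_top hw (by
        rw [withDensity_apply w (hms 0)]; exact setLIntegral_le_lintegral _ _)⟩
    have h0 : ⋂ k : ℕ, {ξ : ℝ | (k : ℝ) ≤ |ξ|} = ∅ := by
      refine Set.eq_empty_of_forall_notMem fun ξ hξ => ?_
      obtain ⟨k, hk⟩ := exists_nat_gt |ξ|
      exact absurd hk (not_lt.2 (Set.mem_iInter.1 hξ k))
    rw [h0, measure_empty] at h
    exact h.congr fun k => withDensity_apply w (hms k)
  have hev : ∀ m : ℕ, ∀ᶠ k : ℕ in atTop,
      ∫⁻ ξ in {ξ : ℝ | (k : ℝ) ≤ |ξ|}, w ξ ≤ (1 / 16) ^ m := fun m =>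
    hlim.eventually_le_const (by simp [pos_iff_ne_zero])
  obtain ⟨φ, hφ, hφP⟩ := extraction_forall_of_eventually hev
  refine ⟨fun m => if m = 0 then 0 else φ m, ?_, by simp, fun m hm => ?_⟩
  · refine strictMono_nat_of_lt_succ fun m => ?_
    simp only [Nat.succ_ne_zero, if_false]
    split_ifs
    · exact (Nat.zero_le _).trans_lt (hφ m.lt_succ_self)
    · exact hφ m.lt_succ_self
  · have h0 : m ≠ 0 := by omega
    simp only [if_neg h0]
    exact hφP m

/-- On each unit interval the `m`-th level set at height `2^{-m}` has a cover of size
`O(16^{-m}/4^{-m})`, which is summable. The points in infinitely many level sets are therefore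
Hausdorff null, and all others are points of convergence. -/
theorem dimH_divergenceSet_le {s α : ℝ} (hs : 1 / 4 ≤ s) (hs' : s ≤ 1 / 2) (hα : 1 - 2 * s < α)
    {f : LTwo} (hf : f ∈ sobolevSpace s) : dimH (divergenceSet f) ≤ ENNReal.ofReal α := by
  obtain ⟨s₀, hs1, hs2, hs3, hs4⟩ := exists_sobolev_exponent hs hs' hα
  have hα0 : 0 < α := by linarith
  obtain ⟨C, hC⟩ := exists_cover_levelSet hs1 hs2 hs4
  set w : ℝ → ℝ≥0∞ := fun ξ => ENNReal.ofReal ((1 + |ξ| ^ 2) ^ s₀) * ‖hat f ξ‖ₑ ^ 2 with hw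
  have hfin : ∫⁻ ξ, w ξ ≠ ∞ := by
    have h1 : sobolevNorm s₀ f < ∞ := (sobolevNorm_mono hs3 f).trans_lt hf
    exact ((ENNReal.rpow_lt_top_iff_of_pos (by norm_num)).1 h1).ne
  obtain ⟨R, hR, hR0, hRw⟩ := exists_radii hfin
  set A : ℕ → Set ℝ := fun m => annulus (R m) (R (m + 1)) with hA
  have hRR : ∀ m, (R m : ℝ) ≤ R (m + 1) := fun m => Nat.cast_le.2 (hR m.lt_succ_self).le
  have hRmono : Monotone fun m => (R m : ℝ) := monotone_nat_of_le_succ hRR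
  have hAd : Pairwise (Function.onFun Disjoint A) := fun m n hmn =>
    (hRmono.pairwise_disjoint_on_Ico_succ hmn).preimage abs
  have hAu : ⋃ m, A m = Set.univ := by
    refine Set.eq_univ_of_forall fun ξ => ?_
    have hex : ∃ m, |ξ| < R m := by
      obtain ⟨n, hn⟩ := exists_nat_gt |ξ|
      exact ⟨n, hn.trans_le (Nat.cast_le.2 (hR.le_apply))⟩
    classical
    have h1 := Nat.find_spec hex
    have h0 : Nat.find hex ≠ 0 := fun h0 => by
      rw [h0, hR0, Nat.cast_zero] at h1
      exact absurd h1 (not_lt.2 (abs_nonneg _))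
    obtain ⟨m, hm⟩ := Nat.exists_eq_succ_of_ne_zero h0
    refine Set.mem_iUnion.2 ⟨m, ?_, ?_⟩
    · exact not_lt.1 (Nat.find_min hex (by omega))
    · rw [hm] at h1; exact h1
  set l : ℕ → ℝ≥0∞ := fun m => (1 / 2) ^ m with hl
  have hcov := fun (i : ℤ) (m : ℕ) => hC (R m) (R (m + 1)) (hat f) (l m) i (Nat.cast_nonneg _)
    (hRR m) (measurable_hat f) (ne_top_of_le_ne_top hfin (setLIntegral_le_lintegral _ _))
  choose S hS1 hS2 using hcov
  have hterm : ∀ i m, ∑ p ∈ S i m, dyadicSize α p.1 ≤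
      (C * ((∫⁻ ξ, w ξ) + 1)) * (1 / 4) ^ m := by
    intro i m
    -- The total energy covers `m = 0`, where the radii promise nothing; the `1` covers `m ≥ 1`.
    have hWm : ∫⁻ ξ in A m, w ξ ≤ ((∫⁻ ξ, w ξ) + 1) * (1 / 16) ^ m := by
      rcases Nat.eq_zero_or_pos m with h0 | h0
      · rw [h0, pow_zero, mul_one]
        exact (setLIntegral_le_lintegral _ _).trans le_self_add
      · refine ((lintegral_mono_set fun ξ hξ => hξ.1).trans (hRw m h0)).trans ?_
        exact le_mul_of_one_le_left zero_le le_add_self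
    have h4 : (4 : ℝ≥0∞) ^ m * (1 / 16) ^ m = (1 / 4) ^ m := by
      rw [← mul_pow]; congr 1
      rw [show (16 : ℝ≥0∞) = 4 * 4 by norm_num, one_div, one_div,
        ENNReal.mul_inv (by simp) (by simp), ← mul_assoc, ENNReal.mul_inv_cancel (by simp)
        (by simp), one_mul]
    have hl4 : l m ^ 2 * 4 ^ m = 1 := by
      rw [hl, ← pow_mul, mul_comm m 2, pow_mul, ← mul_pow]
      rw [show (1 / 2 : ℝ≥0∞) ^ 2 * 4 = 1 from ?_, one_pow]
      rw [show (4 : ℝ≥0∞) = 2 ^ 2 by norm_num, ← mul_pow, one_div,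
        ENNReal.inv_mul_cancel (by simp) (by simp), one_pow]
    calc ∑ p ∈ S i m, dyadicSize α p.1
        = ((∑ p ∈ S i m, dyadicSize α p.1) * l m ^ 2) * 4 ^ m := by rw [mul_assoc, hl4, mul_one]
      _ ≤ (C * (∫⁻ ξ in A m, w ξ)) * 4 ^ m := mul_le_mul' (hS2 i m) le_rfl
      _ ≤ (C * (((∫⁻ ξ, w ξ) + 1) * (1 / 16) ^ m)) * 4 ^ m := by gcongr
      _ = (C * ((∫⁻ ξ, w ξ) + 1)) * (4 ^ m * (1 / 16) ^ m) := by ring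
      _ = _ := by rw [h4]
  have hsum : ∀ i, ∑' m, ∑ p ∈ S i m, dyadicSize α p.1 ≠ ∞ := by
    intro i
    refine ne_top_of_le_ne_top ?_ (ENNReal.tsum_le_tsum (hterm i))
    rw [ENNReal.tsum_mul_left, ENNReal.tsum_geometric]
    refine ENNReal.mul_ne_top (ENNReal.mul_ne_top (by simp) (by simpa using hfin)) ?_
    rw [ENNReal.inv_ne_top]
    have : (1 / 4 : ℝ≥0∞) < 1 := by
      rw [one_div]; exact ENNReal.inv_lt_one.2 (by norm_num)
    exact (tsub_pos_of_lt this).ne'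
  have hnull := fun i => hausdorffMeasure_frequently_eq_zero hα0 (hS1 i) (hsum i)
  have hsub : divergenceSet f ⊆ ⋃ i : ℤ,
      {x | ∃ᶠ m in atTop, x ∈ levelSet (A m) (hat f) (l m) ∩ dyadic 0 i} := by
    intro x hx
    refine Set.mem_iUnion.2 ⟨⌊2 ^ 0 * x⌋, ?_⟩
    by_contra hnot
    refine hx ?_
    have hnot' : ¬ ∃ᶠ m in atTop, x ∈ levelSet (A m) (hat f) (l m) ∩ dyadic 0 ⌊2 ^ 0 * x⌋ := hnot
    rw [not_frequently, eventually_atTop] at hnot'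
    obtain ⟨J, hJ⟩ := hnot'
    refine convergesAt_of_eventually (memLp_hat (by linarith) hf)
      (fun m => measurableSet_annulus _ _) hAd hAu (fun m => volume_annulus_lt_top _ _)
      (J := J) fun m hm t N hN => ?_
    by_contra hgt
    push Not at hgt
    refine hJ m hm ⟨⟨t, N, hN, ?_⟩, rfl⟩
    rw [← ofReal_norm]
    have : l m = ENNReal.ofReal ((1 / 2) ^ m) := by
      rw [hl, ENNReal.ofReal_pow (by norm_num), ENNReal.ofReal_div_of_pos (by norm_num)]
      simp
    rw [this]
    exact ENNReal.ofReal_le_ofReal hgt.le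
  refine (dimH_mono hsub).trans ?_
  rw [dimH_iUnion]
  refine iSup_le fun i => ?_
  refine dimH_le_of_hausdorffMeasure_ne_top (d := α.toNNReal) ?_
  rw [Real.coe_toNNReal α hα0.le, hnull i]
  exact ENNReal.zero_ne_top

theorem alphaDiv_le {s : ℝ} (hs : 1 / 4 ≤ s) (hs' : s ≤ 1 / 2) :
    alphaDiv s ≤ ENNReal.ofReal (1 - 2 * s) := by
  refine iSup₂_le fun f hf => ?_
  refine le_of_forall_gt_imp_ge_of_dense fun b hb => ?_
  obtain ⟨c, hc1, hc2⟩ := exists_between hb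
  have hct : c ≠ ∞ := hc2.ne_top
  refine le_trans ?_ hc2.le
  rw [← ENNReal.ofReal_toReal hct]
  exact dimH_divergenceSet_le hs hs' ((ENNReal.ofReal_lt_iff_lt_toReal (by linarith) hct).1 hc1) hf

/-! ### A Cantor measure -/

/-- The distribution of a fair coin. -/
noncomputable def coin : Measure Bool :=
  (2⁻¹ : ℝ≥0∞) • (Measure.dirac true + Measure.dirac false)

theorem coin_singleton (b : Bool) : coin {b} = 2⁻¹ := by
  cases b <;> simp [coin]

instance : IsProbabilityMeasure coin := ⟨by
  simp only [coin, Measure.smul_apply, Measure.add_apply, measure_univ, smul_eq_mul]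
  rw [show (1 : ℝ≥0∞) + 1 = 2 by norm_num, ENNReal.inv_mul_cancel (by simp) (by simp)]⟩

/-- Independent fair coin tosses. -/
noncomputable def coinTosses : Measure (ℕ → Bool) := Measure.infinitePi fun _ => coin

instance : IsProbabilityMeasure coinTosses := by
  unfold coinTosses; infer_instance

theorem coinTosses_cylinder (b : ℕ → Bool) (n : ℕ) :
    coinTosses {b' | ∀ i < n, b' i = b i} = 2⁻¹ ^ n := by
  have h : {b' : ℕ → Bool | ∀ i < n, b' i = b i} =
      Set.pi (Finset.range n) fun i => ({b i} : Set Bool) := by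
    ext b'
    simp [Set.mem_pi]
  rw [h, coinTosses, Measure.infinitePi_pi _ fun i _ => measurableSet_singleton _]
  simp [coin_singleton]

/-- The parametrization `b ↦ ∑ b_n q^{n+1}` of the Cantor set of ratio `q`. -/
noncomputable def cantorMap (q : ℝ) (b : ℕ → Bool) : ℝ := ∑' n, if b n then q ^ (n + 1) else 0

section CantorMap

variable {q : ℝ}

theorem norm_cantorMap_term_le (hq : 0 < q) (b : ℕ → Bool) (n : ℕ) :
    ‖(if b n then q ^ (n + 1) else 0 : ℝ)‖ ≤ q ^ (n + 1) := by
  split_ifs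
  · rw [Real.norm_of_nonneg (by positivity)]
  · rw [norm_zero]; positivity

theorem summable_pow_succ (hq : 0 < q) (hq1 : q < 1) : Summable fun n : ℕ => q ^ (n + 1) :=
  (summable_nat_add_iff 1).2 (summable_geometric_of_lt_one hq.le hq1)

theorem summable_cantorMap (hq : 0 < q) (hq1 : q < 1) (b : ℕ → Bool) :
    Summable fun n => (if b n then q ^ (n + 1) else 0 : ℝ) :=
  Summable.of_norm_bounded (summable_pow_succ hq hq1) (norm_cantorMap_term_le hq b)

theorem continuous_cantorMap (hq : 0 < q) (hq1 : q < 1) : Continuous (cantorMap q) := by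
  refine continuous_tsum (fun n => ?_) (summable_pow_succ hq hq1)
    fun n b => norm_cantorMap_term_le hq b n
  exact (continuous_of_discreteTopology (f := fun c : Bool => if c then q ^ (n + 1) else 0)).comp
    (continuous_apply n)

theorem cantorMap_nonneg (hq : 0 < q) (b : ℕ → Bool) : 0 ≤ cantorMap q b :=
  tsum_nonneg fun n => by split_ifs <;> positivity

theorem cantorMap_le (hq : 0 < q) (hq1 : q < 1) (b : ℕ → Bool) :
    cantorMap q b ≤ q / (1 - q) := by
  have h : ∑' n : ℕ, q ^ (n + 1) = q / (1 - q) := by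
    simp only [pow_succ']
    rw [tsum_mul_left, tsum_geometric_of_lt_one hq.le hq1, div_eq_mul_inv]
  rw [← h]
  refine Summable.tsum_le_tsum (fun n => ?_) (summable_cantorMap hq hq1 b)
    (summable_pow_succ hq hq1)
  exact (le_abs_self _).trans (norm_cantorMap_term_le hq b n)

theorem cantorMap_eq (hq : 0 < q) (hq1 : q < 1) (b : ℕ → Bool) :
    cantorMap q b = (if b 0 then q else 0) + q * cantorMap q fun n => b (n + 1) := by
  rw [cantorMap, (summable_cantorMap hq hq1 b).tsum_eq_zero_add, cantorMap, ← tsum_mul_left]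
  congr 1
  · simp
  · refine tsum_congr fun n => ?_
    split_ifs
    · ring
    · simp

theorem cantorMap_sub_of_agree (hq : 0 < q) (hq1 : q < 1) (n : ℕ) : ∀ b b' : ℕ → Bool,
    (∀ i < n, b i = b' i) → cantorMap q b - cantorMap q b' =
      q ^ n * (cantorMap q (fun i => b (i + n)) - cantorMap q fun i => b' (i + n)) := by
  induction n with
  | zero => intro b b' _; simp
  | succ n ih =>
    intro b b' h
    rw [cantorMap_eq hq hq1 b, cantorMap_eq hq hq1 b', h 0 n.succ_pos]
    have h2 := ih (fun i => b (i + 1)) (fun i => b' (i + 1)) fun i hi => h (i + 1) (by omega)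
    rw [add_sub_add_left_eq_sub, ← mul_sub, h2, pow_succ', mul_assoc]
    rfl

theorem abs_cantorMap_sub_lt (hq : 0 < q) (hq2 : q < 1 / 2) {n : ℕ} {b b' : ℕ → Bool}
    (h : ∀ i < n, b i = b' i) : |cantorMap q b - cantorMap q b'| < q ^ n := by
  have hq1 : q < 1 := by linarith
  have hρ : q / (1 - q) < 1 := by rw [div_lt_one (by linarith)]; linarith
  rw [cantorMap_sub_of_agree hq hq1 n b b' h, abs_mul, abs_of_pos (pow_pos hq n)]
  refine mul_lt_of_lt_one_right (pow_pos hq n) (abs_lt.2 ⟨?_, ?_⟩)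
  · have h1 := cantorMap_nonneg hq fun i => b (i + n)
    have h2 := cantorMap_le hq hq1 fun i => b' (i + n)
    linarith
  · have h1 := cantorMap_nonneg hq fun i => b' (i + n)
    have h2 := cantorMap_le hq hq1 fun i => b (i + n)
    linarith

/-- The first differing digit separates by `q^{n+1}`, and all later digits can undo only the
fraction `q/(1-q) < 1` of it. -/
theorem le_abs_cantorMap_sub (hq : 0 < q) (hq2 : q < 1 / 2) {n : ℕ} {b b' : ℕ → Bool}
    (h : ∀ i < n, b i = b' i) (hn : b n ≠ b' n) :
    q ^ (n + 1) * (1 - q / (1 - q)) ≤ |cantorMap q b - cantorMap q b'| := by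
  have hq1 : q < 1 := by linarith
  wlog hb : b n = true generalizing b b'
  · rw [abs_sub_comm]
    refine this (fun i hi => (h i hi).symm) hn.symm ?_
    cases hb' : b' n
    · rw [hb'] at hn; simp_all
    · rfl
  have hb' : b' n = false := by
    cases hb' : b' n
    · rfl
    · rw [hb, hb'] at hn; exact absurd rfl hn
  rw [cantorMap_sub_of_agree hq hq1 n b b' h, cantorMap_eq hq hq1 fun i => b (i + n),
    cantorMap_eq hq hq1 fun i => b' (i + n)]
  simp only [zero_add, hb, hb', if_true, Bool.false_eq_true, if_false]
  have h1 := cantorMap_nonneg hq fun i => b (i + 1 + n)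
  have h2 := cantorMap_le hq hq1 fun i => b' (i + 1 + n)
  refine le_trans ?_ (le_abs_self _)
  rw [pow_succ, mul_assoc]
  refine mul_le_mul_of_nonneg_left ?_ (by positivity)
  nlinarith

end CantorMap

/-- With `q = 2^{-1/α}` a cylinder of `n` digits has mass `2^{-n} = (q^n)^α` and image of diameter
comparable to `q^n`. Separation of cylinders gives the upper bound, their smallness the lower one;
`α < 1` is exactly `q < 1/2`. -/
theorem exists_regular_measure {α : ℝ} (hα : 0 < α) (hα1 : α < 1) :
    ∃ (μ : Measure ℝ) (E : Set ℝ) (c : ℝ), IsProbabilityMeasure μ ∧ μ (Metric.ball (0 : ℝ) 1)ᶜ = 0 ∧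
      μ Eᶜ = 0 ∧ 0 ≤ c ∧ (∀ x r, 0 < r → μ (Metric.ball x r) ≤ ENNReal.ofReal (c * r ^ α)) ∧
      ∀ x ∈ E, ∀ r, 0 < r → r ≤ 1 → ENNReal.ofReal (1 / 2 * r ^ α) ≤ μ (Metric.ball x r) := by
  set q : ℝ := 2 ^ (-(1 / α)) with hqdef
  have hq : 0 < q := by positivity
  have hq2 : q < 1 / 2 := by
    rw [hqdef, one_div (2 : ℝ), ← Real.rpow_neg_one]
    refine Real.rpow_lt_rpow_of_exponent_lt (by norm_num) (neg_lt_neg ?_)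
    rw [lt_div_iff₀ hα]; linarith
  have hq1 : q < 1 := by linarith
  have hqα : ∀ n : ℕ, (q ^ n) ^ α = (1 / 2) ^ n := by
    intro n
    rw [← Real.rpow_natCast, ← Real.rpow_mul hq.le, mul_comm, Real.rpow_mul hq.le,
      Real.rpow_natCast, hqdef, ← Real.rpow_mul (by norm_num)]
    congr 1
    rw [neg_mul, one_div_mul_cancel hα.ne', Real.rpow_neg_one]
    norm_num
  have htwo : ∀ n : ℕ, (2⁻¹ : ℝ≥0∞) ^ n = ENNReal.ofReal ((q ^ n) ^ α) := by
    intro n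
    rw [hqα, ENNReal.ofReal_pow (by norm_num), one_div, ENNReal.ofReal_inv_of_pos (by norm_num)]
    simp
  set ρ := q / (1 - q) with hρdef
  have hρ : ρ < 1 := by rw [hρdef, div_lt_one (by linarith)]; linarith
  have hcont := continuous_cantorMap hq hq1
  have hm : Measurable (cantorMap q) := hcont.measurable
  have hK : IsCompact (Set.range (cantorMap q)) := isCompact_range hcont
  have hprob : IsProbabilityMeasure (coinTosses.map (cantorMap q)) :=
    Measure.isProbabilityMeasure_map hm.aemeasurable
  have hnull : (coinTosses.map (cantorMap q)) (Set.range (cantorMap q))ᶜ = 0 := by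
    rw [Measure.map_apply hm hK.measurableSet.compl, Set.preimage_compl, Set.preimage_range,
      Set.compl_univ, measure_empty]
  refine ⟨coinTosses.map (cantorMap q), Set.range (cantorMap q), 2 * (2 / (1 - ρ)) ^ α, hprob,
    measure_mono_null (Set.compl_subset_compl.2 ?_) hnull, hnull, ?_, ?_, ?_⟩
  · rintro _ ⟨b, rfl⟩
    rw [Metric.mem_ball, Real.dist_eq, sub_zero, abs_of_nonneg (cantorMap_nonneg hq b)]
    exact (cantorMap_le hq hq1 b).trans_lt hρ
  · have : 0 < 1 - ρ := by linarith
    positivity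
  · intro x r hr
    have h1ρ : 0 < 1 - ρ := by linarith
    rw [Measure.map_apply hm measurableSet_ball]
    rcases (cantorMap q ⁻¹' Metric.ball x r).eq_empty_or_nonempty with h0 | ⟨b₀, hb₀⟩
    · rw [h0, measure_empty]; exact zero_le
    -- Two points of the ball differ by less than `2r`; once `y ≤ q^n`, this is at most the gap `q^n
    -- (1-ρ)`, so their first `n` digits agree.
    set y := 2 * r / (1 - ρ) with hy
    have hy0 : 0 < y := by positivity
    have hc : 2 * (2 / (1 - ρ)) ^ α * r ^ α = 2 * y ^ α := by
      rw [mul_assoc, ← Real.mul_rpow (by positivity) hr.le, hy]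
      congr 2; ring
    rw [hc]
    rcases le_or_gt 1 y with hy1 | hy1
    · refine prob_le_one.trans (ENNReal.one_le_ofReal.2 ?_)
      have := Real.one_le_rpow hy1 hα.le
      linarith
    obtain ⟨n, hn1, hn2⟩ := exists_nat_pow_near_of_lt_one hy0 hy1.le hq hq1
    have hagree : cantorMap q ⁻¹' Metric.ball x r ⊆ {b | ∀ i < n, b i = b₀ i} := by
      intro b hb
      by_contra hne
      have hne' : ∃ i, i < n ∧ b i ≠ b₀ i := by
        by_contra! h; exact hne h
      classical
      obtain ⟨hm1, hm2⟩ := Nat.find_spec hne'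
      have hmin : ∀ i < Nat.find hne', b i = b₀ i := fun i hi => by
        by_contra hi'
        exact Nat.find_min hne' hi ⟨hi.trans hm1, hi'⟩
      have h3 := le_abs_cantorMap_sub hq hq2 hmin hm2
      have h4 : q ^ n ≤ q ^ (Nat.find hne' + 1) :=
        pow_le_pow_of_le_one hq.le hq1.le hm1
      have h5 : |cantorMap q b - cantorMap q b₀| < 2 * r := by
        have e1 : dist (cantorMap q b) x < r := hb
        have e2 : dist (cantorMap q b₀) x < r := hb₀
        have := dist_triangle_right (cantorMap q b) (cantorMap q b₀) x
        rw [← Real.dist_eq]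
        linarith
      have h6 : 2 * r ≤ q ^ n * (1 - ρ) := by
        rw [hy, div_le_iff₀ h1ρ] at hn2; exact hn2
      have h7 := mul_le_mul_of_nonneg_right h4 h1ρ.le
      linarith
    calc _ ≤ coinTosses {b | ∀ i < n, b i = b₀ i} := measure_mono hagree
      _ = ENNReal.ofReal ((q ^ n) ^ α) := by rw [coinTosses_cylinder, htwo]
      _ ≤ _ := by
          refine ENNReal.ofReal_le_ofReal ?_
          have h8 : (q ^ (n + 1)) ^ α ≤ y ^ α := Real.rpow_le_rpow (by positivity) hn1.le hα.le
          rw [hqα, pow_succ] at h8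
          rw [hqα]
          linarith
  · rintro _ ⟨b, rfl⟩ r hr hr1
    obtain ⟨n, hn1, hn2⟩ := exists_nat_pow_near_of_lt_one hr hr1 hq hq1
    rw [Measure.map_apply hm measurableSet_ball]
    have hsub : {b' | ∀ i < n + 1, b' i = b i} ⊆
        cantorMap q ⁻¹' Metric.ball (cantorMap q b) r := by
      intro b' hb'
      rw [Set.mem_preimage, Metric.mem_ball, Real.dist_eq]
      exact (abs_cantorMap_sub_lt hq hq2 hb').trans hn1
    refine le_trans ?_ (measure_mono hsub)
    rw [coinTosses_cylinder, htwo, hqα, pow_succ, ← hqα]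
    refine ENNReal.ofReal_le_ofReal ?_
    have := Real.rpow_le_rpow hr.le hn2 hα.le
    linarith

/-! ### Functions that are infinite on a Cantor set -/

/-- Plancherel surjectivity, after a dilation by `2π`; dilations preserve null sets. -/
theorem exists_hat_ae_eq {g : ℝ → ℂ} (hg : MemLp g 2 volume) : ∃ f : LTwo, hat f =ᵐ[volume] g := by
  have hπ : (2 * Real.pi) ≠ 0 := by positivity
  have hπ' : (2 * Real.pi)⁻¹ ≠ 0 := inv_ne_zero hπ
  have hG : MemLp (fun η => g (2 * Real.pi * η)) 2 volume := by
    have hq : Measure.QuasiMeasurePreserving (fun η : ℝ => 2 * Real.pi * η) volume volume :=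
      ⟨measurable_const_mul _, Measure.AbsolutelyContinuous.mk fun s hs h0 => by
        rw [Measure.map_apply (measurable_const_mul _) hs, Real.volume_preimage_mul_left hπ, h0,
          mul_zero]⟩
    refine (memLp_two_iff_integrable_sq_norm
      (hg.aestronglyMeasurable.comp_quasiMeasurePreserving hq)).2 ?_
    exact ((memLp_two_iff_integrable_sq_norm hg.aestronglyMeasurable).1 hg).comp_mul_left' hπ
  obtain ⟨f, hf⟩ := (Lp.fourierTransformₗᵢ ℝ ℂ).surjective (hG.toLp _)
  have hf' : (𝓕 f : LTwo) = hG.toLp _ := hf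
  refine ⟨f, ?_⟩
  have hae : (𝓕 f : LTwo) =ᵐ[volume] fun η => g (2 * Real.pi * η) := by
    rw [hf']; exact hG.coeFn_toLp
  have hq : Measure.QuasiMeasurePreserving (fun ξ : ℝ => (2 * Real.pi)⁻¹ * ξ) volume volume :=
    ⟨measurable_const_mul _, Measure.AbsolutelyContinuous.mk fun s hs h0 => by
      rw [Measure.map_apply (measurable_const_mul _) hs, Real.volume_preimage_mul_left hπ', h0,
        mul_zero]⟩
  filter_upwards [hq.ae hae] with ξ hξ
  rw [hat, div_eq_inv_mul, hξ, mul_inv_cancel_left₀ hπ]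

theorem integral_exp_mul_gaussian {v : ℝ} (hv : 0 < v) (x : ℝ) :
    ∫ ξ : ℝ, Complex.exp (Complex.I * (x * ξ : ℝ)) * ((Real.exp (-(v * ξ ^ 2)) : ℝ) : ℂ) =
      ((√(Real.pi / v) * Real.exp (-x ^ 2 / (4 * v)) : ℝ) : ℂ) := by
  have h := fourierIntegral_gaussian (b := (v : ℂ)) (by simpa using hv) (x : ℂ)
  have hsq : ((√(Real.pi / v) : ℝ) : ℂ) = ((Real.pi : ℂ) / v) ^ (1 / 2 : ℂ) := by
    rw [Real.sqrt_eq_rpow, Complex.ofReal_cpow (by positivity)]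
    push_cast
    rfl
  rw [Complex.ofReal_mul, hsq]
  push_cast
  rw [← h]
  refine integral_congr_ae (Eventually.of_forall fun ξ => ?_)
  simp only [mul_assoc, neg_mul]

theorem integrable_exp_neg_mul_sq' {v : ℝ} (hv : 0 < v) :
    Integrable fun ξ : ℝ => Real.exp (-(v * ξ ^ 2)) := by
  simpa only [neg_mul] using integrable_exp_neg_mul_sq hv

/-- The Fourier transform of a measure. -/
noncomputable def measureHat (μ : Measure ℝ) (ξ : ℝ) : ℂ :=
  ∫ y, Complex.exp (-(Complex.I * (y * ξ : ℝ))) ∂μ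

theorem norm_exp_neg_I_mul (r : ℝ) : ‖Complex.exp (-(Complex.I * (r : ℝ)))‖ = 1 := by
  rw [show -(Complex.I * (r : ℂ)) = ((-r : ℝ) : ℂ) * Complex.I by push_cast; ring,
    Complex.norm_exp_ofReal_mul_I]

theorem measurable_measureHat (μ : Measure ℝ) [IsFiniteMeasure μ] : Measurable (measureHat μ) := by
  have : Measurable (Function.uncurry fun (ξ y : ℝ) => Complex.exp (-(Complex.I * (y * ξ : ℝ)))) := by
    unfold Function.uncurry
    fun_prop
  exact this.stronglyMeasurable.integral_prod_right.measurable

theorem norm_measureHat_le (μ : Measure ℝ) [IsProbabilityMeasure μ] (ξ : ℝ) :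
    ‖measureHat μ ξ‖ ≤ 1 := by
  refine (norm_integral_le_of_norm_le_const (C := 1)
    (Eventually.of_forall fun y => (norm_exp_neg_I_mul _).le)).trans ?_
  simp

/-- With `u = |z|/δ` this follows from `(u+1)^β ≤ e^u` and `u - u²/4 ≤ 1`. It dominates a Gaussian
of width `δ` by a truncated Riesz kernel. -/
theorem exp_neg_sq_le {β δ z : ℝ} (hβ1 : β ≤ 1) (hδ : 0 < δ) :
    Real.exp (-z ^ 2 / (4 * δ ^ 2)) ≤ Real.exp 1 * δ ^ β * (|z| + δ) ^ (-β) := by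
  set u := |z| / δ with hu
  have hu0 : 0 ≤ u := by positivity
  have hz : |z| = u * δ := by rw [hu]; field_simp
  have h1 : -z ^ 2 / (4 * δ ^ 2) = -u ^ 2 / 4 := by
    rw [← sq_abs z, hz]; field_simp
  have h2 : (|z| + δ) ^ (-β) = (u + 1) ^ (-β) * δ ^ (-β) := by
    rw [← Real.mul_rpow (by positivity) hδ.le, hz]
    congr 1; ring
  have h3 : (u + 1) ^ β ≤ Real.exp u := by
    calc (u + 1) ^ β ≤ (u + 1) ^ (1 : ℝ) :=
          Real.rpow_le_rpow_of_exponent_le (by linarith) hβ1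
      _ = u + 1 := Real.rpow_one _
      _ ≤ Real.exp u := Real.add_one_le_exp u
  have h4 : Real.exp (-u ^ 2 / 4) * Real.exp u ≤ Real.exp 1 := by
    rw [← Real.exp_add]
    refine Real.exp_le_exp.2 ?_
    nlinarith [sq_nonneg (u - 2)]
  rw [h1, h2]
  have hp : 0 < (u + 1) ^ β := by positivity
  have h5 : Real.exp 1 * δ ^ β * ((u + 1) ^ (-β) * δ ^ (-β)) = Real.exp 1 / (u + 1) ^ β := by
    rw [Real.rpow_neg (by positivity), Real.rpow_neg hδ.le]
    have : δ ^ β ≠ 0 := by positivity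
    field_simp
  rw [h5, le_div_iff₀ hp]
  exact (mul_le_mul_of_nonneg_left h3 (Real.exp_pos _).le).trans h4

theorem one_add_sq_rpow_le {s δ ξ : ℝ} (hs : 0 ≤ s) (hs1 : s ≤ 1) (hδ : 0 < δ) (hδ1 : δ ≤ 1) :
    (1 + |ξ| ^ 2) ^ s ≤ δ ^ (-(2 * s)) * Real.exp (δ ^ 2 * ξ ^ 2) := by
  rw [sq_abs]
  have h1 : δ ^ 2 * (1 + ξ ^ 2) ≤ Real.exp (δ ^ 2 * ξ ^ 2) := by
    have := Real.add_one_le_exp (δ ^ 2 * ξ ^ 2)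
    have h2 : δ ^ 2 ≤ 1 := pow_le_one₀ hδ.le hδ1
    linarith
  have h2 : (δ ^ 2 * (1 + ξ ^ 2)) ^ s ≤ Real.exp (δ ^ 2 * ξ ^ 2) := by
    calc _ ≤ Real.exp (δ ^ 2 * ξ ^ 2) ^ s := Real.rpow_le_rpow (by positivity) h1 hs
      _ ≤ Real.exp (δ ^ 2 * ξ ^ 2) ^ (1 : ℝ) :=
          Real.rpow_le_rpow_of_exponent_le (Real.one_le_exp (by positivity)) hs1
      _ = _ := Real.rpow_one _
  rw [Real.mul_rpow (by positivity) (by positivity), ← Real.rpow_natCast, ← Real.rpow_mul hδ.le]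
    at h2
  rw [Real.rpow_neg hδ.le, inv_mul_eq_div, le_div_iff₀ (by positivity), mul_comm]
  exact_mod_cast h2

/-- Half of the Gaussian absorbs the Sobolev weight at the price `δ^{-2s}`. The other half yields,
after expanding `|μ̂|²`, a Gaussian double integral with prefactor `δ^{-1}`, and the potential bound
gains `δ^β`. -/
theorem exists_energy_le {μ : Measure ℝ} [IsProbabilityMeasure μ]
    (hsupp : μ (Metric.ball (0 : ℝ) 1)ᶜ = 0) {α β s c : ℝ} (hβ : 0 < β) (hβα : β < α) (hβ1 : β ≤ 1)
    (hs : 0 ≤ s) (hs1 : s ≤ 1) (hc : 0 ≤ c)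
    (hball : ∀ x r, 0 < r → μ (Metric.ball x r) ≤ ENNReal.ofReal (c * r ^ α)) :
    ∃ C : ℝ≥0, ∀ δ, 0 < δ → δ ≤ 1 →
      ∫⁻ ξ, ENNReal.ofReal ((1 + |ξ| ^ 2) ^ s * Real.exp (-(2 * δ ^ 2 * ξ ^ 2))) *
        ‖measureHat μ ξ‖ₑ ^ 2 ≤ C * ENNReal.ofReal (δ ^ (β - 2 * s - 1)) := by
  obtain ⟨C₁, hC₁⟩ := exists_lintegral_rpow_neg_le hβ hβα
  refine ⟨(√Real.pi * Real.exp 1).toNNReal * C₁ * c.toNNReal, fun δ hδ hδ1 => ?_⟩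
  have hδ2 : 0 < δ ^ 2 := by positivity
  set Ψ : ℝ → ℝ → ℂ := fun y ξ =>
    Complex.exp (-(Complex.I * (y * ξ : ℝ))) * ((Real.exp (-(δ ^ 2 / 2 * ξ ^ 2)) : ℝ) : ℂ) with hΨ
  have hΨm : Measurable (Function.uncurry Ψ) := by
    simp only [hΨ]
    unfold Function.uncurry
    fun_prop
  have hΨn : ∀ y ξ, ‖Ψ y ξ‖ ≤ Real.exp (-(δ ^ 2 / 2 * ξ ^ 2)) := fun y ξ => by
    simp only [hΨ]
    rw [norm_mul, norm_exp_neg_I_mul, one_mul, Complex.norm_real,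
      Real.norm_of_nonneg (Real.exp_pos _).le]
  have hexp2 : ∀ ξ : ℝ, Real.exp (-(δ ^ 2 / 2 * ξ ^ 2)) ^ 2 = Real.exp (-(δ ^ 2 * ξ ^ 2)) :=
    fun ξ => by
      rw [← Real.exp_nat_mul]; congr 1; push_cast; ring
  have hg : MemLp (fun ξ : ℝ => Real.exp (-(δ ^ 2 / 2 * ξ ^ 2))) 2 volume := by
    rw [memLp_two_iff_integrable_sq (by fun_prop)]
    simp only [hexp2]
    exact integrable_exp_neg_mul_sq' hδ2
  have hTT := lintegral_sq_norm_integral_le (μ := μ) (ν := volume) hΨm hg hΨn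
  have hL : ∀ ξ, ‖∫ y, Ψ y ξ ∂μ‖ₑ ^ 2 =
      ENNReal.ofReal (Real.exp (-(δ ^ 2 * ξ ^ 2))) * ‖measureHat μ ξ‖ₑ ^ 2 := by
    intro ξ
    simp only [hΨ]
    rw [integral_mul_const, enorm_mul, mul_pow, mul_comm, ← hexp2,
      ENNReal.ofReal_pow (Real.exp_pos _).le, measureHat]
    congr 2
    rw [← ofReal_norm, Complex.norm_real, Real.norm_of_nonneg (Real.exp_pos _).le]
  have hK : ∀ x y, ‖∫ ξ, Ψ x ξ * (starRingEnd ℂ) (Ψ y ξ)‖ₑ ≤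
      ENNReal.ofReal (√Real.pi * Real.exp 1 * δ ^ (β - 1)) *
        ENNReal.ofReal (|x - y| + δ) ^ (-β) := by
    intro x y
    have h1 : ∀ ξ, Ψ x ξ * (starRingEnd ℂ) (Ψ y ξ) =
        Complex.exp (Complex.I * ((y - x) * ξ : ℝ)) *
          ((Real.exp (-(δ ^ 2 * ξ ^ 2)) : ℝ) : ℂ) := by
      intro ξ
      simp only [hΨ, map_mul, ← Complex.exp_conj, map_neg, Complex.conj_I, Complex.conj_ofReal]
      rw [← hexp2, mul_mul_mul_comm, ← Complex.exp_add, sq (Real.exp _), Complex.ofReal_mul (Real.exp _)]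
      congr 2
      push_cast
      ring
    simp only [h1]
    have hxy : 0 < |x - y| + δ := by positivity
    rw [integral_exp_mul_gaussian hδ2, ← ofReal_norm, Complex.norm_real,
      Real.norm_of_nonneg (by positivity), ENNReal.ofReal_rpow_of_pos hxy,
      ← ENNReal.ofReal_mul (by positivity)]
    refine ENNReal.ofReal_le_ofReal ?_
    rw [Real.sqrt_div Real.pi_pos.le, Real.sqrt_sq hδ.le, abs_sub_comm, Real.rpow_sub_one hδ.ne']
    calc √Real.pi / δ * Real.exp (-(y - x) ^ 2 / (4 * δ ^ 2))
        ≤ √Real.pi / δ * (Real.exp 1 * δ ^ β * (|y - x| + δ) ^ (-β)) :=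
          mul_le_mul_of_nonneg_left (exp_neg_sq_le hβ1 hδ) (by positivity)
      _ = _ := by ring
  have hsupp' : ∀ᵐ x ∂μ, |x| < 1 := by
    have : ∀ᵐ x ∂μ, x ∈ Metric.ball (0 : ℝ) 1 := by rw [ae_iff]; exact hsupp
    filter_upwards [this] with x hx
    rwa [Metric.mem_ball, Real.dist_eq, sub_zero] at hx
  have hball' : ∀ x r, δ < r → μ (Metric.ball x r) ≤
      ENNReal.ofReal c * ENNReal.ofReal (r ^ α) := fun x r hr => by
    rw [← ENNReal.ofReal_mul hc]; exact hball x r (hδ.trans hr)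
  have hE : ∫⁻ x, ∫⁻ y, ‖∫ ξ, Ψ x ξ * (starRingEnd ℂ) (Ψ y ξ)‖ₑ ∂μ ∂μ ≤
      ENNReal.ofReal (√Real.pi * Real.exp 1 * δ ^ (β - 1)) * (C₁ * ENNReal.ofReal c) := by
    calc _ ≤ ∫⁻ _, ENNReal.ofReal (√Real.pi * Real.exp 1 * δ ^ (β - 1)) *
          (C₁ * ENNReal.ofReal c) ∂μ := by
          refine lintegral_mono_ae ?_
          filter_upwards [hsupp'] with x hx
          have hxy : ∀ᵐ y ∂μ, |x - y| ≤ 2 := by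
            filter_upwards [hsupp'] with y hy
            exact (abs_sub _ _).trans (by linarith)
          refine (lintegral_mono fun y => hK x y).trans ?_
          rw [lintegral_const_mul _ (by fun_prop)]
          gcongr
          exact hC₁ μ δ _ hδ.le hδ1 hball' x hxy
      _ = _ := by rw [lintegral_const, measure_univ, mul_one]
  calc _ ≤ ∫⁻ ξ, ENNReal.ofReal (δ ^ (-(2 * s))) *
        (ENNReal.ofReal (Real.exp (-(δ ^ 2 * ξ ^ 2))) * ‖measureHat μ ξ‖ₑ ^ 2) := by
        refine lintegral_mono fun ξ => ?_
        rw [← mul_assoc, ← ENNReal.ofReal_mul (by positivity)]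
        refine mul_le_mul' (ENNReal.ofReal_le_ofReal ?_) le_rfl
        have h1 := one_add_sq_rpow_le (ξ := ξ) hs hs1 hδ hδ1
        calc _ ≤ δ ^ (-(2 * s)) * Real.exp (δ ^ 2 * ξ ^ 2) *
              Real.exp (-(2 * δ ^ 2 * ξ ^ 2)) :=
              mul_le_mul_of_nonneg_right h1 (Real.exp_pos _).le
          _ = _ := by
              rw [mul_assoc, ← Real.exp_add]
              congr 2; ring
    _ = ENNReal.ofReal (δ ^ (-(2 * s))) * ∫⁻ ξ, ‖∫ y, Ψ y ξ ∂μ‖ₑ ^ 2 := by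
        simp only [hL]
        refine lintegral_const_mul _ ?_
        have := measurable_measureHat μ
        fun_prop
    _ ≤ ENNReal.ofReal (δ ^ (-(2 * s))) *
        (ENNReal.ofReal (√Real.pi * Real.exp 1 * δ ^ (β - 1)) * (C₁ * ENNReal.ofReal c)) :=
        mul_le_mul' le_rfl (hTT.trans hE)
    _ = ENNReal.ofReal (√Real.pi * Real.exp 1) * C₁ * ENNReal.ofReal c *
        ENNReal.ofReal (δ ^ (β - 2 * s - 1)) := by
        rw [ENNReal.ofReal_mul (by positivity : 0 ≤ √Real.pi * Real.exp 1),
          show β - 2 * s - 1 = -(2 * s) + (β - 1) by ring, Real.rpow_add hδ,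
          ENNReal.ofReal_mul (by positivity : 0 ≤ δ ^ (-(2 * s)))]
        ring
    _ = _ := by push_cast; rfl

/-- The scales `2^{-j}`. -/
noncomputable def scale (j : ℕ) : ℝ := (1 / 2) ^ j

theorem scale_pos (j : ℕ) : 0 < scale j := by unfold scale; positivity

theorem scale_le_one (j : ℕ) : scale j ≤ 1 := pow_le_one₀ (by norm_num) (by norm_num)

theorem summable_scale_rpow {κ : ℝ} (hκ : 0 < κ) : Summable fun j => scale j ^ κ := by
  have h : (fun j => scale j ^ κ) = fun j => ((1 / 2 : ℝ) ^ κ) ^ j := by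
    ext j
    rw [scale, ← Real.rpow_natCast, ← Real.rpow_natCast, ← Real.rpow_mul (by norm_num),
      ← Real.rpow_mul (by norm_num), mul_comm]
  rw [h]
  exact summable_geometric_of_lt_one (by positivity)
    (Real.rpow_lt_one (by norm_num) (by norm_num) hκ)

/-- A lacunary superposition of Gaussians. -/
noncomputable def lacunary (α ξ : ℝ) : ℝ :=
  ∑' j, scale j ^ (1 - α) * Real.exp (-(scale j ^ 2 * ξ ^ 2))

theorem lacunary_term_nonneg (α ξ : ℝ) (j : ℕ) :
    0 ≤ scale j ^ (1 - α) * Real.exp (-(scale j ^ 2 * ξ ^ 2)) :=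
  mul_nonneg (Real.rpow_nonneg (scale_pos j).le _) (Real.exp_pos _).le

theorem exp_neg_mul_sq_le_one {v : ℝ} (hv : 0 ≤ v) (ξ : ℝ) : Real.exp (-(v * ξ ^ 2)) ≤ 1 :=
  Real.exp_le_one_iff.2 (by nlinarith [sq_nonneg ξ])

theorem lacunary_term_le (α ξ : ℝ) (j : ℕ) :
    scale j ^ (1 - α) * Real.exp (-(scale j ^ 2 * ξ ^ 2)) ≤ scale j ^ (1 - α) :=
  mul_le_of_le_one_right (Real.rpow_nonneg (scale_pos j).le _)
    (exp_neg_mul_sq_le_one (sq_nonneg _) ξ)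

theorem continuous_lacunary {α : ℝ} (hα : α < 1) : Continuous (lacunary α) := by
  refine continuous_tsum (fun j => by fun_prop)
    (summable_scale_rpow (by linarith : 0 < 1 - α)) fun j ξ => ?_
  rw [Real.norm_of_nonneg (lacunary_term_nonneg α ξ j)]
  exact lacunary_term_le α ξ j

theorem sq_tsum_mul_le {p q : ℕ → ℝ} (hp : ∀ j, 0 ≤ p j) (hq : ∀ j, 0 ≤ q j)
    (hps : Summable fun j => p j ^ 2) (hqs : Summable fun j => q j ^ 2) :
    (∑' j, p j * q j) ^ 2 ≤ (∑' j, p j ^ 2) * ∑' j, q j ^ 2 := by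
  have h := Real.inner_le_Lp_mul_Lq_tsum_of_nonneg Real.HolderConjugate.two_two hp hq
    (by simpa only [Real.rpow_two] using hps) (by simpa only [Real.rpow_two] using hqs)
  simp only [Real.rpow_two, ← Real.sqrt_eq_rpow] at h
  have h0 : 0 ≤ ∑' j, p j * q j := tsum_nonneg fun j => mul_nonneg (hp j) (hq j)
  have h1 : 0 ≤ ∑' j, p j ^ 2 := tsum_nonneg fun j => sq_nonneg _
  have h2 : 0 ≤ ∑' j, q j ^ 2 := tsum_nonneg fun j => sq_nonneg _
  calc _ ≤ (√(∑' j, p j ^ 2) * √(∑' j, q j ^ 2)) ^ 2 := pow_le_pow_left₀ h0 h 2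
    _ = _ := by rw [mul_pow, Real.sq_sqrt h1, Real.sq_sqrt h2]

/-- Cauchy–Schwarz over the scales; splitting off `scale j ^ (ε/2)` makes the other factor's sum
converge at the cost of `ε` in the exponent. -/
theorem lacunary_sq_le {α ε : ℝ} (hε : 0 < ε) (hαε : 0 < 2 * (1 - α) - ε) (ξ : ℝ) :
    ENNReal.ofReal (lacunary α ξ ^ 2) ≤ ENNReal.ofReal (∑' j, scale j ^ ε) *
      ∑' j, ENNReal.ofReal (scale j ^ (2 * (1 - α) - ε) *
        Real.exp (-(2 * scale j ^ 2 * ξ ^ 2))) := by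
  have hsq : ∀ (κ : ℝ) (j : ℕ), (scale j ^ κ) ^ 2 = scale j ^ (2 * κ) := fun κ j => by
    rw [← Real.rpow_natCast, ← Real.rpow_mul (scale_pos j).le]
    congr 1; push_cast; ring
  have hp2 : ∀ j, (scale j ^ (ε / 2)) ^ 2 = scale j ^ ε := fun j => by
    rw [hsq]; congr 1; ring
  have hq2 : ∀ j, (scale j ^ (1 - α - ε / 2) * Real.exp (-(scale j ^ 2 * ξ ^ 2))) ^ 2 =
      scale j ^ (2 * (1 - α) - ε) * Real.exp (-(2 * scale j ^ 2 * ξ ^ 2)) := fun j => by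
    rw [mul_pow, hsq, ← Real.exp_nat_mul]
    congr 2
    · ring
    · push_cast; ring
  have hqs : Summable fun j => scale j ^ (2 * (1 - α) - ε) *
      Real.exp (-(2 * scale j ^ 2 * ξ ^ 2)) :=
    (summable_scale_rpow hαε).of_nonneg_of_le
      (fun j => mul_nonneg (Real.rpow_nonneg (scale_pos j).le _) (Real.exp_pos _).le)
      fun j => mul_le_of_le_one_right (Real.rpow_nonneg (scale_pos j).le _)
        (exp_neg_mul_sq_le_one (by positivity) ξ)
  have h := sq_tsum_mul_le (p := fun j => scale j ^ (ε / 2))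
    (q := fun j => scale j ^ (1 - α - ε / 2) * Real.exp (-(scale j ^ 2 * ξ ^ 2)))
    (fun j => Real.rpow_nonneg (scale_pos j).le _)
    (fun j => mul_nonneg (Real.rpow_nonneg (scale_pos j).le _) (Real.exp_pos _).le)
    (by simpa only [hp2] using summable_scale_rpow hε) (by simpa only [hq2] using hqs)
  simp only [hp2, hq2] at h
  have hl : ∑' j, scale j ^ (ε / 2) *
      (scale j ^ (1 - α - ε / 2) * Real.exp (-(scale j ^ 2 * ξ ^ 2))) = lacunary α ξ := by
    rw [lacunary]
    refine tsum_congr fun j => ?_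
    rw [← mul_assoc, ← Real.rpow_add (scale_pos j)]
    congr 2; ring
  rw [hl] at h
  rw [← ENNReal.ofReal_tsum_of_nonneg (fun j => mul_nonneg (Real.rpow_nonneg (scale_pos j).le _)
    (Real.exp_pos _).le) hqs, ← ENNReal.ofReal_mul
    (tsum_nonneg fun j => Real.rpow_nonneg (scale_pos j).le _)]
  exact ENNReal.ofReal_le_ofReal h

theorem lintegral_lacunary_ne_top {μ : Measure ℝ} [IsProbabilityMeasure μ]
    (hsupp : μ (Metric.ball (0 : ℝ) 1)ᶜ = 0) {α s c : ℝ} (hα : 0 < α)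
    (hαs : α < 1 - 2 * s) (hs : 0 ≤ s) (hc : 0 ≤ c)
    (hball : ∀ x r, 0 < r → μ (Metric.ball x r) ≤ ENNReal.ofReal (c * r ^ α)) :
    ∫⁻ ξ, ENNReal.ofReal ((1 + |ξ| ^ 2) ^ s) *
      ‖(lacunary α ξ : ℂ) * measureHat μ ξ‖ₑ ^ 2 ≠ ∞ := by
  -- The exponent of the final sum over scales is `1 - 2s - α - 2ε`, kept positive by the first
  -- entry; the second keeps `α - ε` positive.
  set ε := min ((1 - 2 * s - α) / 4) (α / 2) with hε
  have hε0 : 0 < ε := lt_min (by linarith) (by linarith)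
  have hε1 : ε ≤ (1 - 2 * s - α) / 4 := min_le_left _ _
  have hε2 : ε ≤ α / 2 := min_le_right _ _
  obtain ⟨C, hC⟩ := exists_energy_le (β := α - ε) (s := s) hsupp (by linarith) (by linarith)
    (by linarith) hs (by linarith) hc hball
  have hαε : 0 < 2 * (1 - α) - ε := by linarith
  have hm := measurable_measureHat μ
  have hpt : ∀ ξ, ENNReal.ofReal ((1 + |ξ| ^ 2) ^ s) *
      ‖(lacunary α ξ : ℂ) * measureHat μ ξ‖ₑ ^ 2 ≤ ENNReal.ofReal (∑' j, scale j ^ ε) *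
      ∑' j, ENNReal.ofReal (scale j ^ (2 * (1 - α) - ε)) *
        (ENNReal.ofReal ((1 + |ξ| ^ 2) ^ s * Real.exp (-(2 * scale j ^ 2 * ξ ^ 2))) *
          ‖measureHat μ ξ‖ₑ ^ 2) := by
    intro ξ
    have h1 : ‖(lacunary α ξ : ℂ)‖ₑ ^ 2 = ENNReal.ofReal (lacunary α ξ ^ 2) := by
      rw [← ofReal_norm, Complex.norm_real, ← ENNReal.ofReal_pow (norm_nonneg _),
        Real.norm_eq_abs, sq_abs]
    have hw : 0 ≤ (1 + |ξ| ^ 2) ^ s := by positivity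
    rw [enorm_mul, mul_pow, h1]
    calc _ ≤ ENNReal.ofReal ((1 + |ξ| ^ 2) ^ s) * ((ENNReal.ofReal (∑' j, scale j ^ ε) *
          ∑' j, ENNReal.ofReal (scale j ^ (2 * (1 - α) - ε) *
            Real.exp (-(2 * scale j ^ 2 * ξ ^ 2)))) * ‖measureHat μ ξ‖ₑ ^ 2) := by
          gcongr
          exact lacunary_sq_le hε0 hαε ξ
      _ = ENNReal.ofReal (∑' j, scale j ^ ε) * (ENNReal.ofReal ((1 + |ξ| ^ 2) ^ s) *
          ((∑' j, ENNReal.ofReal (scale j ^ (2 * (1 - α) - ε) *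
            Real.exp (-(2 * scale j ^ 2 * ξ ^ 2)))) * ‖measureHat μ ξ‖ₑ ^ 2)) := by ring
      _ = _ := by
          rw [← ENNReal.tsum_mul_right, ← ENNReal.tsum_mul_left]
          congr 1
          refine tsum_congr fun j => ?_
          rw [ENNReal.ofReal_mul (Real.rpow_nonneg (scale_pos j).le _), ENNReal.ofReal_mul hw]
          ring
  have hmeas : ∀ j, Measurable fun ξ : ℝ => ENNReal.ofReal (scale j ^ (2 * (1 - α) - ε)) *
        (ENNReal.ofReal ((1 + |ξ| ^ 2) ^ s * Real.exp (-(2 * scale j ^ 2 * ξ ^ 2))) *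
          ‖measureHat μ ξ‖ₑ ^ 2) := fun j => by fun_prop
  refine ne_top_of_le_ne_top ?_ (lintegral_mono hpt)
  rw [lintegral_const_mul _ (Measurable.tsum hmeas),
    lintegral_tsum fun j => (hmeas j).aemeasurable]
  refine ENNReal.mul_ne_top ENNReal.ofReal_ne_top ?_
  have hκ : 0 < 2 * (1 - α) - ε + (α - ε - 2 * s - 1) := by linarith
  refine ne_top_of_le_ne_top (b := ∑' j, C * ENNReal.ofReal
    (scale j ^ (2 * (1 - α) - ε + (α - ε - 2 * s - 1)))) ?_ (ENNReal.tsum_le_tsum fun j => ?_)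
  · rw [ENNReal.tsum_mul_left]
    exact ENNReal.mul_ne_top ENNReal.coe_ne_top (summable_scale_rpow hκ).tsum_ofReal_ne_top
  · rw [lintegral_const_mul _ (by fun_prop), Real.rpow_add (scale_pos j),
      ENNReal.ofReal_mul (Real.rpow_nonneg (scale_pos j).le _)]
    calc _ ≤ ENNReal.ofReal (scale j ^ (2 * (1 - α) - ε)) *
          (C * ENNReal.ofReal (scale j ^ (α - ε - 2 * s - 1))) :=
          mul_le_mul' le_rfl (hC (scale j) (scale_pos j) (scale_le_one j))
      _ = _ := by ring

/-- At time `0` the truncation is one more Gaussian multiplier, so the width parameters add up and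
the result is `μ` convolved with a positive Gaussian. -/
theorem integral_osc_mul_gaussian_measureHat (μ : Measure ℝ) [IsProbabilityMeasure μ] (N : ℕ)
    (x : ℝ) {δ : ℝ} (hδ : 0 < δ) :
    ∫ ξ, osc N 0 x ξ * (((Real.exp (-(δ ^ 2 * ξ ^ 2)) : ℝ) : ℂ) * measureHat μ ξ) =
      ((∫ y, √(Real.pi / (δ ^ 2 + 1 / (N : ℝ) ^ 2)) *
        Real.exp (-(x - y) ^ 2 / (4 * (δ ^ 2 + 1 / (N : ℝ) ^ 2))) ∂μ : ℝ) : ℂ) := by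
  set v := δ ^ 2 + 1 / (N : ℝ) ^ 2 with hv
  have hv0 : 0 < v := by positivity
  have h1 : ∀ ξ, osc N 0 x ξ * (((Real.exp (-(δ ^ 2 * ξ ^ 2)) : ℝ) : ℂ) * measureHat μ ξ) =
      ∫ y, Complex.exp (Complex.I * ((x - y) * ξ : ℝ)) *
        ((Real.exp (-(v * ξ ^ 2)) : ℝ) : ℂ) ∂μ := by
    intro ξ
    have h2 : Real.exp (-(v * ξ ^ 2)) = psi (|ξ| / N) * Real.exp (-(δ ^ 2 * ξ ^ 2)) := by
      rw [psi_div_eq, ← Real.exp_add, hv]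
      congr 1; ring
    rw [measureHat, ← mul_assoc, ← integral_const_mul]
    refine integral_congr_ae (Eventually.of_forall fun y => ?_)
    simp only [osc]
    rw [h2, zero_mul, Complex.ofReal_zero, mul_zero, Complex.exp_zero,
      show Complex.I * (((x - y) * ξ : ℝ) : ℂ) =
        Complex.I * ((x * ξ : ℝ) : ℂ) + -(Complex.I * ((y * ξ : ℝ) : ℂ)) by push_cast; ring,
      Complex.exp_add]
    push_cast
    ring
  simp only [h1]
  have hmeas : Measurable (Function.uncurry fun ξ y : ℝ =>
      Complex.exp (Complex.I * ((x - y) * ξ : ℝ)) * ((Real.exp (-(v * ξ ^ 2)) : ℝ) : ℂ)) := by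
    unfold Function.uncurry
    fun_prop
  have hint : Integrable (Function.uncurry fun ξ y : ℝ =>
      Complex.exp (Complex.I * ((x - y) * ξ : ℝ)) * ((Real.exp (-(v * ξ ^ 2)) : ℝ) : ℂ))
      (volume.prod μ) := by
    refine ((integrable_exp_neg_mul_sq' hv0).comp_fst μ).mono' hmeas.aestronglyMeasurable
      (Eventually.of_forall fun z => ?_)
    simp only [Function.uncurry]
    rw [norm_mul, mul_comm Complex.I, Complex.norm_exp_ofReal_mul_I, one_mul, Complex.norm_real,
      Real.norm_of_nonneg (Real.exp_pos _).le]
  rw [integral_integral_swap hint, ← integral_complex_ofReal]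
  exact integral_congr_ae (Eventually.of_forall fun y => integral_exp_mul_gaussian hv0 (x - y))

/-- On the ball of radius `δ`, of mass at least `δ^α/2`, the Gaussian kernel is at least `δ^{-1}/2`;
the powers of `δ` cancel. -/
theorem quarter_le_gaussian_potential {μ : Measure ℝ} [IsProbabilityMeasure μ] {α x δ v : ℝ}
    (hδ : 0 < δ) (hv : δ ^ 2 ≤ v) (hv2 : v ≤ 2 * δ ^ 2)
    (hlow : ENNReal.ofReal (1 / 2 * δ ^ α) ≤ μ (Metric.ball x δ)) :
    1 / 4 ≤ δ ^ (1 - α) *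
      ∫ y, √(Real.pi / v) * Real.exp (-(x - y) ^ 2 / (4 * v)) ∂μ := by
  have hv0 : 0 < v := lt_of_lt_of_le (by positivity) hv
  have hlow' : 1 / 2 * δ ^ α ≤ μ.real (Metric.ball x δ) :=
    (ENNReal.ofReal_le_iff_le_toReal (measure_ne_top _ _)).1 hlow
  have hsqrt : δ⁻¹ ≤ √(Real.pi / v) := by
    refine Real.le_sqrt_of_sq_le ?_
    rw [inv_pow, ← one_div, div_le_div_iff₀ (by positivity) hv0]
    nlinarith [Real.pi_gt_three, sq_nonneg δ]
  have hpt : ∀ y, (Metric.ball x δ).indicator (fun _ => δ⁻¹ * (1 / 2)) y ≤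
      √(Real.pi / v) * Real.exp (-(x - y) ^ 2 / (4 * v)) := by
    intro y
    by_cases hy : y ∈ Metric.ball x δ
    · rw [Set.indicator_of_mem hy]
      refine mul_le_mul hsqrt ?_ (by norm_num) (by positivity)
      rw [Metric.mem_ball, Real.dist_eq, abs_sub_comm] at hy
      have h1 : (x - y) ^ 2 ≤ v := by
        rw [← sq_abs]
        exact (pow_le_pow_left₀ (abs_nonneg _) hy.le 2).trans hv
      have h2 : -(1 / 4) ≤ -(x - y) ^ 2 / (4 * v) := by
        rw [le_div_iff₀ (by positivity)]; linarith
      have h3 := Real.add_one_le_exp (-(x - y) ^ 2 / (4 * v))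
      linarith
    · rw [Set.indicator_of_notMem hy]; positivity
  have hint : Integrable (fun y => √(Real.pi / v) * Real.exp (-(x - y) ^ 2 / (4 * v))) μ := by
    refine Integrable.of_bound (C := √(Real.pi / v)) (by fun_prop) (Eventually.of_forall fun y => ?_)
    rw [Real.norm_of_nonneg (by positivity)]
    refine mul_le_of_le_one_right (by positivity) (Real.exp_le_one_iff.2 ?_)
    exact div_nonpos_of_nonpos_of_nonneg (neg_nonpos.2 (sq_nonneg _)) (by positivity)
  have hle := integral_mono ((integrable_const (δ⁻¹ * (1 / 2))).indicator
    (measurableSet_ball (x := x) (ε := δ))) hint hpt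
  rw [integral_indicator_const _ measurableSet_ball, smul_eq_mul] at hle
  have hpow : δ ^ (1 - α) * (δ ^ α * δ⁻¹) = 1 := by
    rw [← Real.rpow_neg_one, ← Real.rpow_add hδ, ← Real.rpow_add hδ,
      show 1 - α + (α + -1) = 0 by ring, Real.rpow_zero]
  calc (1 / 4 : ℝ) = δ ^ (1 - α) * ((1 / 2 * δ ^ α) * (δ⁻¹ * (1 / 2))) := by
        linear_combination (-1 / 4) * hpow
    _ ≤ δ ^ (1 - α) * (μ.real (Metric.ball x δ) * (δ⁻¹ * (1 / 2))) := by gcongr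
    _ ≤ _ := mul_le_mul_of_nonneg_left hle (Real.rpow_nonneg hδ.le _)

/-- All scales contribute nonnegatively. For `j ≤ n` the cut-off at `N = 2^n` at most doubles the
width parameter `scale j ^ 2`, so each of these `n + 1` scales contributes at least `1/4`. -/
theorem le_re_integral_osc_lacunary {μ : Measure ℝ} [IsProbabilityMeasure μ] {α x : ℝ}
    (hα1 : α < 1) (hlow : ∀ r, 0 < r → r ≤ 1 →
      ENNReal.ofReal (1 / 2 * r ^ α) ≤ μ (Metric.ball x r)) (n : ℕ) :
    ((n : ℝ) + 1) / 4 ≤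
      (∫ ξ, osc (2 ^ n) 0 x ξ * ((lacunary α ξ : ℂ) * measureHat μ ξ)).re := by
  set N : ℕ := 2 ^ n with hN
  have hN1 : 1 ≤ N := Nat.one_le_two_pow
  have hN0 : (0 : ℝ) < N := by exact_mod_cast hN1
  set F : ℕ → ℝ → ℂ := fun j ξ => ((scale j ^ (1 - α) : ℝ) : ℂ) *
    (osc N 0 x ξ * (((Real.exp (-(scale j ^ 2 * ξ ^ 2)) : ℝ) : ℂ) * measureHat μ ξ)) with hF
  have hpi : Integrable fun ξ => psi (|ξ| / N) := by
    simp only [psi_div_eq]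
    exact integrable_exp_neg_mul_sq' (by positivity)
  have hFn : ∀ j ξ, ‖F j ξ‖ ≤ scale j ^ (1 - α) * psi (|ξ| / N) := by
    intro j ξ
    simp only [hF]
    rw [norm_mul, norm_mul, norm_mul, Complex.norm_real, Complex.norm_real, norm_osc,
      Real.norm_of_nonneg (Real.rpow_nonneg (scale_pos j).le _),
      Real.norm_of_nonneg (Real.exp_pos _).le]
    refine mul_le_mul_of_nonneg_left ?_ (Real.rpow_nonneg (scale_pos j).le _)
    exact mul_le_of_le_one_right (psi_nonneg _) (mul_le_one₀
      (exp_neg_mul_sq_le_one (sq_nonneg _) ξ) (norm_nonneg _) (norm_measureHat_le μ ξ))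
  have hFm : ∀ j, Measurable (F j) := fun j => by
    have h1 := (continuous_osc N 0 x).measurable
    have h2 := measurable_measureHat μ
    simp only [hF]
    fun_prop
  have hFi : ∀ j, Integrable (F j) := fun j =>
    (hpi.const_mul _).mono' (hFm j).aestronglyMeasurable (Eventually.of_forall (hFn j))
  have hFs : Summable fun j => ∫ ξ, ‖F j ξ‖ := by
    refine ((summable_scale_rpow (by linarith : 0 < 1 - α)).mul_right
      (∫ ξ, psi (|ξ| / N))).of_nonneg_of_le (fun j => integral_nonneg fun ξ => norm_nonneg _)
      fun j => ?_
    rw [← integral_const_mul]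
    exact integral_mono (hFi j).norm (hpi.const_mul _) (hFn j)
  have hsum := hasSum_integral_of_summable_integral_norm hFi hFs
  have hT : ∀ ξ, ∑' j, F j ξ = osc N 0 x ξ * ((lacunary α ξ : ℂ) * measureHat μ ξ) := by
    intro ξ
    have h1 : ((lacunary α ξ : ℝ) : ℂ) = ∑' j, ((scale j ^ (1 - α) *
        Real.exp (-(scale j ^ 2 * ξ ^ 2)) : ℝ) : ℂ) := by
      rw [lacunary, Complex.ofReal_tsum]
    rw [h1, ← tsum_mul_right, ← tsum_mul_left]
    refine tsum_congr fun j => ?_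
    simp only [hF]
    push_cast
    ring
  simp only [hT] at hsum
  set P : ℕ → ℝ := fun j => scale j ^ (1 - α) *
    ∫ y, √(Real.pi / (scale j ^ 2 + 1 / (N : ℝ) ^ 2)) *
      Real.exp (-(x - y) ^ 2 / (4 * (scale j ^ 2 + 1 / (N : ℝ) ^ 2))) ∂μ with hP
  have hFP : ∀ j, ∫ ξ, F j ξ = ((P j : ℝ) : ℂ) := by
    intro j
    simp only [hF, hP]
    rw [integral_const_mul, integral_osc_mul_gaussian_measureHat μ N x (scale_pos j)]
    push_cast
    rfl
  simp only [hFP] at hsum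
  have hre := Complex.hasSum_re hsum
  simp only [Complex.ofReal_re] at hre
  have hP0 : ∀ j, 0 ≤ P j := fun j =>
    mul_nonneg (Real.rpow_nonneg (scale_pos j).le _) (integral_nonneg fun y => by positivity)
  refine le_trans ?_ (sum_le_hasSum (Finset.range (n + 1)) (fun j _ => hP0 j) hre)
  have hterm : ∀ j ∈ Finset.range (n + 1), (1 / 4 : ℝ) ≤ P j := by
    intro j hj
    have hjn : j ≤ n := Nat.lt_succ_iff.1 (Finset.mem_range.1 hj)
    have hsc : 1 / (N : ℝ) ^ 2 ≤ scale j ^ 2 := by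
      rw [one_div, ← inv_pow]
      refine pow_le_pow_left₀ (by positivity) ?_ 2
      have : (N : ℝ)⁻¹ = (1 / 2) ^ n := by rw [hN]; push_cast; rw [one_div, inv_pow]
      rw [this]
      exact pow_le_pow_of_le_one (by norm_num) (by norm_num) hjn
    exact quarter_le_gaussian_potential (scale_pos j) (le_add_of_nonneg_right (by positivity))
      (by linarith) (hlow _ (scale_pos j) (scale_le_one j))
  calc ((n : ℝ) + 1) / 4 = ∑ _j ∈ Finset.range (n + 1), (1 / 4 : ℝ) := by
        rw [Finset.sum_const, Finset.card_range, nsmul_eq_mul]; push_cast; ring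
    _ ≤ _ := Finset.sum_le_sum hterm

/-- Below the exponent `1 - 2s` there are an `α`-dimensional measure and a function in `H^s`
whose truncations blow up almost everywhere with respect to the measure. -/
theorem exists_blowup {α s : ℝ} (hs : 0 ≤ s) (hα : 0 < α) (hαs : α < 1 - 2 * s) :
    ∃ (μ : Measure ℝ) (E : Set ℝ) (f : LTwo), IsDimensional α μ ∧ μ Eᶜ = 0 ∧
      f ∈ sobolevSpace s ∧ ∀ x ∈ E, ∀ n : ℕ, ((n : ℝ) + 1) / 32 ≤ ‖truncated (2 ^ n) 0 f x‖ := by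
  have hα1 : α < 1 := by linarith
  obtain ⟨μ, E, c, hprob, hsupp, hE, hc, hup, hlow⟩ := exists_regular_measure hα hα1
  have hm := measurable_measureHat μ
  set g : ℝ → ℂ := fun ξ => (lacunary α ξ : ℂ) * measureHat μ ξ with hg
  have hgm : Measurable g :=
    (Complex.measurable_ofReal.comp (continuous_lacunary hα1).measurable).mul hm
  have hfin := lintegral_lacunary_ne_top hsupp hα hαs hs hc hup
  have hgL : MemLp g 2 volume := by
    refine ⟨hgm.aestronglyMeasurable, ?_⟩
    rw [eLpNorm_lt_top_iff_lintegral_rpow_enorm_lt_top (by norm_num) (by norm_num)]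
    refine (lintegral_mono fun ξ => ?_).trans_lt hfin.lt_top
    rw [ENNReal.toReal_ofNat, ENNReal.rpow_two]
    refine le_mul_of_one_le_left zero_le (ENNReal.one_le_ofReal.2 ?_)
    exact Real.one_le_rpow (by nlinarith [sq_nonneg |ξ|]) hs
  obtain ⟨f, hf⟩ := exists_hat_ae_eq hgL
  refine ⟨μ, E, f, ⟨hα, hα1.le, hprob, hsupp, ?_⟩, hE, ?_, ?_⟩
  · refine (iSup_le fun x => iSup_le fun r => iSup_le fun hr => ?_).trans_lt
      (ENNReal.ofReal_lt_top (r := c))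
    calc _ ≤ ENNReal.ofReal (r ^ (-α)) * ENNReal.ofReal (c * r ^ α) :=
          mul_le_mul' le_rfl (hup x r hr)
      _ = ENNReal.ofReal c := by
          rw [← ENNReal.ofReal_mul (by positivity), mul_left_comm, ← Real.rpow_add hr,
            neg_add_cancel, Real.rpow_zero, mul_one]
  · refine (ENNReal.rpow_lt_top_iff_of_pos (by norm_num)).2 ?_
    rw [lintegral_congr_ae (g := fun ξ => ENNReal.ofReal ((1 + |ξ| ^ 2) ^ s) * ‖g ξ‖ₑ ^ 2)]
    · exact hfin.lt_top
    · filter_upwards [hf] with ξ hξ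
      rw [hξ]
  · intro x hx n
    have h1 := le_re_integral_osc_lacunary hα1 (hlow x hx) n
    have h2 : ∫ ξ, osc (2 ^ n) 0 x ξ * hat f ξ =
        ∫ ξ, osc (2 ^ n) 0 x ξ * ((lacunary α ξ : ℂ) * measureHat μ ξ) := by
      refine integral_congr_ae ?_
      filter_upwards [hf] with ξ hξ
      rw [hξ]
    rw [truncated_eq, h2, norm_mul, Complex.norm_real, Real.norm_of_nonneg (by positivity)]
    have h3 := h1.trans ((le_abs_self _).trans (Complex.abs_re_le_norm _))
    -- The crude bound `π < 4`; together with `1/4` per scale it gives `1/32`.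
    have h4 : (1 / 8 : ℝ) ≤ (2 * Real.pi)⁻¹ := by
      rw [one_div]
      exact inv_anti₀ (by positivity) (by linarith [Real.pi_lt_four])
    calc ((n : ℝ) + 1) / 32 = 1 / 8 * (((n : ℝ) + 1) / 4) := by ring
      _ ≤ _ := mul_le_mul h4 h3 (by positivity) (by positivity)

/-! ### Lower bounds for the two exponents. -/

theorem not_convergesAt_of_blowup {f : LTwo} {x : ℝ}
    (h : ∀ n : ℕ, ((n : ℝ) + 1) / 32 ≤ ‖truncated (2 ^ n) 0 f x‖) : ¬ ConvergesAt f x := by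
  rintro ⟨u, hu, _⟩
  have h1 := (hu.self_of_nhds.comp (tendsto_pow_atTop_atTop_of_one_lt one_lt_two)).norm
  have h2 : Tendsto (fun n : ℕ => ((n : ℝ) + 1) / 32) atTop atTop :=
    (tendsto_natCast_atTop_atTop.atTop_add tendsto_const_nhds).atTop_div_const (by norm_num)
  exact not_tendsto_nhds_of_tendsto_atTop (tendsto_atTop_mono h h2) _ h1

/-- The sequence need not contain the time `0`, but each truncation is continuous in time, so its
value at `0` is a limit of values bounded by the maximal function. -/
theorem maximal_eq_top_of_blowup {s : ℝ} (hs : 0 ≤ s) {f : LTwo} (hf : f ∈ sobolevSpace s) {x : ℝ}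
    (h : ∀ n : ℕ, ((n : ℝ) + 1) / 32 ≤ ‖truncated (2 ^ n) 0 f x‖) {t : ℕ → ℝ}
    (ht : Tendsto t atTop (𝓝 0)) : maximal t f x = ∞ := by
  have hcont : ∀ N : ℕ, 1 ≤ N → Continuous fun u => truncated N u f x := by
    intro N hN
    simp only [truncated_eq]
    refine continuous_const.mul (continuous_of_dominated
      (bound := fun ξ => ‖osc N 0 x ξ * hat f ξ‖)
      (fun u => ((continuous_osc N u x).measurable.mul (measurable_hat f)).aestronglyMeasurable)
      (fun u => Eventually.of_forall fun ξ => ?_)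
      (integrable_osc_mul (memLp_hat hs hf) hN 0 x).norm
      (Eventually.of_forall fun ξ => (continuous_osc_time N x ξ).mul continuous_const))
    rw [norm_mul, norm_mul, norm_osc, norm_osc]
  refine top_le_iff.1 (le_of_tendsto' (ENNReal.tendsto_ofReal_atTop.comp
    ((tendsto_natCast_atTop_atTop (R := ℝ)).atTop_add
      (tendsto_const_nhds (x := (1 : ℝ))) |>.atTop_div_const (by norm_num : (0 : ℝ) < 32)))
    fun n => ?_)
  have h1 : ‖truncated (2 ^ n) 0 f x‖ₑ ≤ maximal t f x :=
    le_of_tendsto' (((hcont (2 ^ n) Nat.one_le_two_pow).tendsto 0).comp ht).enorm fun k =>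
      le_iSup_of_le k (le_iSup_of_le (⟨2 ^ n, by positivity⟩ : ℕ+) le_rfl)
  refine le_trans ?_ h1
  rw [← ofReal_norm]
  exact ENNReal.ofReal_le_ofReal (h n)

theorem le_alphaBar {s : ℝ} (hs : 0 ≤ s) : ENNReal.ofReal (1 - 2 * s) ≤ alphaBar s := by
  refine le_iInf₂ fun α hα => ENNReal.ofReal_le_ofReal ?_
  by_contra! hlt
  obtain ⟨h0, h1, C, hC⟩ := hα
  obtain ⟨μ, E, f, hμ, hE, hf, hblow⟩ := exists_blowup hs h0 hlt
  have := hμ.isProbabilityMeasure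
  have ht : Tendsto (fun k : ℕ => 1 / ((k : ℝ) + 1)) atTop (𝓝 0) :=
    tendsto_one_div_add_atTop_nhds_zero_nat
  have hle := hC μ hμ f hf (fun k => 1 / ((k : ℝ) + 1)) fun k => by positivity
  have htop : ∫⁻ x, maximal (fun k => 1 / ((k : ℝ) + 1)) f x ∂μ = ∞ := by
    have hae : ∀ᵐ x ∂μ, x ∈ E := by rw [ae_iff]; exact hE
    rw [lintegral_congr_ae (g := fun _ => ∞)]
    · simp
    · filter_upwards [hae] with x hx
      exact maximal_eq_top_of_blowup hs hf (hblow x hx) ht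
  rw [htop, top_le_iff] at hle
  refine ENNReal.mul_ne_top (ENNReal.mul_ne_top ENNReal.coe_ne_top ?_) ?_ hle
  · exact ENNReal.rpow_ne_top_of_nonneg (by norm_num) hμ.densityConst_lt_top.ne
  · exact ne_of_lt hf

/-- The mass distribution principle. -/
theorem le_dimH_of_isDimensional {α : ℝ} {μ : Measure ℝ} (hμ : IsDimensional α μ) {E : Set ℝ}
    (hE : μ E ≠ 0) : ENNReal.ofReal α ≤ dimH E := by
  have hα := hμ.pos
  have := hμ.isProbabilityMeasure
  set D := densityConst α μ with hD
  have hDt : D ≠ ∞ := hμ.densityConst_lt_top.ne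
  have h2 : ENNReal.ofReal (2 ^ α) ≠ ∞ := ENNReal.ofReal_ne_top
  -- The factor `2^α` comes from enclosing a set of diameter `d` in an open ball of radius `2d`; the
  -- summand `1` makes `K` invertible.
  set K := D * ENNReal.ofReal (2 ^ α) + 1 with hK
  have hK0 : K ≠ 0 := by simp [hK]
  have hKt : K ≠ ∞ := ENNReal.add_ne_top.2 ⟨ENNReal.mul_ne_top hDt h2, ENNReal.one_ne_top⟩
  -- Sets of diameter `0` lie in no ball of radius comparable to their diameter and need separate
  -- treatment.
  have hsing : ∀ x, μ {x} = 0 := by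
    intro x
    have hlim : Tendsto (fun r : ℝ => D * ENNReal.ofReal (r ^ α)) (𝓝[>] 0) (𝓝 0) := by
      have h3 : Tendsto (fun r : ℝ => r ^ α) (𝓝[>] 0) (𝓝 0) := by
        have := (Real.continuousAt_rpow_const 0 α (Or.inr hα.le)).tendsto
        rw [Real.zero_rpow hα.ne'] at this
        exact this.mono_left nhdsWithin_le_nhds
      have h4 := ENNReal.Tendsto.const_mul (a := D) (ENNReal.tendsto_ofReal h3) (Or.inr hDt)
      simpa using h4
    refine le_antisymm (ge_of_tendsto hlim ?_) zero_le
    filter_upwards [self_mem_nhdsWithin] with r hr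
    refine (measure_mono ?_).trans (measure_ball_le_densityConst α μ x hr)
    exact Set.singleton_subset_iff.2 (Metric.mem_ball_self hr)
  have hdiam : ∀ s : Set ℝ, Metric.ediam s ≤ 1 → (K⁻¹ • μ) s ≤ Metric.ediam s ^ α := by
    intro s hs
    rw [Measure.smul_apply, smul_eq_mul]
    rcases s.eq_empty_or_nonempty with h0 | ⟨x, hx⟩
    · rw [h0, measure_empty, mul_zero]; exact zero_le
    rcases eq_or_ne (Metric.ediam s) 0 with hd | hd
    · have hsub : s ⊆ {x} := fun y hy =>
        (Metric.ediam_eq_zero_iff.1 hd) hy hx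
      rw [measure_mono_null hsub (hsing x), mul_zero]; exact zero_le
    have hdt : Metric.ediam s ≠ ∞ := ne_top_of_le_ne_top ENNReal.one_ne_top hs
    set d := (Metric.ediam s).toReal with hdd
    have hd0 : 0 < d := ENNReal.toReal_pos hd hdt
    have hde : Metric.ediam s = ENNReal.ofReal d := (ENNReal.ofReal_toReal hdt).symm
    have hsub : s ⊆ Metric.ball x (2 * d) := by
      intro y hy
      have h3 := Metric.edist_le_ediam_of_mem hy hx
      rw [hde, edist_dist, ENNReal.ofReal_le_ofReal_iff hd0.le] at h3
      rw [Metric.mem_ball]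
      linarith
    have h4 : μ s ≤ K * Metric.ediam s ^ α := by
      calc μ s ≤ D * ENNReal.ofReal ((2 * d) ^ α) :=
            (measure_mono hsub).trans (measure_ball_le_densityConst α μ x (by linarith))
        _ = D * ENNReal.ofReal (2 ^ α) * Metric.ediam s ^ α := by
            rw [Real.mul_rpow (by norm_num) hd0.le, ENNReal.ofReal_mul (by positivity), hde,
              ENNReal.ofReal_rpow_of_pos hd0, mul_assoc]
        _ ≤ _ := by gcongr; exact le_self_add
    calc K⁻¹ * μ s ≤ K⁻¹ * (K * Metric.ediam s ^ α) := by gcongr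
      _ = _ := by rw [← mul_assoc, ENNReal.inv_mul_cancel hK0 hKt, one_mul]
  have hle := Measure.le_hausdorffMeasure α (K⁻¹ • μ) 1 one_pos hdiam
  refine le_dimH_of_hausdorffMeasure_ne_zero (d := α.toNNReal) ?_
  rw [Real.coe_toNNReal α hα.le]
  intro h0
  have h5 : (K⁻¹ • μ) E ≤ 0 := h0 ▸ hle E
  rw [Measure.smul_apply, smul_eq_mul, nonpos_iff_eq_zero, mul_eq_zero] at h5
  exact h5.elim (ENNReal.inv_ne_zero.2 hKt) hE

theorem le_alphaDiv {s : ℝ} (hs : 0 ≤ s) : ENNReal.ofReal (1 - 2 * s) ≤ alphaDiv s := by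
  refine le_of_forall_lt_imp_le_of_dense fun b hb => ?_
  have hbt : b ≠ ∞ := hb.ne_top
  rcases eq_or_ne b 0 with h0 | h0
  · rw [h0]; exact zero_le
  have hα0 : 0 < b.toReal := ENNReal.toReal_pos h0 hbt
  have hα1 : b.toReal < 1 - 2 * s := (ENNReal.lt_ofReal_iff_toReal_lt hbt).1 hb
  obtain ⟨μ, E, f, hμ, hE, hf, hblow⟩ := exists_blowup hs hα0 hα1
  have := hμ.isProbabilityMeasure
  have hEμ : μ E ≠ 0 := fun h => by
    have h1 : μ Set.univ ≤ μ E + μ Eᶜ := by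
      rw [← Set.union_compl_self E]; exact measure_union_le _ _
    rw [h, hE, measure_univ, add_zero] at h1
    exact absurd h1 (by simp)
  rw [← ENNReal.ofReal_toReal hbt]
  calc ENNReal.ofReal b.toReal ≤ dimH E := le_dimH_of_isDimensional hμ hEμ
    _ ≤ dimH (divergenceSet f) := dimH_mono fun x hx => not_convergesAt_of_blowup (hblow x hx)
    _ ≤ alphaDiv s := le_iSup₂_of_le f hf le_rfl

end Boussinesq

theorem theorem1p10 (s : ℝ) (hs : 1 / 4 ≤ s) (hs' : s ≤ 1 / 2) :
    (∀ α : ℝ, 1 - 2 * s < α → ∃ C : ℝ≥0, ∀ μ : Measure ℝ, Boussinesq.IsDimensional α μ →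
      ∀ t : ℕ → ℝ, Tendsto t atTop (𝓝 0) → ∀ f ∈ Boussinesq.sobolevSpace s,
        ∫⁻ x, Boussinesq.maximal t f x ∂μ ≤
          C * Boussinesq.densityConst α μ ^ (1 / 2 : ℝ) * Boussinesq.sobolevNorm s f) ∧
    Boussinesq.alphaBar s = ENNReal.ofReal (1 - 2 * s) ∧
    Boussinesq.alphaDiv s = ENNReal.ofReal (1 - 2 * s) := by
  refine ⟨fun α hα => ?_,
    le_antisymm (Boussinesq.alphaBar_le hs hs') (Boussinesq.le_alphaBar (by linarith)),
    le_antisymm (Boussinesq.alphaDiv_le hs hs') (Boussinesq.le_alphaDiv (by linarith))⟩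
  obtain ⟨C, hC⟩ := Boussinesq.exists_maximal_estimate hs hs' hα
  exact ⟨C, fun μ hμ t _ f hf => hC μ hμ t f hf⟩
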